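/- **Setting.** A QBF $\Psi=Q_1\mathcal X_1\cdots Q_k\mathcal X_k.\,\psi$ is in prenex CNF, closed, every variable is quantified once, and every clause of $\psi=C_1\wedge\dots\wedge C_L$ is universally reduced. The variables are totally ordered consistently with the prefix. Clauses are sets of literals. A *Q-resolution refutation with $R$ steps* is a sequence of clauses $C_1,\dots,C_{L+R}$ that starts with the clauses of $\psi$ and ends with the empty clause, in which each $C_{L+i}$ arises from two earlier clauses $A\ni p$, $B\ni\neg p$ with an existential pivot literal $p$: the resolvent $\bar C_i=(A\setminus\{p\})\cup(B\setminus\{\neg p\})$ contains no complementary pair of literals, and $C_{L+i}$ is $\bar C_i$ without the universal literals that precede no existential literal of $\bar C_i$. Both parties know $\Psi$, $R$, a width $w$ and a degree $d$. A *witness* is an $R$-step refutation (premise indices, pivots, clauses $\bar C_i$, $C_{L+i}$) in which all clauses, including the clauses of $\psi$ and the $\bar C_i$, have at most $w$ literals and each reduction removes at most $d$ literals. **Protocol CheckProof**, in the hybrid model with the ideal functionalities $\mathcal F_{\rm ZK}$, $\mathcal F_{\rm ZKSet}$, $\mathcal F_{\rm FlexZKArray}$, $\mathcal F_{\rm Clause}$,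 $\mathcal F_{\rm OrdLiteral}$, $\mathcal F_{\rm Quantifier}$ (commit-and-prove functionalities, respectively, for circuits, products of polynomials and integer comparisons, for sets, for an append-only array, for clauses of bounded width, for ordered literals, and for the sets $\mathcal L_\exists,\mathcal L_\forall$ of existential and universal literals; each aborts, or sets a flag "cheating", when a claimed relation between committed values fails). The parties commit the public clauses $C_1,\dots,C_L$; the prover commits $C_{L+1},\dots,C_{L+R}$ (width at most $w$); all are stored in the array. For $i=1,\dots,R$ the prover commits a pivot $p$ and $\bar C_i$, reads two premises at private indices smaller than $L+i$, and it is checked that they resolve on $p$ to $\bar C_i$ and that $p\in\mathcal L_\exists$. The prover commits $W_{\rm res}$, $W_{\rm rem}$ and $\{w_\ell\}$, opens their literals into $w$, $d$ and $1$ committed slots, and it is checked that every literal of $W_{\rm res}$ is ordered before $w_\ell$ and every literal of $W_{\rm rem}$ after it, that $w_\ell\in\mathcal L_\exists$ and $W_{\rm rem}\subseteq\mathcal L_\forall$, and that $C_{L+i}=W_{\rm res}\sqcup\{w_\ell\}$ and $\bar C_i=W_{\rm res}\sqcup\{w_\ell\}\sqcup W_{\rm rem}$. (Unused slots, and $w_\ell$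 when $\bar C_i$ has no existential literal, are filled with constants that denote *false*, contribute nothing to a clause, and have fixed places in the order: the filler of $W_{\rm res}$ before the substitute for $w_\ell$, which lies in $\mathcal L_\exists$, before all literals, before the filler of $W_{\rm rem}$, which lies in $\mathcal L_\forall$.) Finally it is checked that $C_{L+R}$ is empty and that neither the array nor $\mathcal F_{\rm Quantifier}$ reports cheating. The verifier accepts if nothing aborts and no cheating is reported. **Theorem.** For every finite field $\mathbb F$ over which the functionalities work, CheckProof is a zero-knowledge proof of knowledge that $\Psi$ is false: 1. *Efficiency*: the commands of the verifier are computed in polynomial time from $(\Psi,R,w,d)$, with $R,w,d$ in unary. 2. *Completeness*: the honest prover with a witness makes the honest verifier accept with probability $1$. 3. *Soundness*: if $\Psi$ is true, no prover, of any power, makes the honest verifier accept with positive probability. 4. *Knowledge soundness, with error $0$*: there is a polynomial-time extractor that, for every probabilistic prover of any power, computes a witness from $(\Psi,R,w,d)$ and the messages that the prover sent to the functionalities in one execution; the probability that the honest verifier accepts and the extractor does not output a witness is $0$. 5. *Perfect zero knowledge*: there is a polynomial-time simulator that receives only $(\Psi,R,w,d)$ and the commands of the verifier (with the answers so far) and produces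 the answers, such that for every probabilistic verifier, of any power, and every witness, the view of the verifier with the simulator is distributed exactly as in the execution with the honest prover. -/

import Mathlib

noncomputable section

namespace QRes

open scoped Classical

/-! ### Quantified Boolean formulas in prenex CNF -/

/-- The two quantifiers. -/
inductive Quant where
  | ex
  | all
  deriving DecidableEq

/-- A literal: a variable with a sign (`true` for `x`, `false` for `¬ x`). -/
@[ext] structure Lit where
  var : ℕ
  sign : Bool

/-- The lexicographic order on literals; it only serves to list finite sets of literals. -/
instance : LinearOrder Lit :=
  LinearOrder.lift' (fun l => toLex (l.var, l.sign)) (by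
    intro a b h
    have h2 : (a.var, a.sign) = (b.var, b.sign) := toLex.injective h
    exact Lit.ext (congrArg Prod.fst h2) (congrArg Prod.snd h2))

instance : Inhabited Lit := ⟨⟨0, true⟩⟩

/-- The complementary literal. -/
def Lit.neg (l : Lit) : Lit := ⟨l.var, !l.sign⟩

/-- A clause is the set of the literals that occur as its disjuncts. -/
abbrev Clause := Finset Lit

/-- A QBF in PCNF: the blocks `Q₁ 𝒳₁, Q₂ 𝒳₂, …` from the outermost to the innermost (the variables
of a block are listed, which fixes a total order consistent with the prefix) and the clauses. -/
structure QBF where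
  blocks : List (Quant × List ℕ)
  matrix : List Clause

namespace QBF

/-- All variables of the prefix, outermost first. -/
def vars (φ : QBF) : List ℕ := φ.blocks.flatMap (fun b => b.2)

/-- The prefix as a list of single quantifications, outermost first. -/
def quants (φ : QBF) : List (Quant × ℕ) := φ.blocks.flatMap (fun b => b.2.map (fun x => (b.1, x)))

/-- The variable `x` is existentially quantified. -/
def IsEx (φ : QBF) (x : ℕ) : Prop := (Quant.ex, x) ∈ φ.quants

/-- The rank of a variable in the total order given by the prefix. -/
def pos (φ : QBF) (x : ℕ) : ℕ := φ.vars.idxOf x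

/-- The literals over the variables that are bound by the quantifier `q`. -/
def lits (φ : QBF) (q : Quant) : List Lit :=
  φ.blocks.flatMap (fun b => if b.1 = q then b.2.flatMap (fun x => [⟨x, false⟩, ⟨x, true⟩]) else [])

/-- Truth of a quantifier prefix followed by a CNF under an assignment of the free variables. -/
def Sat (M : List Clause) : List (Quant × ℕ) → (ℕ → Bool) → Prop
  | [], σ => ∀ C ∈ M, ∃ l ∈ C, σ l.var = l.sign
  | (Quant.ex, x) :: Q, σ => ∃ b, Sat M Q (Function.update σ x b)
  | (Quant.all, x) :: Q, σ => ∀ b, Sat M Q (Function.update σ x b)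

/-- Truth of a closed QBF. -/
def IsTrue (φ : QBF) : Prop := Sat φ.matrix φ.quants (fun _ => false)

/-- Universal reduction: remove every universal literal that is not followed, in the order of the
prefix, by an existential literal of the clause. -/
def forallRed (φ : QBF) (C : Clause) : Clause :=
  C.filter (fun l => φ.IsEx l.var ∨ ∃ m ∈ C, φ.IsEx m.var ∧ φ.pos l.var < φ.pos m.var)

/-- Closed formulas, each variable quantified once, all of whose clauses are universally reduced. -/
structure Admissible (φ : QBF) : Prop where
  nodup : φ.vars.Nodup
  closed : ∀ C ∈ φ.matrix, ∀ l ∈ C, l.var ∈ φ.vars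
  reduced : ∀ C ∈ φ.matrix, φ.forallRed C = C

end QBF

/-! ### Q-resolution refutations -/

/-- The clause contains no complementary pair of literals. -/
def NonTaut (C : Clause) : Prop := ∀ l ∈ C, l.neg ∉ C

/-- `C` is the non-tautological resolvent of `A ∋ p` and `B ∋ ¬ p` on the pivot literal `p`. -/
def IsResolvent (A B : Clause) (p : Lit) (C : Clause) : Prop :=
  p ∈ A ∧ p.neg ∈ B ∧ C = A.erase p ∪ B.erase p.neg ∧ NonTaut C

/-- One derivation step: the (0-based) indices of the premises, the pivot, the resolvent and
the clause that results from the resolvent by universal reduction. -/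
structure Step where
  left : ℕ
  right : ℕ
  pivot : Lit
  bar : Clause
  red : Clause

instance : Inhabited Step := ⟨⟨0, 0, default, ∅, ∅⟩⟩

/-- The sequence of clauses of a derivation: the clauses of the matrix, then the derived ones. -/
def clauseSeq (φ : QBF) (π : List Step) : List Clause := φ.matrix ++ π.map Step.red

/-- The `i`-th step of `π`: existential resolution of two earlier clauses, followed by universal
reduction. -/
def ValidStep (φ : QBF) (π : List Step) (i : ℕ) (s : Step) : Prop :=
  s.left < φ.matrix.length + i ∧ s.right < φ.matrix.length + i ∧
  ∃ A B, (clauseSeq φ π)[s.left]? = some A ∧ (clauseSeq φ π)[s.right]? = some B ∧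
    φ.IsEx s.pivot.var ∧ IsResolvent A B s.pivot s.bar ∧ s.red = φ.forallRed s.bar

/-- `π` is a Q-resolution refutation of `φ`: all steps are valid and the final clause is empty. -/
def IsRefutation (φ : QBF) (π : List Step) : Prop :=
  (∀ i s, π[i]? = some s → ValidStep φ π i s) ∧ (clauseSeq φ π).getLast? = some ∅

/-- The common input: the QBF, the number `R` of derivation steps, the proof width `w` and the
deduction degree `d`. -/
structure Stmt where
  qbf : QBF
  R : ℕ
  w : ℕ
  d : ℕ

/-- The number of clauses of the matrix. -/
def Stmt.L (x : Stmt) : ℕ := x.qbf.matrix.length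

/-- The witness relation: `π` is a Q-resolution refutation with `R` steps in which all clauses have
at most `w` literals and every universal reduction removes at most `d` literals. -/
structure Rel (x : Stmt) (π : List Step) : Prop where
  refutes : IsRefutation x.qbf π
  length : π.length = x.R
  widthInput : ∀ C ∈ x.qbf.matrix, C.card ≤ x.w
  widthStep : ∀ s ∈ π, s.bar.card ≤ x.w ∧ s.red.card ≤ x.w
  degree : ∀ s ∈ π, (s.bar \ s.red).card ≤ x.d

/-! ### The ideal functionalities

Commitments `[v]` are names under which a functionality stores `v`; that a functionality sends `[v]`
to both parties means that it stores `v` under the name that the parties gave for it and confirms.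
A functionality is invoked by both parties jointly: both send a command, and the prover may add a
private input. -/

/-- Literals and three constants, all of which denote the truth value *false*: they fill the unused
slots of a list of fixed length (`padLo`, `padHi`) and stand for the innermost existential literal
of a clause that has no existential literal (`noEx`). -/
inductive Sym where
  | lit (l : Lit)
  | padLo
  | noEx
  | padHi
  deriving DecidableEq

/-- The literals among a list of symbols. -/
def litSet (S : List Sym) : Clause :=
  (S.filterMap (fun s => match s with
    | Sym.lit l => some l
    | _ => none)).toFinset

/-- The order of a symbol under a total order of the variables (given as a list). The constants
`padLo`, `noEx` come before all literals and `padHi` comes after all of them. -/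
def symOrder (vars : List ℕ) : Sym → ℕ
  | Sym.padLo => 0
  | Sym.noEx => 1
  | Sym.lit l => vars.idxOf l.var + 2
  | Sym.padHi => vars.length + 2

/-- The names of the committed values: `cl j` for `[C_j]`; for the `i`-th step: pivot, resolvent,
fetched premises, the clauses `W_res`, `W_rem` and `{w_ℓ}`, the literal `w_ℓ` and its order,
and the `j`-th literal of `W_res` and of `W_rem` with its order. -/
inductive Name where
  | cl (j : ℕ)
  | piv (i : ℕ)
  | bar (i : ℕ)
  | fetL (i : ℕ)
  | fetR (i : ℕ)
  | wRes (i : ℕ)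
  | wRem (i : ℕ)
  | wCl (i : ℕ)
  | wLit (i : ℕ)
  | wOrd (i : ℕ)
  | resLit (i j : ℕ)
  | resOrd (i j : ℕ)
  | remLit (i j : ℕ)
  | remOrd (i j : ℕ)
  deriving DecidableEq

/-- The integer comparisons. -/
inductive CmpOp where
  | gt
  | ge
  | lt
  | le
  deriving DecidableEq

def CmpOp.Holds : CmpOp → ℕ → ℕ → Prop
  | gt, i, j => i > j
  | ge, i, j => i ≥ j
  | lt, i, j => i < j
  | le, i, j => i ≤ j

/-- Commands of the functionality for ordered literals. -/
inductive OrdCmd where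
  | setup (vars : List ℕ)
  | input (dst : Name)
  | order (src dst : Name)

/-- Commands of the functionality for clauses; `common` commits a clause known to both parties. -/
inductive ClauseCmd where
  | common (dst : Name) (C : Clause) (w : ℕ)
  | input (dst : Name) (w : ℕ)
  | retrieval (src : Name) (dst : List Name)
  | equal (c : Name) (cs : List Name)
  | res (c₀ c₁ p c : Name)
  | isFalse (c : Name)

/-- Commands of the append-only array. -/
inductive ArrayCmd where
  | setup (cs : List Name)
  | read (t : ℕ) (dst : Name)
  | check

/-- Commands of the functionality for quantifiers. -/
inductive QuantCmd where
  | setup (exs alls : List Sym)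
  | check (src : Name) (q : Quant)
  | final

/-- A multivariate polynomial with committed coefficients, as a list of monomials. -/
abbrev CommittedPoly := List ((ℕ →₀ ℕ) × Name)

/-- Commands of the functionality for circuits, polynomials, conversions and comparisons. -/
inductive ZKCmd (F : Type) where
  | witness (dst : Name)
  | common (dst : Name) (a : F)
  | relation (circuit : List F → List F) (src dst : List Name)
  | popEq (P Q : List CommittedPoly)
  | conv (src dst : Name) (ξ : F → ℕ)
  | compare (op : CmpOp) (i j : Name)

/-- Commands of the functionality for sets. -/
inductive SetCmd where
  | setup (src : List Name) (dst : Name)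
  | subset (src dst : Name)
  | mem (elems : List Name) (src : Name)
  | check

/-- A command to one of the six functionalities. -/
inductive Cmd (F : Type) where
  | ord (c : OrdCmd)
  | clause (c : ClauseCmd)
  | array (c : ArrayCmd)
  | quant (c : QuantCmd)
  | zk (c : ZKCmd F)
  | zkset (c : SetCmd)

instance {F : Type} : Inhabited (Cmd F) := ⟨Cmd.array ArrayCmd.check⟩

/-- The private part of a message of the prover. -/
inductive Priv (F : Type) where
  | none
  | lit (l : Lit)
  | clause (C : Clause)
  | slots (S : List Sym)
  | nat (i : ℕ)
  | read (idx : ℕ) (C : Clause)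
  | proceed
  | cheat
  | elem (a : F)
  | set (S : Set F)

/-- A message of the prover to the functionalities. -/
structure PMsg (F : Type) where
  cmd : Cmd F
  priv : Priv F

instance {F : Type} : Inhabited (PMsg F) := ⟨⟨default, Priv.none⟩⟩

/-- The answers of the functionalities. -/
inductive Resp where
  | ok
  | abort
  | honest
  | cheating
  deriving DecidableEq

/-- A stored value. -/
inductive Val (F : Type) where
  | elem (a : F)
  | nat (i : ℕ)
  | lit (s : Sym)
  | clause (C : Clause)
  | set (S : Set F)

/-- The joint state of the functionalities; a flag is `true` when it is set to `cheating`. -/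
structure State (F : Type) where
  store : Name → Option (Val F)
  vars : Option (List ℕ)
  arr : Option (List Clause)
  arrFlag : Bool
  quants : Option (List Sym × List Sym)
  quantFlag : Bool
  setFlag : Bool

namespace State

variable {F : Type}

/-- The state before the first invocation. -/
def start : State F := ⟨fun _ => none, none, none, false, none, false, false⟩

def getFld (st : State F) (n : Name) : Option F :=
  match st.store n with
  | some (Val.elem a) => some a
  | _ => none

def getNat (st : State F) (n : Name) : Option ℕ :=
  match st.store n with
  | some (Val.nat i) => some i
  | _ => none

def getSym (st : State F) (n : Name) : Option Sym :=
  match st.store n with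
  | some (Val.lit s) => some s
  | _ => none

def getClause (st : State F) (n : Name) : Option Clause :=
  match st.store n with
  | some (Val.clause C) => some C
  | _ => none

def getSet (st : State F) (n : Name) : Option (Set F) :=
  match st.store n with
  | some (Val.set S) => some S
  | _ => none

/-- Store a value under a fresh name; fails if the name is in use. -/
def put (st : State F) (n : Name) (v : Val F) : Option (State F) :=
  if st.store n = none then some { st with store := Function.update st.store n (some v) } else none

/-- Store a list of values under a list of as many fresh names. -/
def putAll : State F → List Name → List (Val F) → Option (State F)
  | st, [], [] => some st
  | st, n :: ns, v :: vs => (st.put n v).bind (fun st' => putAll st' ns vs)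
  | _, _, _ => none

/-- The literal is over the variables of the agreed order. -/
def InRange (st : State F) (l : Lit) : Prop := ∃ vs, st.vars = some vs ∧ l.var ∈ vs

/-! Each of the functions below executes a command with the private input of the prover and returns
`none` if the functionality aborts. -/

/-- Ordered literals. -/
def execOrd (st : State F) : OrdCmd → Priv F → Option (State F × Resp)
  | OrdCmd.setup vs, _ =>
      if st.vars = none then some ({ st with vars := some vs }, Resp.ok) else none
  | OrdCmd.input dst, Priv.lit l =>
      if st.InRange l then (st.put dst (Val.lit (Sym.lit l))).map (fun s => (s, Resp.ok)) else none
  | OrdCmd.order src dst, Priv.nat i => do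
      let s ← st.getSym src
      let vs ← st.vars
      if symOrder vs s = i then (st.put dst (Val.nat i)).map (fun s => (s, Resp.ok)) else none
  | _, _ => none

/-- Clauses. -/
def execClause (st : State F) : ClauseCmd → Priv F → Option (State F × Resp)
  | ClauseCmd.common dst C w, _ =>
      if C.card ≤ w ∧ ∀ l ∈ C, st.InRange l then
        (st.put dst (Val.clause C)).map (fun s => (s, Resp.ok)) else none
  | ClauseCmd.input dst w, Priv.clause C =>
      if C.card ≤ w ∧ ∀ l ∈ C, st.InRange l then
        (st.put dst (Val.clause C)).map (fun s => (s, Resp.ok)) else none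
  | ClauseCmd.retrieval src dst, Priv.slots S => do
      let C ← st.getClause src
      if C = litSet S then (st.putAll dst (S.map Val.lit)).map (fun s => (s, Resp.ok)) else none
  | ClauseCmd.equal c cs, _ => do
      let C ← st.getClause c
      let Cs ← cs.mapM st.getClause
      if Cs.Pairwise Disjoint ∧ C = Cs.foldr (· ∪ ·) ∅ then some (st, Resp.ok) else none
  | ClauseCmd.res c₀ c₁ p c, _ => do
      let A ← st.getClause c₀
      let B ← st.getClause c₁
      let s ← st.getSym p
      let C ← st.getClause c
      if ∃ l, s = Sym.lit l ∧ IsResolvent A B l C then some (st, Resp.ok) else none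
  | ClauseCmd.isFalse c, _ => do
      let C ← st.getClause c
      if C = ∅ then some (st, Resp.ok) else none
  | _, _ => none

/-- The answer to a final check: the prover may choose to be caught. -/
def answer (flag : Bool) : Priv F → Option Resp
  | Priv.cheat => some Resp.cheating
  | Priv.proceed => some (if flag then Resp.cheating else Resp.honest)
  | _ => none

/-- Append-only array; `tV` is the time stamp sent by the verifier in case of a `read`. -/
def execArray (st : State F) (tV : ℕ) : ArrayCmd → Priv F → Option (State F × Resp)
  | ArrayCmd.setup cs, _ => do
      let Cs ← cs.mapM st.getClause
      if st.arr = none then some ({ st with arr := some Cs, arrFlag := false }, Resp.ok)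
      else some (st, Resp.ok)
  | ArrayCmd.read t dst, Priv.read idx C => do
      let M ← st.arr
      let st' ← st.put dst (Val.clause C)
      if M[idx]? = some C ∧ t = tV ∧ idx < t then some (st', Resp.ok)
      else some ({ st' with arrFlag := true }, Resp.ok)
  | ArrayCmd.check, p => (answer st.arrFlag p).map (fun r => (st, r))
  | _, _ => none

/-- Quantifiers; `qV` is the quantifier sent by the verifier in case of a `check`. -/
def execQuant (st : State F) (qV : Quant) : QuantCmd → Priv F → Option (State F × Resp)
  | QuantCmd.setup exs alls, _ =>
      if st.quants = none then some ({ st with quants := some (exs, alls) }, Resp.ok)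
      else some (st, Resp.ok)
  | QuantCmd.check src q, _ => do
      let s ← st.getSym src
      let Ls ← st.quants
      if q = qV ∧ s ∈ (match q with
          | Quant.ex => Ls.1
          | Quant.all => Ls.2) then some (st, Resp.ok)
      else some ({ st with quantFlag := true }, Resp.ok)
  | QuantCmd.final, p => (answer st.quantFlag p).map (fun r => (st, r))

/-- The polynomial with the given committed coefficients. -/
def openPoly [Field F] (st : State F) (P : CommittedPoly) : Option (MvPolynomial ℕ F) :=
  (P.mapM (fun m => (st.getFld m.2).map (fun a => MvPolynomial.monomial m.1 a))).map List.sum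

/-- Circuits, products of polynomials, conversions and comparisons. -/
def execZK [Field F] (st : State F) : ZKCmd F → Priv F → Option (State F × Resp)
  | ZKCmd.witness dst, Priv.elem a => (st.put dst (Val.elem a)).map (fun s => (s, Resp.ok))
  | ZKCmd.common dst a, _ => (st.put dst (Val.elem a)).map (fun s => (s, Resp.ok))
  | ZKCmd.relation c src dst, _ => do
      let a ← src.mapM st.getFld
      (st.putAll dst ((c a).map Val.elem)).map (fun s => (s, Resp.ok))
  | ZKCmd.popEq P Q, _ => do
      let P' ← P.mapM st.openPoly
      let Q' ← Q.mapM st.openPoly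
      if P'.prod = Q'.prod then some (st, Resp.ok) else none
  | ZKCmd.conv src dst ξ, Priv.nat i => do
      let a ← st.getFld src
      if ξ a = i then (st.put dst (Val.nat i)).map (fun s => (s, Resp.ok)) else none
  | ZKCmd.compare op i j, _ => do
      let a ← st.getNat i
      let b ← st.getNat j
      if op.Holds a b then some (st, Resp.ok) else none
  | _, _ => none

/-- Sets of field elements. -/
def execSet (st : State F) : SetCmd → Priv F → Option (State F × Resp)
  | SetCmd.setup src dst, _ => do
      let a ← src.mapM st.getFld
      (st.put dst (Val.set {x | x ∈ a})).map (fun s => ({ s with setFlag := false }, Resp.ok))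
  | SetCmd.subset src dst, Priv.set S' => do
      let S ← st.getSet src
      let st' ← st.put dst (Val.set S')
      if S' ⊆ S then some (st', Resp.ok) else some ({ st' with setFlag := true }, Resp.ok)
  | SetCmd.mem elems src, _ => do
      let a ← elems.mapM st.getFld
      let S ← st.getSet src
      if ∀ x ∈ a, x ∈ S then some (st, Resp.ok) else some ({ st with setFlag := true }, Resp.ok)
  | SetCmd.check, p => (answer st.setFlag p).map (fun r => (st, r))
  | _, _ => none

/-- One joint invocation. The parties have to send the same command, or the invocation aborts; but
different time stamps in a `read` and different quantifiers in a `check` only set the flag. -/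
def invoke [Field F] (st : State F) (p : PMsg F) (v : Cmd F) : Option (State F × Resp) :=
  match p.cmd, v with
  | Cmd.array (ArrayCmd.read t n), Cmd.array (ArrayCmd.read t' n') =>
      if n = n' then st.execArray t' (ArrayCmd.read t n) p.priv else none
  | Cmd.quant (QuantCmd.check n q), Cmd.quant (QuantCmd.check n' q') =>
      if n = n' then st.execQuant q' (QuantCmd.check n q) p.priv else none
  | c, c' =>
      if c = c' then
        match c with
        | Cmd.ord c => st.execOrd c p.priv
        | Cmd.clause c => st.execClause c p.priv
        | Cmd.array c => st.execArray 0 c p.priv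
        | Cmd.quant c => st.execQuant Quant.ex c p.priv
        | Cmd.zk c => st.execZK c p.priv
        | Cmd.zkset c => st.execSet c p.priv
      else none

/-- One round: the new state, the answer to the prover and the answer to the verifier. The result
of a final check is sent to the verifier only. -/
def round [Field F] (st : State F) (p : PMsg F) (v : Cmd F) : State F × Resp × Resp :=
  match st.invoke p v with
  | some (st', r) => (st', Resp.ok, r)
  | none => (st, Resp.abort, Resp.abort)

end State

/-! ### The protocol -/

section Protocol

variable (F : Type)

/-- The sets of existential and of universal symbols. -/
def exSyms (φ : QBF) : List Sym := Sym.noEx :: (φ.lits Quant.ex).map Sym.lit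

def allSyms (φ : QBF) : List Sym := Sym.padHi :: (φ.lits Quant.all).map Sym.lit

/-- The commands of the verifier in the `i`-th step. -/
def verifierStep (x : Stmt) (i : ℕ) : List (Cmd F) :=
  [ Cmd.ord (.input (.piv i)),
    Cmd.clause (.input (.bar i) x.w),
    -- fetching the premises
    Cmd.array (.read (x.L + i) (.fetL i)),
    Cmd.array (.read (x.L + i) (.fetR i)),
    -- existential resolution
    Cmd.clause (.res (.fetL i) (.fetR i) (.piv i) (.bar i)),
    Cmd.quant (.check (.piv i) .ex),
    -- the extended witness for the universal reduction
    Cmd.clause (.input (.wRes i) x.w),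
    Cmd.clause (.input (.wRem i) x.w),
    Cmd.clause (.input (.wCl i) x.w),
    Cmd.clause (.retrieval (.wRes i) ((List.range x.w).map (Name.resLit i))),
    Cmd.clause (.retrieval (.wRem i) ((List.range x.d).map (Name.remLit i))),
    Cmd.clause (.retrieval (.wCl i) [.wLit i]),
    Cmd.ord (.order (.wLit i) (.wOrd i)) ] ++
  -- the retained literals come before `w_ℓ`
  (List.range x.w).flatMap (fun j =>
    [ Cmd.ord (.order (.resLit i j) (.resOrd i j)),
      Cmd.zk (.compare .lt (.resOrd i j) (.wOrd i)) ]) ++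
  -- the removed literals come after `w_ℓ`
  (List.range x.d).flatMap (fun j =>
    [ Cmd.ord (.order (.remLit i j) (.remOrd i j)),
      Cmd.zk (.compare .gt (.remOrd i j) (.wOrd i)) ]) ++
  -- quantifiers
  [ Cmd.quant (.check (.wLit i) .ex) ] ++
  (List.range x.d).map (fun j => Cmd.quant (.check (.remLit i j) .all)) ++
  -- the decompositions of the reduced clause and of the resolvent
  [ Cmd.clause (.equal (.cl (x.L + i)) [.wRes i, .wCl i]),
    Cmd.clause (.equal (.bar i) [.wRes i, .wCl i, .wRem i]) ]

/-- The commands of the verifier. -/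
def verifierScript (x : Stmt) : List (Cmd F) :=
  [ Cmd.ord (.setup x.qbf.vars) ] ++
  x.qbf.matrix.zipIdx.map (fun c => Cmd.clause (.common (.cl c.2) c.1 x.w)) ++
  [ Cmd.quant (.setup (exSyms x.qbf) (allSyms x.qbf)) ] ++
  (List.range x.R).map (fun i => Cmd.clause (.input (.cl (x.L + i)) x.w)) ++
  [ Cmd.array (.setup ((List.range (x.L + x.R)).map Name.cl)) ] ++
  (List.range x.R).flatMap (verifierStep F x) ++
  [ Cmd.clause (.isFalse (.cl (x.L + x.R - 1))),
    Cmd.array .check,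
    Cmd.quant .final ]

/-- The innermost existential literal of a clause, if there is one. -/
def innermost (φ : QBF) (C : Clause) : Option Lit :=
  ((C.filter (fun l => φ.IsEx l.var)).sort (· ≤ ·)).argmax (fun l => φ.pos l.var)

/-- A list of symbols for a clause, filled up to length `m`. -/
def slots (C : Clause) (m : ℕ) (pad : Sym) : List Sym :=
  (C.sort (· ≤ ·)).map Sym.lit ++ List.replicate (m - C.card) pad

/-- The messages of the honest prover in the `i`-th step, which is `s`. -/
def proverStep (x : Stmt) (π : List Step) (i : ℕ) (s : Step) : List (PMsg F) :=
  let w := innermost x.qbf s.bar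
  let wSym : Sym := w.elim Sym.noEx Sym.lit
  let wCl : Clause := w.toFinset
  let wRes := s.red \ wCl
  let wRem := s.bar \ s.red
  let resS := slots wRes x.w Sym.padLo
  let remS := slots wRem x.d Sym.padHi
  let ord := symOrder x.qbf.vars
  [ ⟨Cmd.ord (.input (.piv i)), .lit s.pivot⟩,
    ⟨Cmd.clause (.input (.bar i) x.w), .clause s.bar⟩,
    ⟨Cmd.array (.read (x.L + i) (.fetL i)), .read s.left ((clauseSeq x.qbf π).getD s.left ∅)⟩,
    ⟨Cmd.array (.read (x.L + i) (.fetR i)), .read s.right ((clauseSeq x.qbf π).getD s.right ∅)⟩,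
    ⟨Cmd.clause (.res (.fetL i) (.fetR i) (.piv i) (.bar i)), .none⟩,
    ⟨Cmd.quant (.check (.piv i) .ex), .none⟩,
    ⟨Cmd.clause (.input (.wRes i) x.w), .clause wRes⟩,
    ⟨Cmd.clause (.input (.wRem i) x.w), .clause wRem⟩,
    ⟨Cmd.clause (.input (.wCl i) x.w), .clause wCl⟩,
    ⟨Cmd.clause (.retrieval (.wRes i) ((List.range x.w).map (Name.resLit i))), .slots resS⟩,
    ⟨Cmd.clause (.retrieval (.wRem i) ((List.range x.d).map (Name.remLit i))), .slots remS⟩,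
    ⟨Cmd.clause (.retrieval (.wCl i) [.wLit i]), .slots [wSym]⟩,
    ⟨Cmd.ord (.order (.wLit i) (.wOrd i)), .nat (ord wSym)⟩ ] ++
  (List.range x.w).flatMap (fun j =>
    [ ⟨Cmd.ord (.order (.resLit i j) (.resOrd i j)), .nat (ord (resS.getD j .padLo))⟩,
      ⟨Cmd.zk (.compare .lt (.resOrd i j) (.wOrd i)), .none⟩ ]) ++
  (List.range x.d).flatMap (fun j =>
    [ ⟨Cmd.ord (.order (.remLit i j) (.remOrd i j)), .nat (ord (remS.getD j .padHi))⟩,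
      ⟨Cmd.zk (.compare .gt (.remOrd i j) (.wOrd i)), .none⟩ ]) ++
  [ ⟨Cmd.quant (.check (.wLit i) .ex), .none⟩ ] ++
  (List.range x.d).map (fun j => ⟨Cmd.quant (.check (.remLit i j) .all), .none⟩) ++
  [ ⟨Cmd.clause (.equal (.cl (x.L + i)) [.wRes i, .wCl i]), .none⟩,
    ⟨Cmd.clause (.equal (.bar i) [.wRes i, .wCl i, .wRem i]), .none⟩ ]

/-- The messages of the honest prover, who holds the refutation `π`. -/
def proverScript (x : Stmt) (π : List Step) : List (PMsg F) :=
  [ ⟨Cmd.ord (.setup x.qbf.vars), .none⟩ ] ++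
  x.qbf.matrix.zipIdx.map (fun c => ⟨Cmd.clause (.common (.cl c.2) c.1 x.w), .none⟩) ++
  [ ⟨Cmd.quant (.setup (exSyms x.qbf) (allSyms x.qbf)), .none⟩ ] ++
  (List.range x.R).map (fun i =>
    ⟨Cmd.clause (.input (.cl (x.L + i)) x.w), .clause (π.getD i default).red⟩) ++
  [ ⟨Cmd.array (.setup ((List.range (x.L + x.R)).map Name.cl)), .none⟩ ] ++
  (List.range x.R).flatMap (fun i => proverStep F x π i (π.getD i default)) ++
  [ ⟨Cmd.clause (.isFalse (.cl (x.L + x.R - 1))), .none⟩,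
    ⟨Cmd.array .check, .proceed⟩,
    ⟨Cmd.quant .final, .proceed⟩ ]

end Protocol

/-! ### Executions with arbitrary parties -/

section Execution

variable {F : Type}

/-- What happens in one round: the messages of both parties and the answers to them. -/
structure Round (F : Type) where
  p : PMsg F
  v : Cmd F
  toP : Resp
  toV : Resp

/-- A probabilistic prover: it chooses its next message from its messages so far and the answers. -/
abbrev Prover (F : Type) := List (PMsg F × Resp) → PMF (PMsg F)

/-- A probabilistic verifier. -/
abbrev Verifier (F : Type) := List (Cmd F × Resp) → PMF (Cmd F)

/-- Run at most `n` further rounds after the rounds `tr`; stop as soon as there is an abort. -/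
def execFrom [Field F] (P : Prover F) (V : Verifier F) :
    ℕ → State F → List (Round F) → PMF (List (Round F))
  | 0, _, tr => PMF.pure tr
  | n + 1, st, tr =>
      (P (tr.map (fun r => (r.p, r.toP)))).bind (fun p =>
        (V (tr.map (fun r => (r.v, r.toV)))).bind (fun v =>
          let o := st.round p v
          let tr' := tr ++ [⟨p, v, o.2.1, o.2.2⟩]
          if o.2.2 = Resp.abort then PMF.pure tr' else execFrom P V n o.1 tr'))

/-- The number of rounds of the protocol. -/
def rounds (F : Type) (x : Stmt) : ℕ := (verifierScript F x).length

/-- The execution of the protocol on the common input `x` with the given parties. -/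
def exec [Field F] (x : Stmt) (P : Prover F) (V : Verifier F) : PMF (List (Round F)) :=
  execFrom P V (rounds F x) State.start []

/-- The honest verifier. -/
def honestVerifier (x : Stmt) : Verifier F :=
  fun h => PMF.pure ((verifierScript F x).getD h.length default)

/-- The honest prover. -/
def honestProver (x : Stmt) (π : List Step) : Prover F :=
  fun h => PMF.pure ((proverScript F x π).getD h.length default)

/-- The verifier accepts: the protocol ran to its end, no functionality aborted and no check
returned `cheating`. -/
def Accepts (x : Stmt) (tr : List (Round F)) : Prop :=
  tr.length = rounds F x ∧ ∀ r ∈ tr, r.toV ≠ Resp.abort ∧ r.toV ≠ Resp.cheating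

/-- The view of the verifier. -/
def view (tr : List (Round F)) : List (Cmd F × Resp) := tr.map (fun r => (r.v, r.toV))

/-- The interaction of a verifier with a simulator that answers its commands: `S h v` is the
answer to `v` after the history `h`. -/
def simFrom (S : List (Cmd F × Resp) → Cmd F → Resp) (V : Verifier F) :
    ℕ → List (Cmd F × Resp) → PMF (List (Cmd F × Resp))
  | 0, h => PMF.pure h
  | n + 1, h =>
      (V h).bind (fun v =>
        if S h v = Resp.abort then PMF.pure (h ++ [(v, S h v)])
        else simFrom S V n (h ++ [(v, S h v)]))

end Execution

/-! ### Polynomial time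

Programs work on binary trees and are composed from elementary operations, case distinctions and
loops over lists. A program is charged for every elementary operation, and for every tree that it
reads or copies by the size of that tree. -/

/-- Binary trees. -/
inductive Data where
  | nil
  | cons (a b : Data)
  deriving DecidableEq

namespace Data

def size : Data → ℕ
  | nil => 1
  | cons a b => a.size + b.size + 1

def hd : Data → Data
  | nil => nil
  | cons a _ => a

def tl : Data → Data
  | nil => nil
  | cons _ b => b

/-- Fold over a tree read as the list `cons a₁ (cons a₂ (… nil))`. -/
def fold {α : Type} (f : Data → α → α) : Data → α → α
  | nil, s => s
  | cons a l, s => fold f l (f a s)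

/-- Lists as trees. -/
def ofList : List Data → Data
  | [] => nil
  | a :: l => cons a (ofList l)

/-- Numbers in unary. -/
def ofNat (n : ℕ) : Data := ofList (List.replicate n nil)

def ofBool : Bool → Data
  | false => nil
  | true => cons nil nil

/-- Numbers in binary. -/
def ofBits (n : ℕ) : Data := ofList (n.bits.map ofBool)

end Data

/-- Programs. `loop b` expects an input `(l, s, e)` and updates `s` to `b (a, s, e)` for each
element `a` of the list `l` in turn. -/
inductive Prog where
  | id
  | nil
  | hd
  | tl
  | eq
  | pair (f g : Prog)
  | comp (g f : Prog)
  | ite (c f g : Prog)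
  | loop (b : Prog)

namespace Prog

/-- The output of a program. -/
def run : Prog → Data → Data
  | id, x => x
  | nil, _ => Data.nil
  | hd, x => x.hd
  | tl, x => x.tl
  | eq, x => Data.ofBool (decide (x.hd = x.tl))
  | pair f g, x => Data.cons (f.run x) (g.run x)
  | comp g f, x => g.run (f.run x)
  | ite c f g, x => if c.run x = Data.nil then g.run x else f.run x
  | loop b, x =>
      Data.fold (fun a s => b.run (Data.cons a (Data.cons s x.tl.tl))) x.hd x.tl.hd

/-- The number of steps of a program. -/
def time : Prog → Data → ℕ
  | id, x => x.size + 1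
  | nil, _ => 1
  | hd, x => x.size + 1
  | tl, x => x.size + 1
  | eq, x => x.size + 1
  | pair f g, x => f.time x + g.time x + 1
  | comp g f, x => f.time x + g.time (f.run x) + 1
  | ite c f g, x => c.time x + (if c.run x = Data.nil then g.time x else f.time x) + 1
  | loop b, x =>
      x.size + 1 + (Data.fold (fun a (s : Data × ℕ) =>
        let y := Data.cons a (Data.cons s.1 x.tl.tl)
        (b.run y, s.2 + y.size + b.time y + 1)) x.hd (x.tl.hd, 0)).2

/-- The program runs in polynomial time. -/
def PolyTime (f : Prog) : Prop := ∃ q : Polynomial ℕ, ∀ x, f.time x ≤ q.eval x.size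

end Prog

/-! ### Inputs and outputs of programs

The numbers `R`, `w`, `d` and all indices are written in unary (the protocol itself takes that many
rounds), the names of variables in binary. -/

section Encoding

open Data

variable {F : Type}

/-- A tree with a label. -/
def tag (k : ℕ) (l : List Data) : Data := cons (Data.ofNat k) (ofList l)

def Quant.enc : Quant → Data
  | ex => Data.ofNat 0
  | all => Data.ofNat 1

def Lit.enc (l : Lit) : Data := cons (ofBits l.var) (ofBool l.sign)

def encClause (C : Clause) : Data := ofList ((C.sort (· ≤ ·)).map Lit.enc)

def QBF.enc (φ : QBF) : Data :=
  cons (ofList (φ.blocks.map (fun b => cons b.1.enc (ofList (b.2.map ofBits)))))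
    (ofList (φ.matrix.map encClause))

def Stmt.enc (x : Stmt) : Data :=
  ofList [x.qbf.enc, Data.ofNat x.R, Data.ofNat x.w, Data.ofNat x.d]

def Step.enc (s : Step) : Data :=
  ofList [Data.ofNat s.left, Data.ofNat s.right, s.pivot.enc, encClause s.bar, encClause s.red]

/-- Refutations. -/
def encProof (π : List Step) : Data := ofList (π.map Step.enc)

def Sym.enc : Sym → Data
  | lit l => tag 0 [l.enc]
  | padLo => tag 1 []
  | noEx => tag 2 []
  | padHi => tag 3 []

def Name.enc : Name → Data
  | cl j => tag 0 [Data.ofNat j]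
  | piv i => tag 1 [Data.ofNat i]
  | bar i => tag 2 [Data.ofNat i]
  | fetL i => tag 3 [Data.ofNat i]
  | fetR i => tag 4 [Data.ofNat i]
  | wRes i => tag 5 [Data.ofNat i]
  | wRem i => tag 6 [Data.ofNat i]
  | wCl i => tag 7 [Data.ofNat i]
  | wLit i => tag 8 [Data.ofNat i]
  | wOrd i => tag 9 [Data.ofNat i]
  | resLit i j => tag 10 [Data.ofNat i, Data.ofNat j]
  | resOrd i j => tag 11 [Data.ofNat i, Data.ofNat j]
  | remLit i j => tag 12 [Data.ofNat i, Data.ofNat j]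
  | remOrd i j => tag 13 [Data.ofNat i, Data.ofNat j]

def encNames (l : List Name) : Data := ofList (l.map Name.enc)

def CmpOp.enc : CmpOp → Data
  | gt => Data.ofNat 0
  | ge => Data.ofNat 1
  | lt => Data.ofNat 2
  | le => Data.ofNat 3

/-- Commands. All commands that no honest party ever sends are written as the same tree. -/
def Cmd.enc : Cmd F → Data
  | ord (.setup vs) => tag 0 (vs.map ofBits)
  | ord (.input n) => tag 1 [n.enc]
  | ord (.order s n) => tag 2 [s.enc, n.enc]
  | clause (.common n C w) => tag 3 [n.enc, encClause C, Data.ofNat w]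
  | clause (.input n w) => tag 4 [n.enc, Data.ofNat w]
  | clause (.retrieval s ns) => tag 5 [s.enc, encNames ns]
  | clause (.equal c cs) => tag 6 [c.enc, encNames cs]
  | clause (.res a b p c) => tag 7 [a.enc, b.enc, p.enc, c.enc]
  | clause (.isFalse c) => tag 8 [c.enc]
  | array (.setup cs) => tag 9 [encNames cs]
  | array (.read t n) => tag 10 [Data.ofNat t, n.enc]
  | array .check => tag 11 []
  | quant (.setup a b) => tag 12 [ofList (a.map Sym.enc), ofList (b.map Sym.enc)]
  | quant (.check n q) => tag 13 [n.enc, q.enc]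
  | quant .final => tag 14 []
  | zk (.compare op i j) => tag 15 [op.enc, i.enc, j.enc]
  | _ => tag 16 []

/-- Private inputs; those that belong to such commands are written as the same tree. -/
def Priv.enc : Priv F → Data
  | none => tag 0 []
  | lit l => tag 1 [l.enc]
  | clause C => tag 2 [encClause C]
  | slots S => tag 3 (S.map Sym.enc)
  | nat i => tag 4 [Data.ofNat i]
  | read i C => tag 5 [Data.ofNat i, encClause C]
  | proceed => tag 6 []
  | cheat => tag 7 []
  | _ => tag 8 []

def PMsg.enc (m : PMsg F) : Data := cons m.cmd.enc m.priv.enc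

def Resp.enc : Resp → Data
  | ok => Data.ofNat 0
  | abort => Data.ofNat 1
  | honest => Data.ofNat 2
  | cheating => Data.ofNat 3

/-- The answer written on a tree. -/
def Resp.dec (y : Data) : Resp :=
  if y = Resp.ok.enc then ok
  else if y = Resp.honest.enc then honest
  else if y = Resp.cheating.enc then cheating
  else abort

/-- The input of the extractor: the common input and the messages of the prover. -/
def extractorInput (x : Stmt) (tr : List (Round F)) : Data :=
  cons x.enc (ofList (tr.map (fun r => r.p.enc)))

/-- The input of the simulator: the common input, the view so far and the next command. -/
def simulatorInput (x : Stmt) (h : List (Cmd F × Resp)) (v : Cmd F) : Data :=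
  ofList [x.enc, ofList (h.map (fun r => cons r.1.enc r.2.enc)), v.enc]

end Encoding

/-! ### Zero-knowledge proofs of knowledge -/

section Security

variable (F : Type) [Field F]

/-- The probability of an event. -/
def Pr {α : Type} (μ : PMF α) (E : Set α) : ENNReal := μ.toOuterMeasure E

/-- The verifier is polynomial: a polynomial-time program writes down all of its commands. -/
def EfficientVerifier : Prop :=
  ∃ G : Prog, G.PolyTime ∧
    ∀ x : Stmt, G.run x.enc = Data.ofList ((verifierScript F x).map Cmd.enc)

/-- Perfect completeness: the honest prover with a witness always convinces the honest verifier. -/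
def Complete : Prop :=
  ∀ (x : Stmt) (π : List Step), x.qbf.Admissible → Rel x π →
    Pr (exec (F := F) x (honestProver x π) (honestVerifier x)) {tr | Accepts x tr} = 1

/-- Soundness: no prover whatsoever convinces the honest verifier of a true QBF. -/
def Sound : Prop :=
  ∀ x : Stmt, x.qbf.Admissible → x.qbf.IsTrue →
    ∀ P : Prover F, Pr (exec x P (honestVerifier x)) {tr | Accepts x tr} = 0

/-- Knowledge soundness with knowledge error zero: a polynomial-time extractor computes, from the
messages that an arbitrary prover sent to the functionalities in a single execution, a witness
whenever the honest verifier accepts. -/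
def KnowledgeSound : Prop :=
  ∃ E : Prog, E.PolyTime ∧ ∀ x : Stmt, x.qbf.Admissible → ∀ P : Prover F,
    Pr (exec x P (honestVerifier x))
      {tr | Accepts x tr ∧ ¬ ∃ π, Rel x π ∧ E.run (extractorInput x tr) = encProof π} = 0

/-- Perfect zero knowledge: a polynomial-time simulator that knows only the common input produces
answers to an arbitrary verifier such that the view of the verifier has the same distribution
as in the execution with the honest prover, whatever witness the prover uses. -/
def ZeroKnowledge : Prop :=
  ∃ S : Prog, S.PolyTime ∧ ∀ (x : Stmt) (π : List Step), x.qbf.Admissible → Rel x π →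
    ∀ V : Verifier F,
      (exec x (honestProver x π) V).map view =
        simFrom (fun h v => Resp.dec (S.run (simulatorInput x h v))) V (rounds F x) []

end Security

end QRes

end

/-!
Every committed value, clause and literal of the protocol is checked by an ideal functionality, so
the theorem reduces to combinatorics of Q-resolution, bookkeeping of the joint state of the
functionalities, and the construction of three polynomial-time programs.

*Programs.* `PolyF f` says that a program computes `f` in polynomial time. It is closed under the
usual list operations and under loops whose state grows by a polynomial amount in every pass
(`PolyF.fold_of_invariant`); the list of the commands of the verifier (`scriptData`), the extractor
(`extractData`) and the simulator (`simData`) are written with these operations.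

*Knowledge soundness.* Stored values are never overwritten and a flag is never cleared once the
array is set up (`State.Le`), so each command that succeeds leaves a fact about the final store
(`State.Fact`, `State.invoke_plain`), which is unconditional except that the facts from reading the
array and from the quantifier checks hold if the final checks report no cheating. In an accepting
run the facts for one step say that the two premises are earlier clauses, that `bar` is their
resolvent on an existential pivot, and that `red` is its universal reduction: the literal `w_ℓ` is
existential (or a substitute that precedes all literals), what is kept precedes it, and what is
removed is universal and follows it (`forallRed_litSet`). Hence the messages contain a witness
(`witness_of_run`), and the extractor collects it.

*Soundness.* Resolution preserves satisfaction by every assignment, and universal reduction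
preserves the truth of a prenex formula, since the universal player can falsify the trailing
universal literals of a clause without complementary literals (`QBF.sat_forallRed`). So a formula with a
refutation is not true (`IsRefutation.not_isTrue`), and soundness follows from knowledge soundness.

*Completeness.* Every message of the honest prover is a true claim about the values `honestVal`
(`honestMsg_step`), and every name is assigned once, before it is used (`WellScoped`). So the state
of an honest execution is determined by the set of assigned names (`honestRun_proverScript`).

*Zero knowledge.* Against the honest prover, a verifier that deviates causes an abort, except that a
wrong time stamp in a `read` or a wrong quantifier in a `check` sets a flag. The state therefore
differs from the honest one in the flags only (`State.invoke_withFlags`), and the flags and answers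
are functions of the common input and the commands of the verifier (`simAnswer`, `flagsAfter`).
-/

noncomputable section

namespace QRes

open scoped Classical

section

/-! ### Lists encoded as trees -/

namespace Data

theorem one_le_size : ∀ x : Data, 1 ≤ x.size
  | nil => le_rfl
  | cons _ _ => Nat.le_add_left _ _

theorem size_hd_le (x : Data) : x.hd.size ≤ x.size := by
  cases x <;> simp [hd, size]; omega

theorem size_tl_le (x : Data) : x.tl.size ≤ x.size := by
  cases x <;> simp [tl, size]; omega

/-- Reversal of a list. -/
def rev (l : Data) : Data := fold cons l nil

/-- Concatenation of lists. -/
def app (l s : Data) : Data := fold cons (rev l) s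

/-- The list of the values of a function on the elements of a list. -/
def map (f : Data → Data) (l : Data) : Data := rev (fold (fun a s => cons (f a) s) l nil)

/-- The concatenation of the values of a list-valued function on the elements of a list. -/
def bindList (f : Data → Data) (l : Data) : Data := fold (fun a s => app (f a) s) (rev l) nil

/-- The elements of a list, each paired with its index (in unary). The loop runs from the end of the
list and keeps the index of the current element in front of the pairs collected so far. -/
def enum (l : Data) : Data :=
  (fold (fun a s => cons s.hd.tl (cons (cons s.hd.tl a) s.tl)) (rev l)
    (cons (map (fun _ => nil) l) nil)).tl

/-- The list of the unary numbers below a unary number. -/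
def range (n : Data) : Data := map hd (enum n)

@[simp] theorem fold_nil {α : Type} (f : Data → α → α) (s : α) : fold f nil s = s := rfl

@[simp] theorem hd_cons (a b : Data) : (cons a b).hd = a := rfl

@[simp] theorem tl_cons (a b : Data) : (cons a b).tl = b := rfl

@[simp] theorem ofList_nil : ofList [] = nil := rfl

@[simp] theorem ofList_cons (a : Data) (l : List Data) : ofList (a :: l) = cons a (ofList l) := rfl

theorem fold_ofList {α : Type} (f : Data → α → α) (l : List Data) (s : α) :
    fold f (ofList l) s = l.foldl (fun s a => f a s) s := by
  induction l generalizing s with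
  | nil => rfl
  | cons a l ih => exact ih _

theorem foldl_cons_eq (l m : List Data) :
    l.foldl (fun s a => cons a s) (ofList m) = ofList (l.reverse ++ m) := by
  induction l generalizing m with
  | nil => rfl
  | cons a l ih => simpa using ih (a :: m)

@[simp] theorem rev_ofList (l : List Data) : rev (ofList l) = ofList l.reverse := by
  simpa [rev, fold_ofList] using foldl_cons_eq l []

@[simp] theorem app_ofList (l m : List Data) : app (ofList l) (ofList m) = ofList (l ++ m) := by
  rw [app, rev_ofList, fold_ofList, foldl_cons_eq, List.reverse_reverse]

@[simp] theorem map_ofList (f : Data → Data) (l : List Data) :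
    map f (ofList l) = ofList (l.map f) := by
  have h : fold (fun a s => cons (f a) s) (ofList l) nil = ofList (l.map f).reverse := by
    rw [fold_ofList, ← List.foldl_map (f := f) (g := fun s a => cons a s)]
    simpa using foldl_cons_eq (l.map f) []
  rw [map, h, rev_ofList, List.reverse_reverse]

theorem fold_rev_ofList {α : Type} (f : Data → α → α) (l : List Data) (s : α) :
    fold f (rev (ofList l)) s = l.foldr f s := by
  rw [rev_ofList, fold_ofList, List.foldl_reverse]

theorem bindList_ofList {α : Type} (f : Data → Data) (g : α → Data) (k : α → List Data)
    (l : List α) (h : ∀ a ∈ l, f (g a) = ofList (k a)) :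
    bindList f (ofList (l.map g)) = ofList (l.flatMap k) := by
  rw [bindList, fold_rev_ofList]
  induction l with
  | nil => rfl
  | cons a l ih =>
    rw [List.map_cons, List.foldr_cons, ih fun b hb => h b (List.mem_cons_of_mem _ hb),
      h a List.mem_cons_self, app_ofList, List.flatMap_cons]

theorem ofNat_succ (n : ℕ) : ofNat (n + 1) = cons nil (ofNat n) := rfl

@[simp] theorem tl_ofNat (n : ℕ) : (ofNat n).tl = ofNat (n - 1) := by cases n <;> rfl

theorem map_nil_ofList (l : List Data) : map (fun _ => nil) (ofList l) = ofNat l.length := by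
  simp [ofNat]

theorem enum_ofList (l : List Data) :
    enum (ofList l) = ofList (l.zipIdx.map fun c => cons (ofNat c.2) c.1) := by
  have key : ∀ k : ℕ, l.foldr (fun a s => cons s.hd.tl (cons (cons s.hd.tl a) s.tl))
      (cons (ofNat (k + l.length)) nil) =
        cons (ofNat k) (ofList ((l.zipIdx k).map fun c => cons (ofNat c.2) c.1)) := by
    induction l with
    | nil => intro k; rfl
    | cons a l ih =>
      intro k
      rw [List.foldr_cons, List.length_cons, show k + (l.length + 1) = k + 1 + l.length by omega,
        ih (k + 1)]
      simp
  have h := key 0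
  rw [Nat.zero_add] at h
  rw [enum, map_nil_ofList, fold_rev_ofList, h, tl_cons]

theorem range_ofNat (n : ℕ) : range (ofNat n) = ofList ((List.range n).map ofNat) := by
  rw [range, ofNat, enum_ofList, map_ofList, List.map_map]
  have : (Data.hd ∘ fun c : Data × ℕ => cons (ofNat c.2) c.1) = ofNat ∘ Prod.snd := rfl
  rw [this, ← List.map_map, List.zipIdx_map_snd, List.length_replicate, List.range_eq_range']

theorem app_ofNat (m n : ℕ) : app (ofNat m) (ofNat n) = ofNat (m + n) := by
  simp [ofNat]

theorem size_fold_cons (l s : Data) : (fold cons l s).size ≤ l.size + s.size := by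
  induction l generalizing s with
  | nil => simp [size]
  | cons a l _ ih => simp only [fold, size]; have := ih (cons a s); simp only [size] at this; omega

theorem size_rev_le (l : Data) : (rev l).size ≤ l.size + 1 := size_fold_cons l nil

theorem size_app_le (l s : Data) : (app l s).size ≤ l.size + 1 + s.size :=
  (size_fold_cons _ _).trans (Nat.add_le_add_right (size_rev_le l) _)

theorem ofNat_injective : Function.Injective ofNat := by
  intro m
  induction m with
  | zero => intro n h; cases n with
    | zero => rfl
    | succ n => cases h
  | succ m ih => intro n h; cases n with
    | zero => cases h
    | succ n => rw [ofNat_succ, ofNat_succ, Data.cons.injEq] at h; rw [ih h.2]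

theorem ofBool_injective : Function.Injective ofBool := by
  intro a b h; cases a <;> cases b <;> simp_all [ofBool]

theorem ofBool_eq_nil {b : Bool} : ofBool b = nil ↔ b = false := by cases b <;> simp [ofBool]

theorem ofList_injective : Function.Injective ofList := by
  intro l
  induction l with
  | nil => intro m h; cases m with
    | nil => rfl
    | cons b m => cases h
  | cons a l ih => intro m h; cases m with
    | nil => cases h
    | cons b m => rw [ofList, ofList, Data.cons.injEq] at h; rw [h.1, ih h.2]

theorem bits_injective : Function.Injective Nat.bits := by
  have h : ∀ n : ℕ, n.bits.foldr Nat.bit 0 = n := by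
    intro n
    induction n using Nat.binaryRec' with
    | zero => simp
    | bit b n hn ih => rw [Nat.bits_append_bit n b hn, List.foldr_cons, ih]
  exact Function.LeftInverse.injective h

theorem ofBits_injective : Function.Injective ofBits := by
  intro m n h
  have := List.map_injective_iff.2 ofBool_injective (ofList_injective h)
  exact bits_injective this

end Data

/-! ### Polynomial-time functions on trees -/

theorem eval_mono (q : Polynomial ℕ) {m n : ℕ} (h : m ≤ n) : q.eval m ≤ q.eval n := by
  simp only [Polynomial.eval_eq_sum_range]
  gcongr

/-- The output of a program is not much larger than its running time. -/
theorem Prog.size_run_le (p : Prog) (x : Data) : (p.run x).size ≤ 2 * p.time x := by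
  induction p generalizing x with
  | id => simp only [run, time]; omega
  | nil => simp [run, time, Data.size]
  | hd => have := x.size_hd_le; simp only [run, time]; omega
  | tl => have := x.size_tl_le; simp only [run, time]; omega
  | eq =>
    have := x.one_le_size
    simp only [run, time]
    rcases decide (x.hd = x.tl) <;> simp [Data.ofBool, Data.size] <;> omega
  | pair f g hf hg => have := hf x; have := hg x; simp only [run, time, Data.size]; omega
  | comp g f hg hf => have := hg (f.run x); simp only [run, time]; omega
  | ite c f g hc hf hg =>
    have := hf x; have := hg x; simp only [run, time]; split_ifs <;> omega
  | loop b hb =>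
    have key : ∀ (e l s : Data) (t : ℕ),
        (Data.fold (fun a s => b.run (Data.cons a (Data.cons s e))) l s).size + 2 * t ≤
          s.size + 2 * (Data.fold (fun a (s : Data × ℕ) =>
            let y := Data.cons a (Data.cons s.1 e)
            (b.run y, s.2 + y.size + b.time y + 1)) l (s, t)).2 := by
      intro e l
      induction l with
      | nil => intro s t; exact le_rfl
      | cons a l _ ih =>
        intro s t
        have h1 := ih (b.run (Data.cons a (Data.cons s e)))
          (t + (Data.cons a (Data.cons s e)).size + b.time (Data.cons a (Data.cons s e)) + 1)
        have h2 := hb (Data.cons a (Data.cons s e))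
        simp only [Data.fold] at h1 ⊢
        omega
    have h1 := key x.tl.tl x.hd x.tl.hd 0
    have h2 := x.tl.size_hd_le
    have h3 := x.size_tl_le
    simp only [run, time] at h1 ⊢
    omega

/-- A function on trees that is computed by a program in polynomial time. -/
def PolyF (f : Data → Data) : Prop := ∃ p : Prog, p.PolyTime ∧ ∀ x, p.run x = f x

namespace PolyF

variable {f g c : Data → Data}

theorem size_le (hf : PolyF f) : ∃ q : Polynomial ℕ, ∀ x, (f x).size ≤ q.eval x.size := by
  obtain ⟨p, ⟨q, hq⟩, hp⟩ := hf
  refine ⟨2 * q, fun x => ?_⟩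
  have := p.size_run_le x
  have := hq x
  rw [← hp]
  simp only [Polynomial.eval_mul, Polynomial.eval_ofNat]
  omega

theorem id : PolyF fun x => x :=
  ⟨.id, ⟨Polynomial.X + 1, fun x => by simp [Prog.time]⟩, fun _ => rfl⟩

theorem comp (hg : PolyF g) (hf : PolyF f) : PolyF fun x => g (f x) := by
  obtain ⟨r, hr⟩ := hf.size_le
  obtain ⟨pf, ⟨qf, hqf⟩, hpf⟩ := hf
  obtain ⟨pg, ⟨qg, hqg⟩, hpg⟩ := hg
  refine ⟨.comp pg pf, ⟨qf + qg.comp r + 1, fun x => ?_⟩, fun x => by simp [Prog.run, hpf, hpg]⟩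
  have h1 := hqf x
  have h2 := (hqg (f x)).trans (eval_mono qg (hr x))
  simp only [Prog.time, hpf, Polynomial.eval_add, Polynomial.eval_comp, Polynomial.eval_one]
  omega

theorem cons (hf : PolyF f) (hg : PolyF g) : PolyF fun x => Data.cons (f x) (g x) := by
  obtain ⟨pf, ⟨qf, hqf⟩, hpf⟩ := hf
  obtain ⟨pg, ⟨qg, hqg⟩, hpg⟩ := hg
  refine ⟨.pair pf pg, ⟨qf + qg + 1, fun x => ?_⟩, fun x => by simp [Prog.run, hpf, hpg]⟩
  have h1 := hqf x
  have h2 := hqg x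
  simp only [Prog.time, Polynomial.eval_add, Polynomial.eval_one]
  omega

theorem const (d : Data) : PolyF fun _ => d := by
  induction d with
  | nil => exact ⟨.nil, ⟨1, fun x => by simp [Prog.time]⟩, fun _ => rfl⟩
  | cons a b ha hb => exact ha.cons hb

theorem hd (hf : PolyF f) : PolyF fun x => (f x).hd :=
  comp (g := Data.hd) ⟨.hd, ⟨Polynomial.X + 1, fun x => by simp [Prog.time]⟩, fun _ => rfl⟩ hf

theorem tl (hf : PolyF f) : PolyF fun x => (f x).tl :=
  comp (g := Data.tl) ⟨.tl, ⟨Polynomial.X + 1, fun x => by simp [Prog.time]⟩, fun _ => rfl⟩ hf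

theorem ite_nil (hc : PolyF c) (hf : PolyF f) (hg : PolyF g) :
    PolyF fun x => if c x = Data.nil then g x else f x := by
  obtain ⟨pc, ⟨qc, hqc⟩, hpc⟩ := hc
  obtain ⟨pf, ⟨qf, hqf⟩, hpf⟩ := hf
  obtain ⟨pg, ⟨qg, hqg⟩, hpg⟩ := hg
  refine ⟨.ite pc pf pg, ⟨qc + qf + qg + 1, fun x => ?_⟩,
    fun x => by simp [Prog.run, hpf, hpg, hpc]⟩
  have h1 := hqf x
  have h2 := hqg x
  have h3 := hqc x
  simp only [Prog.time, Polynomial.eval_add, Polynomial.eval_one]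
  split_ifs <;> omega

theorem ite_eq {k l : Data → Data} (hk : PolyF k) (hl : PolyF l) (hf : PolyF f) (hg : PolyF g) :
    PolyF fun x => if k x = l x then f x else g x := by
  have he : PolyF fun x => Data.ofBool (decide (x.hd = x.tl)) :=
    ⟨.eq, ⟨Polynomial.X + 1, fun x => by simp [Prog.time]⟩, fun _ => rfl⟩
  convert ite_nil (he.comp (hk.cons hl)) hf hg using 2 with x
  by_cases h : k x = l x <;> simp [h, Data.hd, Data.tl, Data.ofBool]

/-- A loop is polynomial if every pass adds to the size of the state at most a polynomial in the
sizes of the current element and of the input; the invariant `I` may help to show this. -/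
theorem fold_of_invariant {b : Data → Data → Data → Data} {l s : Data → Data}
    (hb : PolyF fun y => b y.hd y.tl.hd y.tl.tl) (hl : PolyF l) (hs : PolyF s)
    (I : Data → Data → Prop) (q : Polynomial ℕ) (hI₀ : ∀ x, I x (s x))
    (hI : ∀ a t x, I x t → I x (b a t x) ∧ (b a t x).size ≤ t.size + q.eval (a.size + x.size)) :
    PolyF fun x => Data.fold (fun a t => b a t x) (l x) (s x) := by
  obtain ⟨ql, hql⟩ := hl.size_le
  obtain ⟨qs, hqs⟩ := hs.size_le
  obtain ⟨pl, ⟨tl, htl⟩, hpl⟩ := hl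
  obtain ⟨ps, ⟨ts, hts⟩, hps⟩ := hs
  obtain ⟨p, ⟨tp, htp⟩, hp⟩ := hb
  have hp' : ∀ a t x, p.run (Data.cons a (Data.cons t x)) = b a t x := fun a t x => hp _
  -- `D` bounds the growth in one pass, `B` the state and `T` the time of one pass.
  have key : ∀ (x : Data) (K D B T : ℕ),
      q.eval (K + x.size) ≤ D → (K + (B + x.size + 1) + 1) +
        tp.eval (K + (B + x.size + 1) + 1) + 1 ≤ T →
      ∀ (m : Data) (t : Data) (n : ℕ), I x t → m.size ≤ K → t.size + m.size * D ≤ B →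
        (Data.fold (fun a (s : Data × ℕ) =>
          let y := Data.cons a (Data.cons s.1 x)
          (p.run y, s.2 + y.size + p.time y + 1)) m (t, n)).2 ≤ n + m.size * T := by
    intro x K D B T hD hT m
    induction m with
    | nil => intro t n _ _ _; simp
    | cons a m _ ih =>
      intro t n hIt hm ht
      obtain ⟨hIt', hgrow⟩ := hI a t x hIt
      simp only [Data.size] at hm ht
      have h1 : (b a t x).size ≤ t.size + D :=
        hgrow.trans (Nat.add_le_add_left ((eval_mono q (by omega)).trans hD) _)
      have h2 := ih (b a t x)
        (n + (Data.cons a (Data.cons t x)).size + p.time (Data.cons a (Data.cons t x)) + 1)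
        hIt' (by omega) (by nlinarith [Nat.zero_le (a.size * D)])
      have h3 : (Data.cons a (Data.cons t x)).size ≤ K + (B + x.size + 1) + 1 := by
        simp only [Data.size]
        nlinarith [Nat.zero_le ((a.size + m.size + 1) * D)]
      have h4 := (htp (Data.cons a (Data.cons t x))).trans (eval_mono tp h3)
      simp only [Data.fold, hp', Data.size] at h2 h3 h4 ⊢
      nlinarith [Nat.zero_le (a.size * T)]
  refine ⟨.comp (.loop p) (.pair pl (.pair ps .id)), ?_, fun x => ?_⟩
  · set D : Polynomial ℕ := q.comp (ql + .X) with hDdef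
    set B : Polynomial ℕ := qs + ql * D with hBdef
    set T : Polynomial ℕ := (ql + (B + .X + 1) + 1) + tp.comp (ql + (B + .X + 1) + 1) + 1 with hTdef
    refine ⟨tl + (ts + (.X + 1) + 1) + 1 + ((ql + (qs + .X + 1) + 1) + 1 + ql * T) + 1,
      fun x => ?_⟩
    have h1 := key x (ql.eval x.size) (D.eval x.size) (B.eval x.size) (T.eval x.size)
      (by simp [hDdef]) (by simp [hTdef]) (l x) (s x) 0 (hI₀ x) (hql x)
      (by
        have := Nat.mul_le_mul_right (D.eval x.size) (hql x)
        have := hqs x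
        simp only [hBdef, Polynomial.eval_add, Polynomial.eval_mul]
        omega)
    have h2 := Nat.mul_le_mul_right (T.eval x.size) (hql x)
    have h3 := htl x
    have h4 := hts x
    have h5 := hql x
    have h6 := hqs x
    simp only [Prog.time, Prog.run, hpl, hps, Data.hd, Data.tl, Data.size, Polynomial.eval_add,
      Polynomial.eval_mul, Polynomial.eval_X, Polynomial.eval_one] at h1 h2 ⊢
    omega
  · simp only [Prog.run, hpl, hps, Data.hd, Data.tl, hp']

theorem fold {b : Data → Data → Data → Data} {l s : Data → Data}
    (hb : PolyF fun y => b y.hd y.tl.hd y.tl.tl) (hl : PolyF l) (hs : PolyF s)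
    (q : Polynomial ℕ)
    (hq : ∀ a t x, (b a t x).size ≤ t.size + q.eval (a.size + x.size)) :
    PolyF fun x => Data.fold (fun a t => b a t x) (l x) (s x) :=
  fold_of_invariant hb hl hs (fun _ _ => True) q (fun _ => trivial) fun a t x _ =>
    ⟨trivial, hq a t x⟩

theorem fold_cons {l s : Data → Data} (hl : PolyF l) (hs : PolyF s) :
    PolyF fun x => Data.fold Data.cons (l x) (s x) :=
  fold (b := fun a t _ => Data.cons a t) (id.hd.cons id.tl.hd) hl hs (.X + 1) fun a t x => by
    simp [Data.size]; omega

theorem rev (hf : PolyF f) : PolyF fun x => (f x).rev := hf.fold_cons (const _)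

theorem app (hf : PolyF f) (hg : PolyF g) : PolyF fun x => (f x).app (g x) := hf.rev.fold_cons hg

theorem map {k : Data → Data → Data} {l : Data → Data} (hk : PolyF fun y => k y.hd y.tl)
    (hl : PolyF l) : PolyF fun x => Data.map (fun a => k a x) (l x) := by
  obtain ⟨q, hq⟩ := hk.size_le
  refine (fold (b := fun a t x => Data.cons (k a x) t) ?_ hl (const _) (q.comp (.X + 1) + 1)
    fun a t x => ?_).rev
  · exact (hk.comp (id.hd.cons id.tl.tl)).cons id.tl.hd
  · have := hq (Data.cons a x)
    simp only [Data.hd, Data.tl, Data.size] at this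
    simp only [Data.size, Polynomial.eval_add, Polynomial.eval_comp, Polynomial.eval_X,
      Polynomial.eval_one]
    omega

theorem bindList {k : Data → Data → Data} {l : Data → Data} (hk : PolyF fun y => k y.hd y.tl)
    (hl : PolyF l) : PolyF fun x => Data.bindList (fun a => k a x) (l x) := by
  obtain ⟨q, hq⟩ := hk.size_le
  refine fold (b := fun a t x => (k a x).app t) ?_ hl.rev (const _) (q.comp (.X + 1) + 1)
    fun a t x => ?_
  · exact (hk.comp (id.hd.cons id.tl.tl)).app id.tl.hd
  · have h1 := hq (Data.cons a x)
    have h2 := Data.size_app_le (k a x) t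
    simp only [Data.hd, Data.tl, Data.size] at h1
    simp only [Polynomial.eval_add, Polynomial.eval_comp, Polynomial.eval_X,
      Polynomial.eval_one]
    omega

theorem enum (hf : PolyF f) : PolyF fun x => (f x).enum := by
  have hn : PolyF fun x => x.map fun _ => Data.nil := map (k := fun _ _ => .nil) (const _) id
  obtain ⟨q, hq⟩ := hn.size_le
  refine comp (g := Data.enum) (tl ?_) hf
  refine fold_of_invariant (b := fun a s _ => .cons s.hd.tl (.cons (.cons s.hd.tl a) s.tl)) ?_
    id.rev (hn.cons (const _)) (fun x s => s.hd.size ≤ q.eval x.size) (q.comp .X + .X + 5) hq ?_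
  · exact id.tl.hd.hd.tl.cons ((id.tl.hd.hd.tl.cons id.hd).cons id.tl.hd.tl)
  · intro a t x h
    have h1 := t.hd.size_tl_le
    refine ⟨h1.trans h, ?_⟩
    have h2 : q.eval x.size ≤ q.eval (a.size + x.size) := eval_mono q (by omega)
    have h3 := a.one_le_size
    have h4 := x.one_le_size
    simp only [Polynomial.comp_X, Polynomial.eval_add, Polynomial.eval_X, Polynomial.eval_ofNat]
    cases t with
    | nil => simp only [Data.size, Data.hd, Data.tl]; omega
    | cons u v => simp only [Data.size, Data.hd_cons, Data.tl_cons] at h h1 ⊢; omega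

theorem range (hf : PolyF f) : PolyF fun x => (f x).range :=
  map (k := fun a _ => a.hd) id.hd.hd hf.enum

end PolyF

end

section

/-! ### The commands of the verifier are computed in polynomial time -/

open Data

/-- The number of clauses of the matrix in unary, from the encoded common input. -/
def numClauses (x : Data) : Data := map (fun _ => nil) x.hd.tl

/-- The encoded literals, as symbols, over the variables with the encoded quantifier `q`. -/
def symsOf (q : Data) (x : Data) : Data :=
  bindList (fun b =>
    if b.hd = q then bindList (fun v => ofList [tag 0 [cons v (ofBool false)],
      tag 0 [cons v (ofBool true)]]) b.tl else nil) x.hd.hd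

/-- The encoded commands of the verifier in the step with the unary number `i`. -/
def stepCmds (i x : Data) : Data :=
  app (app (app (app (app
    (ofList
      [ tag 1 [tag 1 [i]],
        tag 4 [tag 2 [i], x.tl.tl.hd],
        tag 10 [app (numClauses x) i, tag 3 [i]],
        tag 10 [app (numClauses x) i, tag 4 [i]],
        tag 7 [tag 3 [i], tag 4 [i], tag 1 [i], tag 2 [i]],
        tag 13 [tag 1 [i], Quant.ex.enc],
        tag 4 [tag 5 [i], x.tl.tl.hd],
        tag 4 [tag 6 [i], x.tl.tl.hd],
        tag 4 [tag 7 [i], x.tl.tl.hd],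
        tag 5 [tag 5 [i], map (fun j => tag 10 [i, j]) (range x.tl.tl.hd)],
        tag 5 [tag 6 [i], map (fun j => tag 12 [i, j]) (range x.tl.tl.tl.hd)],
        tag 5 [tag 7 [i], ofList [tag 8 [i]]],
        tag 2 [tag 8 [i], tag 9 [i]] ])
    (bindList (fun j => ofList
      [ tag 2 [tag 10 [i, j], tag 11 [i, j]],
        tag 15 [CmpOp.lt.enc, tag 11 [i, j], tag 9 [i]] ]) (range x.tl.tl.hd)))
    (bindList (fun j => ofList
      [ tag 2 [tag 12 [i, j], tag 13 [i, j]],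
        tag 15 [CmpOp.gt.enc, tag 13 [i, j], tag 9 [i]] ]) (range x.tl.tl.tl.hd)))
    (ofList [tag 13 [tag 8 [i], Quant.ex.enc]]))
    (map (fun j => tag 13 [tag 12 [i, j], Quant.all.enc]) (range x.tl.tl.tl.hd)))
    (ofList
      [ tag 6 [tag 0 [app (numClauses x) i], ofList [tag 5 [i], tag 7 [i]]],
        tag 6 [tag 2 [i], ofList [tag 5 [i], tag 7 [i], tag 6 [i]]] ])

/-- The encoded commands of the verifier, from the encoded common input. -/
def scriptData (x : Data) : Data :=
  app (app (app (app (app (app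
    (ofList [cons (ofNat 0) (bindList (fun b => b.tl) x.hd.hd)])
    (map (fun c => tag 3 [tag 0 [c.hd], c.tl, x.tl.tl.hd]) (enum x.hd.tl)))
    (ofList [tag 12 [cons Sym.noEx.enc (symsOf Quant.ex.enc x),
      cons Sym.padHi.enc (symsOf Quant.all.enc x)]]))
    (map (fun i => tag 4 [tag 0 [app (numClauses x) i], x.tl.tl.hd]) (range x.tl.hd)))
    (ofList [tag 9 [map (fun j => tag 0 [j]) (range (app (numClauses x) x.tl.hd))]]))
    (bindList (fun i => stepCmds i x) (range x.tl.hd)))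
    (ofList [tag 8 [tag 0 [(app (numClauses x) x.tl.hd).tl]], tag 11 [], tag 14 []])

theorem PolyF.numClauses {f : Data → Data} (hf : PolyF f) : PolyF fun x => numClauses (f x) :=
  PolyF.map (k := fun _ _ => .nil) (const _) hf.hd.tl

theorem PolyF.symsOf (q : Data) {f : Data → Data} (hf : PolyF f) :
    PolyF fun x => symsOf q (f x) := by
  refine PolyF.bindList (k := fun b _ => if b.hd = q then Data.bindList _ b.tl else .nil) ?_
    hf.hd.hd
  refine PolyF.ite_eq id.hd.hd (const _) ?_ (const _)
  refine PolyF.bindList (k := fun v _ => ofList [_, _]) ?_ id.hd.tl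
  simp only [tag, ofList_cons, ofList_nil]
  repeat' first
    | with_reducible exact PolyF.const _
    | with_reducible exact PolyF.id
    | with_reducible apply PolyF.hd
    | with_reducible apply PolyF.cons

theorem polyF_stepCmds : PolyF fun y => stepCmds y.hd y.tl := by
  unfold stepCmds
  simp only [tag, ofList_cons, ofList_nil]
  repeat' first
    | with_reducible exact PolyF.const _
    | with_reducible exact PolyF.id
    | with_reducible apply PolyF.hd
    | with_reducible apply PolyF.tl
    | with_reducible apply PolyF.numClauses
    | with_reducible apply PolyF.range
    | with_reducible apply PolyF.app
    | with_reducible apply PolyF.bindList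
    | with_reducible apply PolyF.map
    | with_reducible apply PolyF.cons

theorem PolyF.scriptData {f : Data → Data} (hf : PolyF f) : PolyF fun x => scriptData (f x) := by
  refine PolyF.comp (g := QRes.scriptData) ?_ hf
  unfold QRes.scriptData
  simp only [tag, ofList_cons, ofList_nil]
  repeat' first
    | with_reducible exact PolyF.const _
    | with_reducible exact PolyF.id
    | with_reducible exact polyF_stepCmds
    | with_reducible apply PolyF.hd
    | with_reducible apply PolyF.tl
    | with_reducible apply PolyF.numClauses
    | with_reducible apply PolyF.symsOf
    | with_reducible apply PolyF.range
    | with_reducible apply PolyF.enum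
    | with_reducible apply PolyF.app
    | with_reducible apply PolyF.bindList
    | with_reducible apply PolyF.map
    | with_reducible apply PolyF.cons

theorem numClauses_enc (x : Stmt) : numClauses x.enc = ofNat x.L := by
  simp [Stmt.enc, QBF.enc, numClauses, map_nil_ofList, Stmt.L, -map_ofList]

theorem Quant.enc_injective : Function.Injective Quant.enc := by
  intro a b h; cases a <;> cases b <;> first | rfl | cases h

theorem symsOf_enc (x : Stmt) (q : Quant) :
    symsOf q.enc x.enc = ofList ((x.qbf.lits q).map fun l => (Sym.lit l).enc) := by
  simp only [symsOf, Stmt.enc, QBF.enc, ofList_cons, hd_cons, QBF.lits, List.map_flatMap]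
  refine bindList_ofList _ _ _ _ fun b _ => ?_
  simp only [hd_cons, tl_cons, Quant.enc_injective.eq_iff]
  split_ifs
  · rw [List.map_flatMap]
    exact bindList_ofList _ _ _ _ fun v _ => rfl
  · rfl

variable {F : Type}

theorem bindList_range (f : Data → Data) (k : ℕ → List Data) (n : ℕ)
    (h : ∀ i, f (ofNat i) = ofList (k i)) :
    bindList f (ofList ((List.range n).map ofNat)) = ofList ((List.range n).flatMap k) :=
  bindList_ofList _ _ _ _ fun i _ => h i

theorem stepCmds_enc (x : Stmt) (i : ℕ) :
    stepCmds (ofNat i) x.enc = ofList ((verifierStep F x i).map Cmd.enc) := by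
  have hw : x.enc.tl.tl.hd = ofNat x.w := rfl
  have hd : x.enc.tl.tl.tl.hd = ofNat x.d := rfl
  rw [stepCmds, numClauses_enc, hw, hd]
  simp only [range_ofNat, app_ofNat, map_ofList]
  rw [bindList_range _ (fun j => [Cmd.ord (.order (.resLit i j) (.resOrd i j)),
      Cmd.zk (.compare .lt (.resOrd i j) (.wOrd i))].map (Cmd.enc (F := F))) _ fun j => rfl,
    bindList_range _ (fun j => [Cmd.ord (.order (.remLit i j) (.remOrd i j)),
      Cmd.zk (.compare .gt (.remOrd i j) (.wOrd i))].map (Cmd.enc (F := F))) _ fun j => rfl]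
  simp only [app_ofList, verifierStep, List.map_append, List.map_flatMap, List.map_map]
  simp only [List.map_cons, List.map_nil, Cmd.enc, encNames, List.map_map]
  rfl

theorem scriptData_enc (x : Stmt) :
    scriptData x.enc = ofList ((verifierScript F x).map Cmd.enc) := by
  have hw : x.enc.tl.tl.hd = ofNat x.w := rfl
  have hR : x.enc.tl.hd = ofNat x.R := rfl
  have hm : x.enc.hd.tl = ofList (x.qbf.matrix.map encClause) := rfl
  have hb : x.enc.hd.hd = ofList (x.qbf.blocks.map (fun b => cons b.1.enc
    (ofList (b.2.map ofBits)))) := rfl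
  rw [scriptData, numClauses_enc, symsOf_enc, symsOf_enc, hw, hR, hm, hb,
    bindList_ofList _ _ (fun b => b.2.map ofBits) _ fun b _ => rfl, enum_ofList]
  simp only [range_ofNat, app_ofNat, map_ofList, tl_ofNat]
  rw [bindList_range (fun i => stepCmds i x.enc) (fun i => (verifierStep F x i).map Cmd.enc) _
    (stepCmds_enc x)]
  simp only [app_ofList, verifierScript, List.map_append, List.map_flatMap, List.map_map,
    List.zipIdx_map]
  simp only [List.map_cons, List.map_nil, Cmd.enc, encNames, List.map_map, QBF.vars,
    List.map_flatMap, exSyms, allSyms, Function.comp_def, app_ofNat]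
  rfl

theorem efficientVerifier (F : Type) : EfficientVerifier F := by
  obtain ⟨p, hp, h⟩ := PolyF.id.scriptData
  exact ⟨p, hp, fun x => (h _).trans (scriptData_enc x)⟩

end

section

/-! ### Soundness of Q-resolution -/

namespace QBF

variable {φ : QBF}

theorem map_snd_quants (φ : QBF) : φ.quants.map Prod.snd = φ.vars := by
  simp [quants, vars, List.map_flatMap, Function.comp_def]

theorem isEx_or_all (x : ℕ) (hx : x ∈ φ.vars) : φ.IsEx x ∨ (Quant.all, x) ∈ φ.quants := by
  rw [← map_snd_quants, List.mem_map] at hx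
  obtain ⟨⟨q, y⟩, h, rfl⟩ := hx
  cases q
  · exact Or.inl h
  · exact Or.inr h

theorem Admissible.not_isEx (h : φ.Admissible) {x : ℕ} (hx : (Quant.all, x) ∈ φ.quants) :
    ¬ φ.IsEx x := by
  intro he
  have := List.inj_on_of_nodup_map (φ.map_snd_quants.symm ▸ h.nodup) hx he rfl
  cases this

theorem IsEx.mem_vars {x : ℕ} (h : φ.IsEx x) : x ∈ φ.vars := by
  rw [← map_snd_quants]
  exact List.mem_map_of_mem (f := Prod.snd) h

theorem forallRed_subset (C : Clause) : φ.forallRed C ⊆ C := Finset.filter_subset _ _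

theorem Sat.mono {M M' : List Clause}
    (h : ∀ σ : ℕ → Bool, (∀ C ∈ M, ∃ l ∈ C, σ l.var = l.sign) →
      ∀ C ∈ M', ∃ l ∈ C, σ l.var = l.sign) :
    ∀ (Q : List (Quant × ℕ)) (σ : ℕ → Bool), Sat M Q σ → Sat M' Q σ
  | [], σ, hs => h σ hs
  | (Quant.ex, _) :: Q, _, ⟨b, hb⟩ => ⟨b, Sat.mono h Q _ hb⟩
  | (Quant.all, _) :: Q, _, hs => fun b => Sat.mono h Q _ (hs b)

/-- A clause stays satisfied if one of its literals is true and not affected by the prefix. -/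
theorem Sat.cons_of_literal {M : List Clause} {C : Clause} {l : Lit} (hl : l ∈ C) :
    ∀ (Q : List (Quant × ℕ)) (σ : ℕ → Bool), l.var ∉ Q.map Prod.snd → σ l.var = l.sign →
      Sat M Q σ → Sat (C :: M) Q σ
  | [], σ, _, hσ, hs => by
      intro D hD
      rcases List.mem_cons.1 hD with rfl | hD
      · exact ⟨l, hl, hσ⟩
      · exact hs D hD
  | (Quant.ex, x) :: Q, σ, hn, hσ, ⟨b, hb⟩ => by
      simp only [List.map_cons, List.mem_cons, not_or] at hn
      exact ⟨b, Sat.cons_of_literal hl Q _ hn.2 (by rwa [Function.update_of_ne hn.1]) hb⟩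
  | (Quant.all, x) :: Q, σ, hn, hσ, hs => by
      simp only [List.map_cons, List.mem_cons, not_or] at hn
      exact fun b => Sat.cons_of_literal hl Q _ hn.2 (by rwa [Function.update_of_ne hn.1]) (hs b)

/-- The universal player wins against a clause without complementary literals each of whose
literals is already false or belongs to a universal variable that is yet to be played. -/
theorem not_sat_of_universal {M : List Clause} {C : Clause} (hC : C ∈ M) (hN : NonTaut C) :
    ∀ (Q : List (Quant × ℕ)) (σ : ℕ → Bool), (Q.map Prod.snd).Nodup →
      (∀ l ∈ C, (l.var ∉ Q.map Prod.snd ∧ σ l.var ≠ l.sign) ∨ (Quant.all, l.var) ∈ Q) →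
      ¬ Sat M Q σ
  | [], σ, _, hl, hs => by
      obtain ⟨l, hlC, h⟩ := hs C hC
      rcases hl l hlC with h' | h'
      · exact h'.2 h
      · simp at h'
  | (Quant.ex, x) :: Q, σ, hQ, hl, ⟨b, hb⟩ => by
      rw [List.map_cons, List.nodup_cons] at hQ
      refine not_sat_of_universal hC hN Q _ hQ.2 (fun l hlC => ?_) hb
      rcases hl l hlC with ⟨h, h'⟩ | h
      · simp only [List.map_cons, List.mem_cons, not_or] at h
        exact Or.inl ⟨h.2, by rwa [Function.update_of_ne h.1]⟩
      · exact Or.inr (by simpa using h)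
  | (Quant.all, x) :: Q, σ, hQ, hl, hs => by
      rw [List.map_cons, List.nodup_cons] at hQ
      obtain ⟨b, hb⟩ : ∃ b : Bool, ∀ l ∈ C, l.var = x → b ≠ l.sign := by
        by_cases hx : ∃ l ∈ C, l.var = x
        · obtain ⟨l, hlC, hlx⟩ := hx
          refine ⟨!l.sign, fun m hm hmx hs => hN l hlC ?_⟩
          rwa [show l.neg = m from Lit.ext (hlx.trans hmx.symm) hs]
        · exact ⟨true, fun l hlC hlx => (hx ⟨l, hlC, hlx⟩).elim⟩
      refine not_sat_of_universal hC hN Q _ hQ.2 (fun l hlC => ?_) (hs b)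
      rcases hl l hlC with ⟨h, h'⟩ | h
      · simp only [List.map_cons, List.mem_cons, not_or] at h
        exact Or.inl ⟨h.2, by rwa [Function.update_of_ne h.1]⟩
      · rcases List.mem_cons.1 h with h | h
        · have hx : l.var = x := congrArg Prod.snd h
          refine Or.inl ⟨hx ▸ hQ.1, ?_⟩
          rw [hx, Function.update_self]
          exact hb l hlC hx
        · exact Or.inr h

/-- Universal reduction preserves truth. The induction descends along the prefix as long as an
existential variable of the clause is to come; after that, the literals that are removed can all
be falsified by the universal player. -/
theorem sat_forallRed (h : φ.Admissible) {M : List Clause} {C : Clause}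
    (hN : NonTaut C) :
    ∀ (Q P : List (Quant × ℕ)) (σ : ℕ → Bool), φ.quants = P ++ Q →
      (∀ l ∈ C, l ∉ φ.forallRed C → l.var ∈ Q.map Prod.snd) →
      Sat (C :: M) Q σ → Sat (φ.forallRed C :: M) Q σ := by
  intro Q
  have hnd := h.nodup
  have hpos : ∀ x, φ.pos x = (φ.quants.map Prod.snd).idxOf x := by
    intro x; rw [map_snd_quants]; rfl
  have hmem : ∀ {l : Lit}, l ∈ C → (l ∈ φ.forallRed C ↔
      φ.IsEx l.var ∨ ∃ m ∈ C, φ.IsEx m.var ∧ φ.pos l.var < φ.pos m.var) := by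
    intro l hl; simp [forallRed, hl]
  rw [← map_snd_quants] at hnd
  induction Q with
  | nil =>
    intro P σ _ hU hs
    have : φ.forallRed C = C := Finset.Subset.antisymm (forallRed_subset C) fun l hl => by
      by_contra hn
      simpa using hU l hl hn
    rwa [this]
  | cons qx Q ih =>
    intro P σ hP hU hs
    obtain ⟨q, x⟩ := qx
    rw [hP, List.map_append, List.nodup_append] at hnd
    by_cases hm : ∃ m ∈ C, (Quant.ex, m.var) ∈ (q, x) :: Q
    · obtain ⟨m, hmC, hmQ⟩ := hm
      have hmEx : φ.IsEx m.var := by rw [IsEx, hP]; exact List.mem_append_right _ hmQ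
      have hU' : ∀ l ∈ C, l ∉ φ.forallRed C → l.var ∈ Q.map Prod.snd := by
        intro l hl hlr
        have h1 := hU l hl hlr
        rw [List.map_cons, List.mem_cons] at h1
        refine h1.resolve_left fun hlx => hlr ((hmem hl).2 ?_)
        by_contra hno
        rw [not_or, not_exists] at hno
        refine hno.2 m ⟨hmC, hmEx, ?_⟩
        have hne : m.var ≠ x := by rintro rfl; exact hno.1 (hlx ▸ hmEx)
        have hxP : x ∉ P.map Prod.snd := fun hx => hnd.2.2 x hx x (by simp) rfl
        have hmP : m.var ∉ P.map Prod.snd := fun hx =>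
          hnd.2.2 _ hx _ (List.mem_map_of_mem (f := Prod.snd) hmQ) rfl
        rw [hpos, hpos, hP, List.map_append, List.idxOf_append_of_notMem (hlx ▸ hxP),
          List.idxOf_append_of_notMem hmP, List.map_cons, hlx, List.idxOf_cons_self,
          List.idxOf_cons_ne _ hne.symm]
        omega
      cases q
      · obtain ⟨b, hb⟩ := hs
        exact ⟨b, ih (P ++ [(Quant.ex, x)]) _ (by simpa using hP) hU' hb⟩
      · exact fun b => ih (P ++ [(Quant.all, x)]) _ (by simpa using hP) hU' (hs b)
    -- No existential variable of `C` is to come: the literals still to be played are exactly those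
    -- removed by the reduction.
    · generalize hQ' : (q, x) :: Q = Q' at *
      have hex : ∀ m ∈ C, φ.IsEx m.var → m.var ∉ Q'.map Prod.snd := by
        intro m hmC hme hmQ
        obtain ⟨⟨q', y⟩, h1, h2⟩ := List.mem_map.1 hmQ
        simp only at h2
        subst h2
        cases q'
        · exact hm ⟨m, hmC, h1⟩
        · exact h.not_isEx (by rw [hP]; exact List.mem_append_right _ h1) hme
      have hred : ∀ l ∈ φ.forallRed C, l.var ∉ Q'.map Prod.snd := by
        intro l hl hlQ
        have hlC := forallRed_subset C hl
        rcases (hmem hlC).1 hl with he | ⟨m, hmC, hme, hlt⟩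
        · exact hex l hlC he hlQ
        · have hmQ := hex m hmC hme
          have hmP : m.var ∈ P.map Prod.snd := by
            have := hme.mem_vars
            rw [← map_snd_quants, hP, List.map_append, List.mem_append] at this
            exact this.resolve_right hmQ
          have hlP : l.var ∉ P.map Prod.snd := fun hx => hnd.2.2 _ hx _ hlQ rfl
          rw [hpos, hpos, hP, List.map_append, List.idxOf_append_of_notMem hlP,
            List.idxOf_append_of_mem hmP] at hlt
          have := List.idxOf_lt_length_of_mem hmP
          omega
      by_cases hσ : ∃ l ∈ φ.forallRed C, σ l.var = l.sign
      · obtain ⟨l, hl, hlσ⟩ := hσ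
        exact Sat.cons_of_literal hl _ _ (hred l hl) hlσ
          (Sat.mono (fun _ h D hD => h D (List.mem_cons_of_mem _ hD)) _ _ hs)
      · refine (not_sat_of_universal List.mem_cons_self hN Q' σ hnd.2.1 (fun l hl => ?_) hs).elim
        by_cases hlr : l ∈ φ.forallRed C
        · exact Or.inl ⟨hred l hlr, fun hl' => hσ ⟨l, hlr, hl'⟩⟩
        · obtain ⟨⟨q', y⟩, h1, h2⟩ := List.mem_map.1 (hU l hl hlr)
          simp only at h2
          subst h2
          cases q'
          · exact (hm ⟨l, hl, h1⟩).elim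
          · exact Or.inr h1

end QBF

variable {φ : QBF} {π : List Step}

theorem IsResolvent.subset {A B C : Clause} {p : Lit} (h : IsResolvent A B p C) : C ⊆ A ∪ B := by
  rw [h.2.2.1]
  exact Finset.union_subset_union (Finset.erase_subset _ _) (Finset.erase_subset _ _)

theorem IsResolvent.satisfied {A B C : Clause} {p : Lit} (h : IsResolvent A B p C)
    {σ : ℕ → Bool} (hA : ∃ l ∈ A, σ l.var = l.sign) (hB : ∃ l ∈ B, σ l.var = l.sign) :
    ∃ l ∈ C, σ l.var = l.sign := by
  obtain ⟨a, haA, ha⟩ := hA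
  obtain ⟨b, hbB, hb⟩ := hB
  rw [h.2.2.1]
  by_cases hap : a = p
  · refine ⟨b, Finset.mem_union_right _ (Finset.mem_erase.2 ⟨?_, hbB⟩), hb⟩
    rintro rfl
    subst hap
    rw [Lit.neg, ha] at hb
    simp at hb
  · exact ⟨a, Finset.mem_union_left _ (Finset.mem_erase.2 ⟨hap, haA⟩), ha⟩

theorem getElem?_clauseSeq_lt {k j : ℕ} (hj : j < φ.matrix.length + k) :
    (clauseSeq φ π)[j]? = (φ.matrix ++ (π.take k).map Step.red)[j]? := by
  rw [clauseSeq, List.getElem?_append, List.getElem?_append]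
  split_ifs
  · rfl
  · rw [List.getElem?_map, List.getElem?_map, List.getElem?_take_of_lt (by omega)]

/-- All clauses of a derivation are over the variables of the formula. -/
theorem closed_of_valid (h : φ.Admissible)
    (hv : ∀ i s, π[i]? = some s → ValidStep φ π i s) (k : ℕ) :
    ∀ C ∈ φ.matrix ++ (π.take k).map Step.red, ∀ l ∈ C, l.var ∈ φ.vars := by
  induction k with
  | zero => simpa using h.closed
  | succ k ih =>
    intro C hC l hl
    rcases hk : π[k]? with _ | s
    · rw [List.take_of_length_le (by rw [List.getElem?_eq_none_iff] at hk; omega)] at hC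
      rw [List.take_of_length_le (by rwa [List.getElem?_eq_none_iff] at hk)] at ih
      exact ih C hC l hl
    · rw [List.take_add_one, hk, Option.toList_some, List.map_append, ← List.append_assoc,
        List.mem_append] at hC
      rcases hC with hC | hC
      · exact ih C hC l hl
      · obtain ⟨hL, hR, A, B, hA, hB, -, hres, hred⟩ := hv k s hk
        rw [getElem?_clauseSeq_lt hL] at hA
        rw [getElem?_clauseSeq_lt hR] at hB
        rw [List.map_singleton, List.mem_singleton] at hC
        subst hC
        rw [hred] at hl
        rcases Finset.mem_union.1 (hres.subset (QBF.forallRed_subset _ hl)) with hl | hl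
        · exact ih A (List.mem_of_getElem? hA) l hl
        · exact ih B (List.mem_of_getElem? hB) l hl

theorem closed_bar (h : φ.Admissible) (hv : ∀ i s, π[i]? = some s → ValidStep φ π i s)
    {s : Step} (hs : s ∈ π) : ∀ l ∈ s.bar, l.var ∈ φ.vars := by
  intro l hl
  obtain ⟨i, hi⟩ := List.mem_iff_getElem?.1 hs
  obtain ⟨hL, hR, A, B, hA, hB, -, hres, -⟩ := hv i s hi
  rw [getElem?_clauseSeq_lt hL] at hA
  rw [getElem?_clauseSeq_lt hR] at hB
  rcases Finset.mem_union.1 (hres.subset hl) with hl | hl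
  · exact closed_of_valid h hv i A (List.mem_of_getElem? hA) l hl
  · exact closed_of_valid h hv i B (List.mem_of_getElem? hB) l hl

/-- A formula with a Q-resolution refutation is false. -/
theorem IsRefutation.not_isTrue (h : φ.Admissible) (hπ : IsRefutation φ π) : ¬ φ.IsTrue := by
  obtain ⟨hv, hlast⟩ := hπ
  intro ht
  have key : ∀ k, QBF.Sat (φ.matrix ++ (π.take k).map Step.red) φ.quants (fun _ => false) := by
    intro k
    induction k with
    | zero => simpa [QBF.IsTrue] using ht
    | succ k ih =>
      rcases hk : π[k]? with _ | s
      · rw [List.take_of_length_le (by rw [List.getElem?_eq_none_iff] at hk; omega)]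
        rwa [List.take_of_length_le (by rwa [List.getElem?_eq_none_iff] at hk)] at ih
      · obtain ⟨hL, hR, A, B, hA, hB, -, hres, hred⟩ := hv k s hk
        rw [getElem?_clauseSeq_lt hL] at hA
        rw [getElem?_clauseSeq_lt hR] at hB
        have h1 : QBF.Sat (s.bar :: (φ.matrix ++ (π.take k).map Step.red)) φ.quants
            (fun _ => false) := by
          refine QBF.Sat.mono (fun σ hσ C hC => ?_) _ _ ih
          rcases List.mem_cons.1 hC with rfl | hC
          · exact hres.satisfied (hσ A (List.mem_of_getElem? hA)) (hσ B (List.mem_of_getElem? hB))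
          · exact hσ C hC
        have hcl := closed_bar h hv (List.mem_of_getElem? hk)
        have h2 := QBF.sat_forallRed h hres.2.2.2 φ.quants [] _ rfl
          (fun l hl _ => by rw [QBF.map_snd_quants]; exact hcl l hl) h1
        rw [List.take_add_one, hk, Option.toList_some, List.map_append, ← List.append_assoc]
        refine QBF.Sat.mono (fun σ hσ C hC => ?_) _ _ h2
        rw [List.map_singleton, List.mem_append, List.mem_singleton, hred] at hC
        rcases hC with hC | rfl
        · exact hσ C (List.mem_cons_of_mem _ hC)
        · exact hσ _ List.mem_cons_self
  have h1 := key π.length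
  rw [List.take_length] at h1
  refine QBF.not_sat_of_universal (C := ∅) (List.mem_of_getLast? hlast) (fun l hl => ?_) _ _
    (by rw [QBF.map_snd_quants]; exact h.nodup) (fun l hl => ?_) h1
  · simp at hl
  · simp at hl

end

section

/-! ### What an accepting run proves about the committed values -/

variable {F : Type}

theorem mapM_eq_some_iff {α β : Type} {f : α → Option β} {l : List α} {m : List β} :
    l.mapM f = some m ↔ List.Forall₂ (fun a b => f a = some b) l m := by
  induction l generalizing m with
  | nil => simp [List.mapM_nil, eq_comm]
  | cons a l ih =>
    simp only [List.mapM_cons, Option.bind_eq_bind, Option.bind_eq_some_iff, Option.pure_def,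
      Option.some.injEq]
    constructor
    · rintro ⟨b, hb, bs, hbs, rfl⟩
      exact .cons hb (ih.1 hbs)
    · rintro (_ | ⟨hb, hbs⟩)
      exact ⟨_, hb, _, ih.2 hbs, rfl⟩

/-- The parties send the same command, up to the time stamp of a `read` and the quantifier of a
`check`. -/
def Cmd.Agree (c v : Cmd F) : Prop :=
  c = v ∨ (∃ t t' n, c = .array (.read t n) ∧ v = .array (.read t' n)) ∨
    ∃ n q q', c = .quant (.check n q) ∧ v = .quant (.check n q')

namespace State

/-- Everything that is stored in `s` is stored in `t`, and the flags that are set in `s` are set in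
`t`. The flag of the array counts only once the array is set up, which clears it. -/
structure Le (s t : State F) : Prop where
  store : ∀ n v, s.store n = some v → t.store n = some v
  vars : ∀ a, s.vars = some a → t.vars = some a
  arr : ∀ a, s.arr = some a → t.arr = some a
  quants : ∀ a, s.quants = some a → t.quants = some a
  quantFlag : s.quantFlag = true → t.quantFlag = true
  arrFlag : ∀ a, s.arr = some a → s.arrFlag = true → t.arrFlag = true

theorem Le.refl (s : State F) : s.Le s :=
  ⟨fun _ _ => id, fun _ => id, fun _ => id, fun _ => id, id, fun _ _ => id⟩

theorem Le.trans {s t u : State F} (h : s.Le t) (k : t.Le u) : s.Le u :=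
  ⟨fun n v a => k.store n v (h.store n v a), fun x a => k.vars x (h.vars x a),
    fun x a => k.arr x (h.arr x a), fun x a => k.quants x (h.quants x a),
    fun a => k.quantFlag (h.quantFlag a), fun x a b => k.arrFlag x (h.arr x a) (h.arrFlag x a b)⟩

variable {st st' stf : State F}

theorem put_eq_some {n : Name} {v : Val F} (h : st.put n v = some st') :
    st.store n = none ∧ st' = { st with store := Function.update st.store n (some v) } := by
  unfold put at h
  split_ifs at h with hn
  exact ⟨hn, (Option.some.inj h).symm⟩

theorem Le.of_put {n : Name} {v : Val F} (h : st.put n v = some st') : st.Le st' := by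
  obtain ⟨h1, rfl⟩ := put_eq_some h
  refine ⟨fun m u hm => ?_, fun _ => id, fun _ => id, fun _ => id, id, fun _ _ => id⟩
  have : m ≠ n := by rintro rfl; rw [h1] at hm; cases hm
  simpa [Function.update_of_ne this] using hm

theorem store_of_put {n : Name} {v : Val F} (h : st.put n v = some st') :
    st'.store n = some v := by
  obtain ⟨-, rfl⟩ := put_eq_some h
  simp

theorem Le.of_putAll {ns : List Name} {vs : List (Val F)} (h : st.putAll ns vs = some st') :
    st.Le st' ∧ List.Forall₂ (fun n v => st'.store n = some v) ns vs := by
  induction ns generalizing st vs with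
  | nil =>
    cases vs with
    | nil => cases h; exact ⟨Le.refl _, .nil⟩
    | cons => cases h
  | cons n ns ih =>
    cases vs with
    | nil => cases h
    | cons v vs =>
      simp only [putAll, Option.bind_eq_some_iff] at h
      obtain ⟨s, h1, h2⟩ := h
      obtain ⟨h3, h4⟩ := ih h2
      exact ⟨(Le.of_put h1).trans h3, .cons (h3.store _ _ (store_of_put h1)) h4⟩

theorem putAll_fields {ns : List Name} {vs : List (Val F)} (h : st.putAll ns vs = some st') :
    st'.arr = st.arr ∧ st'.quants = st.quants := by
  induction ns generalizing st vs with
  | nil => cases vs <;> cases h; exact ⟨rfl, rfl⟩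
  | cons n ns ih =>
    cases vs with
    | nil => cases h
    | cons v vs =>
      simp only [putAll, Option.bind_eq_some_iff] at h
      obtain ⟨s, h1, h2⟩ := h
      have h3 := ih h2
      obtain ⟨-, rfl⟩ := put_eq_some h1
      exact h3

theorem getSym_eq_some {n : Name} {s : Sym} :
    st.getSym n = some s ↔ st.store n = some (.lit s) := by
  unfold getSym; split <;> simp_all

theorem getNat_eq_some {n : Name} {i : ℕ} :
    st.getNat n = some i ↔ st.store n = some (.nat i) := by
  unfold getNat; split <;> simp_all

theorem getClause_eq_some {n : Name} {C : Clause} :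
    st.getClause n = some C ↔ st.store n = some (.clause C) := by
  unfold getClause; split <;> simp_all

/-- The symbols that belong to a quantifier, among the existential and the universal ones. -/
def quantSyms : Quant → List Sym × List Sym → List Sym
  | .ex, Ls => Ls.1
  | .all, Ls => Ls.2

/-- What the execution of a command of the verifier with the message `p` of the prover implies for
every later state `st`. -/
def Fact (st : State F) (p : PMsg F) : Cmd F → Prop
  | .ord (.setup vs) => st.vars = some vs
  | .ord (.input n) => p.cmd = .ord (.input n) ∧
      ∃ l, p.priv = .lit l ∧ st.store n = some (.lit (.lit l))
  | .ord (.order s n) => ∃ a vs, st.store s = some (.lit a) ∧ st.vars = some vs ∧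
      st.store n = some (.nat (symOrder vs a))
  | .clause (.common n C w) => C.card ≤ w ∧ st.store n = some (.clause C)
  | .clause (.input n w) => p.cmd = .clause (.input n w) ∧
      ∃ C, p.priv = .clause C ∧ C.card ≤ w ∧ st.store n = some (.clause C)
  | .clause (.retrieval s ns) => ∃ S, st.store s = some (.clause (litSet S)) ∧
      List.Forall₂ (fun n a => st.store n = some (.lit a)) ns S
  | .clause (.equal c cs) => ∃ Cs : List Clause,
      List.Forall₂ (fun n C => st.store n = some (.clause C)) cs Cs ∧
      st.store c = some (.clause (Cs.foldr (· ∪ ·) ∅))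
  | .clause (.res a b p c) => ∃ A B l C, st.store a = some (.clause A) ∧
      st.store b = some (.clause B) ∧ st.store p = some (.lit (.lit l)) ∧
      st.store c = some (.clause C) ∧ IsResolvent A B l C
  | .clause (.isFalse c) => st.store c = some (.clause ∅)
  | .array (.setup _) => True
  | .array (.read t n) => ∃ t' i C, p = ⟨.array (.read t' n), .read i C⟩ ∧
      st.store n = some (.clause C) ∧
      (st.arrFlag = false → i < t ∧ ∃ M, st.arr = some M ∧ M[i]? = some C)
  | .quant (.check n q) => ∃ a Ls, st.store n = some (.lit a) ∧ st.quants = some Ls ∧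
      (st.quantFlag = false → a ∈ quantSyms q Ls)
  | .zk (.compare op i j) => ∃ a b, st.store i = some (.nat a) ∧ st.store j = some (.nat b) ∧
      op.Holds a b
  | _ => True

theorem answer_le {f : Bool} {a : Priv F} {r : Resp} (h : answer f a = some r)
    (hr : r ≠ .cheating) : f = false := by
  unfold answer at h
  split at h <;> simp_all
  by_contra hf
  simp_all

/-- The commands that the parties use in the protocol, except `setup` of the array and of the
quantifiers, and the final checks. -/
def IsPlain : Cmd F → Prop
  | .ord _ => True
  | .clause _ => True
  | .array (.read _ _) => True
  | .quant (.check _ _) => True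
  | .zk (.compare _ _ _) => True
  | _ => False

variable [Field F]

/-- Execution of a command on which the parties agree. -/
def execCmd (st : State F) (c : Cmd F) (a : Priv F) : Option (State F × Resp) :=
  match c with
  | .ord c => st.execOrd c a
  | .clause c => st.execClause c a
  | .array c => st.execArray 0 c a
  | .quant c => st.execQuant .ex c a
  | .zk c => st.execZK c a
  | .zkset c => st.execSet c a

/-- The ways in which an invocation proceeds: a `read`, a `check` of quantifiers, another command on
which the parties agree, or an abort. -/
theorem invoke_cases {st : State F} {p : PMsg F} {v : Cmd F} {o : Option (State F × Resp)}
    (h : st.invoke p v = o) :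
    (∃ t t' n, p.cmd = .array (.read t n) ∧ v = .array (.read t' n) ∧
      st.execArray t' (.read t n) p.priv = o) ∨
    (∃ n q q', p.cmd = .quant (.check n q) ∧ v = .quant (.check n q') ∧
      st.execQuant q' (.check n q) p.priv = o) ∨
    ((∀ t n, v ≠ .array (.read t n)) ∧ (∀ n q, v ≠ .quant (.check n q)) ∧
      p.cmd = v ∧ st.execCmd v p.priv = o) ∨ o = none := by
  unfold invoke at h
  split at h
  · rename_i t n t' n' hc
    split_ifs at h with hn
    · subst hn
      exact Or.inl ⟨t, t', n, hc, rfl, h⟩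
    · exact Or.inr (Or.inr (Or.inr h.symm))
  · rename_i n q n' q' hc
    split_ifs at h with hn
    · subst hn
      exact Or.inr (Or.inl ⟨n, q, q', hc, rfl, h⟩)
    · exact Or.inr (Or.inr (Or.inr h.symm))
  · rename_i h1 h2
    split_ifs at h with hc
    · refine Or.inr (Or.inr (Or.inl ⟨?_, ?_, hc, ?_⟩))
      · rintro t n rfl
        exact h1 _ _ _ _ hc rfl
      · rintro n q rfl
        exact h2 _ _ _ _ hc rfl
      · rw [← h, ← hc]
        rfl
    · exact Or.inr (Or.inr (Or.inr h.symm))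

/-- A successful command does not lose information, and the fact that it leaves holds in every later
state. -/
theorem invoke_plain {p : PMsg F} {v : Cmd F} {r : Resp} (hv : IsPlain v)
    (h₀ : st.invoke p v = some (st', r)) :
    st.Le st' ∧ st'.arr = st.arr ∧ st'.quants = st.quants ∧
      ∀ stf : State F, st'.Le stf → Fact stf p v := by
  rcases invoke_cases h₀ with ⟨t, t', n, hp, rfl, h⟩ | ⟨n, q, q', hp, rfl, h⟩ | ⟨h1, h2, hp, h⟩ | h
  · obtain ⟨c, a⟩ := p
    simp only at hp h
    subst hp
    unfold execArray at h
    split at h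
    · cases ‹ArrayCmd.read _ _ = ArrayCmd.setup _›
    · rename_i heq
      cases heq
      simp only [Option.bind_eq_bind, Option.bind_eq_some_iff] at h
      obtain ⟨M, hM, s, hs, h⟩ := h
      have hle := Le.of_put hs
      have hst := store_of_put hs
      have harr := hle.arr M hM
      obtain ⟨-, hs⟩ := put_eq_some hs
      split_ifs at h with hc
      · cases h
        refine ⟨hle, by rw [hs], by rw [hs], fun stf hf => ⟨_, _, _, rfl, hf.store _ _ hst,
          fun _ => ⟨hc.2.1 ▸ hc.2.2, M, hf.arr M harr, hc.1⟩⟩⟩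
      · cases h
        refine ⟨⟨hle.store, hle.vars, hle.arr, hle.quants, hle.quantFlag, fun _ _ _ => rfl⟩,
          by rw [hs], by rw [hs], fun stf hf => ⟨_, _, _, rfl, hf.store _ _ hst, fun hff => ?_⟩⟩
        rw [hf.arrFlag M harr rfl] at hff
        cases hff
    · cases ‹ArrayCmd.read _ _ = ArrayCmd.check›
    · cases h
  · unfold execQuant at h
    simp only [Option.bind_eq_bind, Option.bind_eq_some_iff] at h
    obtain ⟨a, ha, Ls, hLs, h⟩ := h
    rw [getSym_eq_some] at ha
    split_ifs at h with hc
    · cases h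
      refine ⟨Le.refl _, rfl, rfl, fun stf hf => ⟨a, Ls, hf.store _ _ ha, hf.quants _ hLs,
        fun _ => ?_⟩⟩
      obtain ⟨rfl, hc⟩ := hc
      cases q <;> exact hc
    · cases h
      refine ⟨⟨fun _ _ => id, fun _ => id, fun _ => id, fun _ => id, fun _ => rfl,
        fun _ _ => id⟩, rfl, rfl, fun stf hf => ⟨a, Ls, hf.store _ _ ha, hf.quants _ hLs,
        fun hff => ?_⟩⟩
      rw [hf.quantFlag rfl] at hff
      cases hff
  · obtain ⟨c, a⟩ := p
    simp only at hp h
    subst hp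
    have of_put : ∀ {n : Name} {u : Val F} {s : State F} {r : Resp},
        (st.put n u).map (fun s => (s, Resp.ok)) = some (s, r) →
        st.Le s ∧ s.arr = st.arr ∧ s.quants = st.quants ∧ s.store n = some u := by
      intro n u s r hs
      rw [Option.map_eq_some_iff] at hs
      obtain ⟨s', hs, h⟩ := hs
      cases h
      have h3 := Le.of_put hs
      have h4 := store_of_put hs
      obtain ⟨-, rfl⟩ := put_eq_some hs
      exact ⟨h3, rfl, rfl, h4⟩
    rcases c with c | c | c | c | c | c
    · simp only [execCmd] at h
      unfold execOrd at h
      split at h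
      · split_ifs at h with hn
        cases h
        refine ⟨⟨fun _ _ => id, fun _ hx => ?_, fun _ => id, fun _ => id, id, fun _ _ => id⟩,
          rfl, rfl, fun stf hf => hf.vars _ rfl⟩
        rw [hn] at hx
        cases hx
      · split_ifs at h with hn
        obtain ⟨h3, h4, h5, h6⟩ := of_put h
        exact ⟨h3, h4, h5, fun stf hf => ⟨rfl, _, rfl, hf.store _ _ h6⟩⟩
      · simp only [Option.bind_eq_bind, Option.bind_eq_some_iff] at h
        obtain ⟨s, hs, vs, hvs, h⟩ := h
        split_ifs at h with hn
        obtain ⟨h3, h4, h5, h6⟩ := of_put h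
        subst hn
        exact ⟨h3, h4, h5, fun stf hf => ⟨s, vs, hf.store _ _ (h3.store _ _ (getSym_eq_some.1 hs)),
          hf.vars _ (h3.vars _ hvs), hf.store _ _ h6⟩⟩
      · cases h
    · simp only [execCmd] at h
      unfold execClause at h
      split at h
      · split_ifs at h with hn
        obtain ⟨h3, h4, h5, h6⟩ := of_put h
        exact ⟨h3, h4, h5, fun stf hf => ⟨hn.1, hf.store _ _ h6⟩⟩
      · split_ifs at h with hn
        obtain ⟨h3, h4, h5, h6⟩ := of_put h
        exact ⟨h3, h4, h5, fun stf hf => ⟨rfl, _, rfl, hn.1, hf.store _ _ h6⟩⟩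
      · simp only [Option.bind_eq_bind, Option.bind_eq_some_iff] at h
        obtain ⟨C, hC, h⟩ := h
        split_ifs at h with hn
        rw [Option.map_eq_some_iff] at h
        obtain ⟨s, hs, h⟩ := h
        cases h
        obtain ⟨h3, h4⟩ := Le.of_putAll hs
        obtain ⟨h5, h6⟩ := putAll_fields hs
        rw [List.forall₂_map_right_iff] at h4
        subst hn
        exact ⟨h3, h5, h6, fun stf hf => ⟨_, hf.store _ _ (h3.store _ _ (getClause_eq_some.1 hC)),
          h4.imp fun _ _ hs => hf.store _ _ hs⟩⟩
      · simp only [Option.bind_eq_bind, Option.bind_eq_some_iff] at h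
        obtain ⟨C, hC, Cs, hCs, h⟩ := h
        split_ifs at h with hn
        cases h
        obtain ⟨-, rfl⟩ := hn
        exact ⟨Le.refl _, rfl, rfl, fun stf hf => ⟨Cs, (mapM_eq_some_iff.1 hCs).imp
          fun _ _ hs => hf.store _ _ (getClause_eq_some.1 hs),
          hf.store _ _ (getClause_eq_some.1 hC)⟩⟩
      · simp only [Option.bind_eq_bind, Option.bind_eq_some_iff] at h
        obtain ⟨A, hA, B, hB, s, hs, C, hC, h⟩ := h
        split_ifs at h with hn
        cases h
        obtain ⟨l, rfl, hn⟩ := hn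
        exact ⟨Le.refl _, rfl, rfl, fun stf hf => ⟨A, B, l, C,
          hf.store _ _ (getClause_eq_some.1 hA), hf.store _ _ (getClause_eq_some.1 hB),
          hf.store _ _ (getSym_eq_some.1 hs), hf.store _ _ (getClause_eq_some.1 hC), hn⟩⟩
      · simp only [Option.bind_eq_bind, Option.bind_eq_some_iff] at h
        obtain ⟨C, hC, h⟩ := h
        split_ifs at h with hn
        cases h
        subst hn
        exact ⟨Le.refl _, rfl, rfl, fun stf hf => hf.store _ _ (getClause_eq_some.1 hC)⟩
      · cases h
    · cases c with
      | setup => exact hv.elim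
      | read t n => exact (h1 t n rfl).elim
      | check => exact hv.elim
    · cases c with
      | setup => exact hv.elim
      | check n q => exact (h2 n q rfl).elim
      | final => exact hv.elim
    · cases c with
      | compare op i j =>
        simp only [execCmd, execZK, Option.bind_eq_bind, Option.bind_eq_some_iff] at h
        obtain ⟨x, hx, y, hy, h⟩ := h
        split_ifs at h with hn
        cases h
        exact ⟨Le.refl _, rfl, rfl, fun stf hf => ⟨x, y, hf.store _ _ (getNat_eq_some.1 hx),
          hf.store _ _ (getNat_eq_some.1 hy), hn⟩⟩
      | _ => exact hv.elim
    · exact hv.elim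
  · cases h

/-- The invocations with the listed messages of the prover and commands of the verifier succeed one
after the other, and no check returns `cheating`. -/
def Run : State F → List (PMsg F × Cmd F) → State F → Prop
  | st, [], st' => st = st'
  | st, m :: l, st' => ∃ s r, st.invoke m.1 m.2 = some (s, r) ∧ r ≠ .cheating ∧ Run s l st'

theorem run_append {l m : List (PMsg F × Cmd F)} :
    Run st (l ++ m) st' ↔ ∃ s, Run st l s ∧ Run s m st' := by
  induction l generalizing st with
  | nil => simp [Run]
  | cons a l ih =>
    simp only [List.cons_append, Run, ih]
    constructor
    · rintro ⟨s, r, h, hr, u, hu, hu'⟩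
      exact ⟨u, ⟨s, r, h, hr, hu⟩, hu'⟩
    · rintro ⟨u, ⟨s, r, h, hr, hu⟩, hu'⟩
      exact ⟨s, r, h, hr, u, hu, hu'⟩

theorem agree_of_invoke {p : PMsg F} {v : Cmd F} {o : State F × Resp}
    (h : st.invoke p v = some o) : p.cmd.Agree v := by
  rcases invoke_cases h with ⟨t, t', n, hp, hv, -⟩ | ⟨n, q, q', hp, hv, -⟩ | ⟨-, -, hp, -⟩ | h
  · exact Or.inr (Or.inl ⟨t, t', n, hp, hv⟩)
  · exact Or.inr (Or.inr ⟨n, q, q', hp, hv⟩)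
  · exact Or.inl hp
  · cases h

theorem Run.agree {l : List (PMsg F × Cmd F)} (h : Run st l st') : ∀ m ∈ l, m.1.cmd.Agree m.2 := by
  induction l generalizing st with
  | nil => simp
  | cons a l ih =>
    obtain ⟨s, r, h1, -, h2⟩ := h
    intro m hm
    rcases List.mem_cons.1 hm with rfl | hm
    · exact agree_of_invoke h1
    · exact ih h2 m hm

theorem Run.plain {l : List (PMsg F × Cmd F)} (h : Run st l st') (hl : ∀ m ∈ l, IsPlain m.2) :
    st.Le st' ∧ st'.arr = st.arr ∧ st'.quants = st.quants ∧
      ∀ stf : State F, st'.Le stf → ∀ m ∈ l, Fact stf m.1 m.2 := by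
  induction l generalizing st with
  | nil => cases h; exact ⟨Le.refl _, rfl, rfl, by simp⟩
  | cons a l ih =>
    obtain ⟨s, r, h1, -, h2⟩ := h
    obtain ⟨h3, h4, h5, h6⟩ := invoke_plain (hl a List.mem_cons_self) h1
    obtain ⟨k3, k4, k5, k6⟩ := ih h2 fun m hm => hl m (List.mem_cons_of_mem _ hm)
    refine ⟨h3.trans k3, k4.trans h4, k5.trans h5, fun stf hf m hm => ?_⟩
    rcases List.mem_cons.1 hm with rfl | hm
    · exact h6 stf (k3.trans hf)
    · exact k6 stf hf m hm

end State

end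

section

/-! ### The witness behind an accepting run -/

variable {φ : QBF}

theorem mem_litSet {l : Lit} {S : List Sym} : l ∈ litSet S ↔ Sym.lit l ∈ S := by
  simp only [litSet, List.mem_toFinset, List.mem_filterMap]
  constructor
  · rintro ⟨s, hs, h⟩
    cases s <;> cases h
    exact hs
  · exact fun h => ⟨_, h, rfl⟩

theorem card_litSet_le (S : List Sym) : (litSet S).card ≤ S.length :=
  (List.toFinset_card_le _).trans (List.length_filterMap_le _ _)

theorem QBF.mem_lits {q : Quant} {l : Lit} : l ∈ φ.lits q ↔ (q, l.var) ∈ φ.quants := by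
  simp only [lits, quants, List.mem_flatMap, List.mem_map, Prod.mk.injEq]
  refine exists_congr fun b => and_congr_right fun _ => ?_
  by_cases hq : b.1 = q
  · obtain ⟨x, s⟩ := l
    cases s <;> simp [hq]
  · simp [hq]

theorem lit_mem_exSyms {l : Lit} : Sym.lit l ∈ exSyms φ ↔ φ.IsEx l.var := by
  simp [exSyms, QBF.mem_lits, QBF.IsEx]

theorem lit_mem_allSyms {l : Lit} : Sym.lit l ∈ allSyms φ ↔ (Quant.all, l.var) ∈ φ.quants := by
  simp [allSyms, QBF.mem_lits]

theorem symOrder_lit (l : Lit) : symOrder φ.vars (.lit l) = φ.pos l.var + 2 := rfl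

/-- The checks on the extended witness of a step certify its universal reduction. -/
theorem forallRed_litSet (h : φ.Admissible) {a : Sym} {S T : List Sym} (ha : a ∈ exSyms φ)
    (hS : ∀ s ∈ S, symOrder φ.vars s < symOrder φ.vars a)
    (hT : ∀ s ∈ T, symOrder φ.vars s > symOrder φ.vars a) (hT' : ∀ s ∈ T, s ∈ allSyms φ) :
    φ.forallRed (litSet S ∪ (litSet [a] ∪ litSet T)) = litSet S ∪ litSet [a] := by
  ext l
  simp only [QBF.forallRed, Finset.mem_filter, Finset.mem_union, mem_litSet, List.mem_singleton]
  have hle : ∀ m : Lit, Sym.lit m ∈ S ∨ Sym.lit m = a ∨ Sym.lit m ∈ T → φ.IsEx m.var →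
      φ.pos m.var + 2 ≤ symOrder φ.vars a := by
    rintro m (hm | rfl | hm) he
    · exact (hS _ hm).le
    · exact le_rfl
    · exact (h.not_isEx (lit_mem_allSyms.1 (hT' _ hm)) he).elim
  constructor
  · rintro ⟨hl | hl | hl, hr⟩
    · exact Or.inl hl
    · exact Or.inr hl
    · have h1 := h.not_isEx (lit_mem_allSyms.1 (hT' _ hl))
      rcases hr with hr | ⟨m, hm, he, hlt⟩
      · exact (h1 hr).elim
      · have h2 := hle m hm he
        have h3 := hT _ hl
        rw [symOrder_lit] at h3
        omega
  · rintro (hl | rfl)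
    · refine ⟨Or.inl hl, Or.inr ?_⟩
      have h1 := hS _ hl
      rw [symOrder_lit] at h1
      cases a with
      | lit m => exact ⟨m, Or.inr (Or.inl rfl), lit_mem_exSyms.1 ha, by
          rw [symOrder_lit] at h1; omega⟩
      | noEx => simp [symOrder] at h1
      | padLo => simp [symOrder] at h1
      | padHi => simp [exSyms] at ha
    · exact ⟨Or.inr (Or.inl rfl), Or.inl (lit_mem_exSyms.1 ha)⟩

variable {F : Type} {x : Stmt} {st : State F}

/-- The commands whose private inputs make up the witness. -/
def Cmd.Carries : Cmd F → Prop
  | .ord (.input _) => True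
  | .clause (.input (.cl _) _) => True
  | .clause (.input (.bar _) _) => True
  | .array (.read _ _) => True
  | _ => False

theorem Cmd.Agree.not_carries {c v : Cmd F} (h : c.Agree v) (hv : ¬ v.Carries) : ¬ c.Carries := by
  rcases h with rfl | ⟨t, t', n, rfl, rfl⟩ | ⟨n, q, q', rfl, rfl⟩
  · exact hv
  · exact hv
  · exact id

theorem not_carries_drop {i : ℕ} {c : Cmd F} (h : c ∈ (verifierStep F x i).drop 4) :
    ¬ c.Carries := by
  simp only [verifierStep, List.cons_append, List.drop_succ_cons, List.drop_zero, List.nil_append,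
    List.mem_cons, List.mem_append, List.mem_flatMap, List.mem_map, List.mem_range,
    List.not_mem_nil, or_false] at h
  rcases h with rfl | rfl | rfl | rfl | rfl | rfl | rfl | rfl | rfl | h
  iterate 9 exact id
  rcases h with ((((⟨j, -, rfl | rfl⟩ | ⟨j, -, rfl | rfl⟩) | rfl) | ⟨j, -, rfl⟩) | rfl | rfl)
  all_goals exact id

/-- The messages of the prover in the `i`-th step contain the step `s`: the first four hold the
pivot, the resolvent and the indices of the premises. -/
def SegmentOf (x : Stmt) (i : ℕ) (s : Step) (l : List (PMsg F)) : Prop :=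
  ∃ t t' C C' rest, l =
    ⟨.ord (.input (.piv i)), .lit s.pivot⟩ :: ⟨.clause (.input (.bar i) x.w), .clause s.bar⟩ ::
    ⟨.array (.read t (.fetL i)), .read s.left C⟩ :: ⟨.array (.read t' (.fetR i)), .read s.right C'⟩ ::
    rest ∧ ∀ p ∈ rest, ¬ p.cmd.Carries

/-- The conditions of the witness relation on the `i`-th step, for the sequence `M` of clauses. -/
structure StepOf (x : Stmt) (M : List Clause) (i : ℕ) (s : Step) : Prop where
  left : s.left < x.L + i
  right : s.right < x.L + i
  resolvent : ∃ A B, M[s.left]? = some A ∧ M[s.right]? = some B ∧ x.qbf.IsEx s.pivot.var ∧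
    IsResolvent A B s.pivot s.bar
  red : s.red = x.qbf.forallRed s.bar
  width : s.bar.card ≤ x.w
  degree : (s.bar \ s.red).card ≤ x.d

theorem clause_unique {n : Name} {C D : Clause} (h : st.store n = some (.clause C))
    (h' : st.store n = some (.clause D)) : C = D := by
  rw [h] at h'; cases h'; rfl

theorem sym_unique {n : Name} {a b : Sym} (h : st.store n = some (.lit a))
    (h' : st.store n = some (.lit b)) : a = b := by
  rw [h] at h'; cases h'; rfl

theorem nat_unique {n : Name} {a b : ℕ} (h : st.store n = some (.nat a))
    (h' : st.store n = some (.nat b)) : a = b := by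
  rw [h] at h'; cases h'; rfl

theorem exists_slot {S : List Sym} {f : ℕ → Name} {m : ℕ}
    (h : List.Forall₂ (fun n a => st.store n = some (.lit a)) ((List.range m).map f) S) :
    S.length = m ∧ ∀ a ∈ S, ∃ j < m, st.store (f j) = some (.lit a) := by
  have hlen : S.length = m := by simpa using h.length_eq.symm
  refine ⟨hlen, fun a ha => ?_⟩
  obtain ⟨j, hj, rfl⟩ := List.getElem_of_mem ha
  refine ⟨j, hlen ▸ hj, ?_⟩
  simpa using (List.forall₂_iff_get.1 h).2 j (by simpa [hlen] using hj) hj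

/-- The facts that an accepting run leaves about the commands of one step yield the corresponding
step of a refutation, which is contained in the messages of the prover. -/
theorem step_of_facts (h : x.qbf.Admissible) {i : ℕ} {l : List (PMsg F × Cmd F)} {M : List Clause}
    (hl : l.map Prod.snd = verifierStep F x i) (hF : ∀ m ∈ l, st.Fact m.1 m.2)
    (hA : ∀ m ∈ l, m.1.cmd.Agree m.2) (hv : st.vars = some x.qbf.vars)
    (hq : st.quants = some (exSyms x.qbf, allSyms x.qbf)) (hM : st.arr = some M)
    (hqf : st.quantFlag = false) (haf : st.arrFlag = false) :
    ∃ s, SegmentOf x i s (l.map Prod.fst) ∧ st.store (.cl (x.L + i)) = some (.clause s.red) ∧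
      StepOf x M i s := by
  have fact : ∀ c ∈ verifierStep F x i, ∃ p, st.Fact p c := by
    intro c hc
    rw [← hl, List.mem_map] at hc
    obtain ⟨m, hm, rfl⟩ := hc
    exact ⟨m.1, hF m hm⟩
  have order : ∀ {s n : Name} {a : Sym} {k : ℕ}, Cmd.ord (.order s n) ∈ verifierStep F x i →
      st.store s = some (.lit a) → st.store n = some (.nat k) → k = symOrder x.qbf.vars a := by
    intro s n a k hc hs hn
    obtain ⟨-, b, vs, h1, h2, h3⟩ := fact _ hc
    rw [hv] at h2
    cases h2
    rw [nat_unique hn h3, sym_unique hs h1]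
  have quant : ∀ {n : Name} {a : Sym} {q : Quant}, Cmd.quant (.check n q) ∈ verifierStep F x i →
      st.store n = some (.lit a) → a ∈ State.quantSyms q (exSyms x.qbf, allSyms x.qbf) := by
    intro n a q hc hs
    obtain ⟨-, b, Ls, h1, h2, h3⟩ := fact _ hc
    rw [hq] at h2
    cases h2
    rw [sym_unique hs h1]
    exact h3 hqf
  -- The pivot, the resolvent and the premises are in the first four messages. The verifier's time
  -- stamp bounds the indices, whatever time stamp the prover sends.
  obtain ⟨m₀, l₀, rfl, h0, hl₀⟩ := List.map_eq_cons_iff.1 hl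
  obtain ⟨m₁, l₁, rfl, h1, hl₁⟩ := List.map_eq_cons_iff.1 hl₀
  obtain ⟨m₂, l₂, rfl, h2, hl₂⟩ := List.map_eq_cons_iff.1 hl₁
  obtain ⟨m₃, l₃, rfl, h3, hl₃⟩ := List.map_eq_cons_iff.1 hl₂
  obtain ⟨⟨c₀, a₀⟩, v₀⟩ := m₀
  obtain ⟨⟨c₁, a₁⟩, v₁⟩ := m₁
  obtain ⟨p₂, v₂⟩ := m₂
  obtain ⟨p₃, v₃⟩ := m₃
  simp only at h0 h1 h2 h3
  subst h0 h1 h2 h3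
  obtain ⟨hc₀, p, ha₀, hpiv⟩ := hF _ List.mem_cons_self
  obtain ⟨hc₁, B, ha₁, hBw, hbar⟩ := hF _ (List.mem_cons_of_mem _ List.mem_cons_self)
  obtain ⟨t, iL, A, hp₂, hfL, hL⟩ :=
    hF _ (List.mem_cons_of_mem _ (List.mem_cons_of_mem _ List.mem_cons_self))
  obtain ⟨t', iR, A', hp₃, hfR, hR⟩ := hF _ (List.mem_cons_of_mem _ (List.mem_cons_of_mem _
    (List.mem_cons_of_mem _ List.mem_cons_self)))
  simp only at hc₀ hc₁ ha₀ ha₁ hp₂ hp₃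
  subst hc₀ hc₁ ha₀ ha₁ hp₂ hp₃
  obtain ⟨hLt, M', hM', hL⟩ := hL haf
  rw [hM] at hM'
  cases hM'
  obtain ⟨hRt, M', hM', hR⟩ := hR haf
  rw [hM] at hM'
  cases hM'
  obtain ⟨-, C₁, C₂, q, B', hC₁, hC₂, hq', hB', hres⟩ := fact (.clause (.res (.fetL i) (.fetR i)
    (.piv i) (.bar i))) (by simp [verifierStep])
  obtain rfl := clause_unique hfL hC₁
  obtain rfl := clause_unique hfR hC₂
  obtain rfl := clause_unique hbar hB'
  cases sym_unique hpiv hq'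
  have hex := quant (n := .piv i) (q := .ex) (by simp [verifierStep]) hpiv
  -- The symbols that are opened from `W_res`, `W_rem` and `{w_ℓ}` satisfy the hypotheses of
  -- `forallRed_litSet`.
  obtain ⟨-, S, hS, hS'⟩ := fact (.clause (.retrieval (.wRes i)
    ((List.range x.w).map (Name.resLit i)))) (by simp [verifierStep])
  obtain ⟨-, T, hT, hT'⟩ := fact (.clause (.retrieval (.wRem i)
    ((List.range x.d).map (Name.remLit i)))) (by simp [verifierStep])
  obtain ⟨-, W, hW, hW'⟩ := fact (.clause (.retrieval (.wCl i) [.wLit i])) (by simp [verifierStep])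
  obtain ⟨a, ha, rfl⟩ : ∃ a, st.store (.wLit i) = some (.lit a) ∧ W = [a] := by
    rcases hW' with _ | ⟨ha, _ | _⟩
    exact ⟨_, ha, rfl⟩
  obtain ⟨-, hSj⟩ := exists_slot hS'
  obtain ⟨hTlen, hTj⟩ := exists_slot hT'
  have haex := quant (n := .wLit i) (q := .ex) (by simp [verifierStep]) ha
  have hTall : ∀ b ∈ T, b ∈ allSyms x.qbf := by
    intro b hb
    obtain ⟨j, hj, hb⟩ := hTj b hb
    exact quant (q := .all) (by simp [verifierStep, hj]) hb
  have hSlt : ∀ b ∈ S, symOrder x.qbf.vars b < symOrder x.qbf.vars a := by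
    intro b hb
    obtain ⟨j, hj, hb⟩ := hSj b hb
    obtain ⟨-, k, k', hk, hk', hlt⟩ := fact (.zk (.compare .lt (.resOrd i j) (.wOrd i)))
      (by simp [verifierStep, hj])
    rw [order (by simp [verifierStep, hj]) hb hk, order (by simp [verifierStep]) ha hk'] at hlt
    exact hlt
  have hTgt : ∀ b ∈ T, symOrder x.qbf.vars b > symOrder x.qbf.vars a := by
    intro b hb
    obtain ⟨j, hj, hb⟩ := hTj b hb
    obtain ⟨-, k, k', hk, hk', hlt⟩ := fact (.zk (.compare .gt (.remOrd i j) (.wOrd i)))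
      (by simp [verifierStep, hj])
    rw [order (by simp [verifierStep, hj]) hb hk, order (by simp [verifierStep]) ha hk'] at hlt
    exact hlt
  -- By the two decompositions, the resolvent and the reduced clause are made of these symbols.
  obtain ⟨-, Cs, hCs, hcl⟩ := fact (.clause (.equal (.cl (x.L + i)) [.wRes i, .wCl i]))
    (by simp [verifierStep])
  obtain ⟨-, Ds, hDs, hbar'⟩ := fact (.clause (.equal (.bar i) [.wRes i, .wCl i, .wRem i]))
    (by simp [verifierStep])
  rcases hCs with _ | ⟨e₁, _ | ⟨e₂, _ | _⟩⟩
  rcases hDs with _ | ⟨f₁, _ | ⟨f₂, _ | ⟨f₃, _ | _⟩⟩⟩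
  obtain rfl := clause_unique hS e₁
  obtain rfl := clause_unique hS f₁
  obtain rfl := clause_unique hW e₂
  obtain rfl := clause_unique hW f₂
  obtain rfl := clause_unique hT f₃
  simp only [List.foldr_cons, List.foldr_nil, Finset.union_empty] at hcl hbar'
  obtain rfl := clause_unique hbar' hbar
  have hred := forallRed_litSet h haex hSlt hTgt hTall
  refine ⟨⟨iL, iR, p, _, litSet S ∪ litSet [a]⟩, ⟨t, t', A, A', l₃.map Prod.fst, rfl, ?_⟩, hcl,
    hLt, hRt, ⟨A, A', hL, hR, lit_mem_exSyms.1 hex, hres⟩, hred.symm, hBw, ?_⟩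
  · intro p hp
    obtain ⟨m, hm, rfl⟩ := List.mem_map.1 hp
    refine (hA m (by simp [hm])).not_carries (not_carries_drop (x := x) (i := i) ?_)
    rw [show (verifierStep F x i).drop 4 = l₃.map Prod.snd from hl₃.symm]
    exact List.mem_map_of_mem hm
  · refine (Finset.card_le_card (t := litSet T) ?_).trans ((card_litSet_le T).trans hTlen.le)
    rw [← Finset.union_assoc]
    exact fun l hl => ((Finset.mem_union.1 (Finset.mem_sdiff.1 hl).1).resolve_left
      (Finset.mem_sdiff.1 hl).2)

/-- A list of pairs whose second components are concatenated from `g 0, …, g (n - 1)` splits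
accordingly. -/
theorem exists_segments {α β : Type} {l : List (α × β)} {n : ℕ} {g : ℕ → List β}
    (h : l.map Prod.snd = (List.range n).flatMap g) :
    ∃ seg : ℕ → List (α × β), l = (List.range n).flatMap seg ∧
      ∀ i < n, (seg i).map Prod.snd = g i := by
  induction n generalizing l with
  | zero => exact ⟨fun _ => [], by simpa using h, by simp⟩
  | succ n ih =>
    rw [List.range_succ, List.flatMap_append] at h
    obtain ⟨l₁, l₂, rfl, h1, h2⟩ := List.map_eq_append_iff.1 h
    obtain ⟨seg, rfl, hseg⟩ := ih h1
    have hne : ∀ i < n, Function.update seg n l₂ i = seg i := fun i hi =>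
      Function.update_of_ne hi.ne _ _
    refine ⟨Function.update seg n l₂, ?_, fun i hi => ?_⟩
    · rw [List.range_succ, List.flatMap_append, List.flatMap_singleton, Function.update_self]
      congr 1
      rw [List.flatMap_def, List.flatMap_def, List.map_congr_left]
      intro i hi
      exact (hne i (List.mem_range.1 hi)).symm
    · rcases Nat.lt_succ_iff_lt_or_eq.1 hi with hi | rfl
      · rw [hne i hi, hseg i hi]
      · simpa using h2

/-- The messages of an accepting run contain the witness `f 0, …, f (R - 1)`: the reduced clauses
are committed between the common clauses and the setup of the array, the other parts of a step
in its segment. -/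
structure MessagesOf (x : Stmt) (f : ℕ → Step) (l : List (PMsg F)) : Prop where
  split : ∃ l₁ l₂ l₃ seg, l = l₁ ++ (List.range x.R).map (fun i =>
      ⟨.clause (.input (.cl (x.L + i)) x.w), .clause (f i).red⟩) ++ l₂ ++
        (List.range x.R).flatMap seg ++ l₃ ∧
    (∀ i < x.R, SegmentOf x i (f i) (seg i)) ∧ ∀ p ∈ l₁ ++ l₂ ++ l₃, ¬ p.cmd.Carries

variable [Field F] {st' : State F} {p : PMsg F} {r : Resp}

theorem invoke_quant_setup {e a : List Sym} (hn : st.quants = none)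
    (h₀ : st.invoke p (.quant (.setup e a)) = some (st', r)) :
    st' = { st with quants := some (e, a) } := by
  rcases State.invoke_cases h₀ with ⟨t, t', n, -, hv, -⟩ | ⟨n, q, q', -, hv, -⟩ | ⟨-, -, -, h⟩ | h
  · cases hv
  · cases hv
  · simp only [State.execCmd, State.execQuant, if_pos hn] at h
    cases h
    rfl
  · cases h

theorem invoke_quant_final (h₀ : st.invoke p (.quant .final) = some (st', r)) (hr : r ≠ .cheating) :
    st' = st ∧ st.quantFlag = false := by
  rcases State.invoke_cases h₀ with ⟨t, t', n, -, hv, -⟩ | ⟨n, q, q', -, hv, -⟩ | ⟨-, -, -, h⟩ | h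
  · cases hv
  · cases hv
  · simp only [State.execCmd, State.execQuant, Option.map_eq_some_iff] at h
    obtain ⟨r', h, h'⟩ := h
    cases h'
    exact ⟨rfl, State.answer_le h hr⟩
  · cases h

theorem invoke_array_check (h₀ : st.invoke p (.array .check) = some (st', r)) (hr : r ≠ .cheating) :
    st' = st ∧ st.arrFlag = false := by
  rcases State.invoke_cases h₀ with ⟨t, t', n, -, hv, -⟩ | ⟨n, q, q', -, hv, -⟩ | ⟨-, -, -, h⟩ | h
  · cases hv
  · cases hv
  · simp only [State.execCmd, State.execArray, Option.map_eq_some_iff] at h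
    obtain ⟨r', h, h'⟩ := h
    cases h'
    exact ⟨rfl, State.answer_le h hr⟩
  · cases h

theorem invoke_array_setup {cs : List Name} (hn : st.arr = none)
    (h₀ : st.invoke p (.array (.setup cs)) = some (st', r)) :
    ∃ Cs, List.Forall₂ (fun n C => st.store n = some (.clause C)) cs Cs ∧
      st' = { st with arr := some Cs, arrFlag := false } := by
  rcases State.invoke_cases h₀ with ⟨t, t', n, -, hv, -⟩ | ⟨n, q, q', -, hv, -⟩ | ⟨-, -, -, h⟩ | h
  · cases hv
  · cases hv
  · simp only [State.execCmd, State.execArray, Option.bind_eq_bind, Option.bind_eq_some_iff,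
      if_pos hn] at h
    obtain ⟨Cs, hCs, h⟩ := h
    cases h
    exact ⟨Cs, (mapM_eq_some_iff.1 hCs).imp fun _ _ => State.getClause_eq_some.1, rfl⟩
  · cases h

theorem invoke_ord_setup {vs : List ℕ} (h₀ : st.invoke p (.ord (.setup vs)) = some (st', r)) :
    st'.store = st.store := by
  rcases State.invoke_cases h₀ with ⟨t, t', n, -, hv, -⟩ | ⟨n, q, q', -, hv, -⟩ | ⟨-, -, -, h⟩ | h
  · cases hv
  · cases hv
  · simp only [State.execCmd, State.execOrd] at h
    split_ifs at h
    cases h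
    rfl
  · cases h

theorem invoke_isFalse {n : Name} (h₀ : st.invoke p (.clause (.isFalse n)) = some (st', r)) :
    st.store n ≠ none := by
  rcases State.invoke_cases h₀ with ⟨t, t', n, -, hv, -⟩ | ⟨n, q, q', -, hv, -⟩ | ⟨-, -, -, h⟩ | h
  · cases hv
  · cases hv
  · simp only [State.execCmd, State.execClause, Option.bind_eq_bind, Option.bind_eq_some_iff] at h
    obtain ⟨C, hC, -⟩ := h
    rw [State.getClause_eq_some.1 hC]
    exact Option.some_ne_none _
  · cases h

/-- The messages of the prover in a run with the honest verifier, in which no functionality aborts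
and no check reports cheating, contain a witness. -/
theorem witness_of_run (h : x.qbf.Admissible) {l : List (PMsg F × Cmd F)}
    (hl : l.map Prod.snd = verifierScript F x) (hr : State.Run .start l st') :
    ∃ f : ℕ → Step, Rel x ((List.range x.R).map f) ∧ MessagesOf x f (l.map Prod.fst) := by
  have hagree := hr.agree
  unfold verifierScript at hl
  obtain ⟨l, lz, rfl, hl, hlz⟩ := List.map_eq_append_iff.1 hl
  obtain ⟨l, ls, rfl, hl, hls⟩ := List.map_eq_append_iff.1 hl
  obtain ⟨l, le, rfl, hl, hle⟩ := List.map_eq_append_iff.1 hl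
  obtain ⟨l, ld, rfl, hl, hld⟩ := List.map_eq_append_iff.1 hl
  obtain ⟨lab, lc, rfl, hlab, hlc⟩ := List.map_eq_append_iff.1 hl
  obtain ⟨s₅, hr, hrz⟩ := State.run_append.1 hr
  obtain ⟨s₄, hr, hrs⟩ := State.run_append.1 hr
  obtain ⟨s₃, hr, hre⟩ := State.run_append.1 hr
  obtain ⟨s₂, hr, hrd⟩ := State.run_append.1 hr
  obtain ⟨s₁, hrab, hrc⟩ := State.run_append.1 hr
  obtain ⟨mc, _, rfl, hmc, hlc⟩ := List.map_eq_cons_iff.1 hlc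
  obtain rfl := List.map_eq_nil_iff.1 hlc
  obtain ⟨me, _, rfl, hme, hle⟩ := List.map_eq_cons_iff.1 hle
  obtain rfl := List.map_eq_nil_iff.1 hle
  obtain ⟨mz₀, lz, rfl, hmz₀, hlz⟩ := List.map_eq_cons_iff.1 hlz
  obtain ⟨mz₁, lz, rfl, hmz₁, hlz⟩ := List.map_eq_cons_iff.1 hlz
  obtain ⟨mz₂, _, rfl, hmz₂, hlz⟩ := List.map_eq_cons_iff.1 hlz
  obtain rfl := List.map_eq_nil_iff.1 hlz
  have plain : ∀ {l : List (PMsg F × Cmd F)} {k : List (Cmd F)}, l.map Prod.snd = k →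
      (∀ c ∈ k, State.IsPlain c) → ∀ m ∈ l, State.IsPlain m.2 := by
    rintro l k rfl hk m hm
    exact hk _ (List.mem_map_of_mem hm)
  have fact : ∀ {s : State F} {l : List (PMsg F × Cmd F)} {k : List (Cmd F)}, l.map Prod.snd = k →
      (∀ m ∈ l, s.Fact m.1 m.2) → ∀ c ∈ k, ∃ p, s.Fact p c := by
    rintro s l k rfl hk c hc
    obtain ⟨m, hm, rfl⟩ := List.mem_map.1 hc
    exact ⟨m.1, hk m hm⟩
  -- The array and the quantifiers are still unset when their `setup` comes, so that both take
  -- effect; this relates the states at the boundaries of the phases.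
  obtain ⟨-, ha₁, hq₁, hf₁⟩ := hrab.plain (plain hlab (by
    simp only [List.mem_append, List.mem_singleton, List.mem_map]
    rintro c (rfl | ⟨m, -, rfl⟩) <;> trivial))
  obtain ⟨_, _, hrc, -, rfl⟩ := hrc
  rw [hmc] at hrc
  obtain rfl := invoke_quant_setup hq₁ hrc
  obtain ⟨hle₂, ha₃, hq₃, hf₃⟩ := hrd.plain (plain hld (by
    simp only [List.mem_map]
    rintro c ⟨m, -, rfl⟩
    trivial))
  obtain ⟨_, _, hre, -, rfl⟩ := hre
  rw [hme] at hre
  obtain ⟨M, hM, rfl⟩ := invoke_array_setup (ha₃.trans ha₁) hre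
  have hplain_step : ∀ i, ∀ c ∈ verifierStep F x i, State.IsPlain c := by
    intro i c hc
    simp only [verifierStep, List.mem_append, List.mem_cons, List.mem_flatMap, List.mem_map,
      List.not_mem_nil, or_false] at hc
    rcases hc with (((((rfl | rfl | rfl | rfl | rfl | rfl | rfl | rfl | rfl | rfl | rfl | rfl | rfl)
      | ⟨j, -, rfl | rfl⟩) | ⟨j, -, rfl | rfl⟩) | rfl) | ⟨j, -, rfl⟩) | rfl | rfl <;> trivial
  obtain ⟨hle₅, ha₅, hq₅, hf₅⟩ := hrs.plain (plain hls (by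
    simp only [List.mem_flatMap]
    rintro c ⟨i, -, hc⟩
    exact hplain_step i c hc))
  obtain ⟨s₆, _, hrz₀, -, s₇, _, hrz₁, hz₁, s₈, _, hrz₂, hz₂, -⟩ := hrz
  rw [hmz₀] at hrz₀
  rw [hmz₁] at hrz₁
  rw [hmz₂] at hrz₂
  obtain ⟨hle₆, ha₆, hq₆, hf₆⟩ := State.invoke_plain
    (show State.IsPlain (.clause (.isFalse _)) from trivial) hrz₀
  obtain ⟨rfl, haf⟩ := invoke_array_check hrz₁ hz₁
  obtain ⟨rfl, hqf⟩ := invoke_quant_final hrz₂ hz₂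
  have hle₃ : State.Le s₃ { s₃ with arr := some M, arrFlag := false } :=
    ⟨fun _ _ => id, fun _ => id, fun a h => (by rw [ha₃.trans ha₁] at h; cases h),
      fun _ => id, id, fun a h => (by rw [ha₃.trans ha₁] at h; cases h)⟩
  have hle₁ : State.Le s₁ { s₁ with quants := some (exSyms x.qbf, allSyms x.qbf) } :=
    ⟨fun _ _ => id, fun _ => id, fun _ => id, fun a h => (by rw [hq₁] at h; cases h), id,
      fun _ _ => id⟩
  have hle₃₈ := hle₃.trans (hle₅.trans hle₆)
  have fab := fact hlab (hf₁ _ (hle₁.trans (hle₂.trans hle₃₈)))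
  have fd := fact hld (hf₃ _ hle₃₈)
  have fs := hf₅ _ hle₆
  have hempty := hf₆ _ (State.Le.refl _)
  have hM₈ : s₈.arr = some M := ha₆.trans ha₅
  have hQ₈ : s₈.quants = some (exSyms x.qbf, allSyms x.qbf) := by
    rw [hq₆, hq₅]; exact hq₃
  obtain ⟨_, hvars⟩ := fab (.ord (.setup x.qbf.vars)) (by simp)
  obtain ⟨seg, rfl, hseg⟩ := exists_segments hls
  have hsteps : ∀ i, ∃ s, i < x.R → SegmentOf x i s ((seg i).map Prod.fst) ∧
      s₈.store (.cl (x.L + i)) = some (.clause s.red) ∧ StepOf x M i s := by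
    intro i
    by_cases hi : i < x.R
    · have hsub : ∀ m ∈ seg i, m ∈ (List.range x.R).flatMap seg := fun m hm =>
        List.mem_flatMap.2 ⟨i, List.mem_range.2 hi, hm⟩
      obtain ⟨s, hs⟩ := step_of_facts h (hseg i hi) (fun m hm => fs m (hsub m hm))
        (fun m hm => hagree m (by simp [hsub m hm])) hvars hQ₈ hM₈ hqf haf
      exact ⟨s, fun _ => hs⟩
    · exact ⟨default, fun hi' => (hi hi').elim⟩
  choose f hf using hsteps
  -- Hence the clauses stored under `cl j`, and so those in the array, are those of the derivation.
  have hcommon : ∀ {j : ℕ} {C : Clause}, x.qbf.matrix[j]? = some C →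
      C.card ≤ x.w ∧ s₈.store (.cl j) = some (.clause C) := by
    intro j C hj
    obtain ⟨_, hc⟩ := fab (.clause (.common (.cl j) C x.w)) (List.mem_append_right _
      (List.mem_map.2 ⟨(C, j), List.mem_zipIdx_iff_getElem?.2 hj, rfl⟩))
    exact hc
  have hseq : ∀ {j : ℕ} {C : Clause}, (clauseSeq x.qbf ((List.range x.R).map f))[j]? = some C →
      s₈.store (.cl j) = some (.clause C) := by
    intro j C hj
    rw [clauseSeq, List.getElem?_append] at hj
    split_ifs at hj with hjL
    · exact (hcommon hj).2
    · simp only [List.getElem?_map, List.map_map, Option.map_eq_some_iff,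
        List.getElem?_eq_some_iff, List.length_range, List.getElem_range] at hj
      obtain ⟨i, ⟨hi, rfl⟩, rfl⟩ := hj
      have := (hf _ hi).2.1
      rwa [Stmt.L, Nat.add_sub_cancel' (by omega)] at this
  have hlen : (clauseSeq x.qbf ((List.range x.R).map f)).length = x.L + x.R := by
    simp [clauseSeq, Stmt.L]
  have hMlen : M.length = x.L + x.R := by simpa using hM.length_eq.symm
  have hMseq : M = clauseSeq x.qbf ((List.range x.R).map f) := by
    refine List.ext_getElem (hMlen.trans hlen.symm) fun j hj hj' => ?_
    have h1 := (List.forall₂_iff_get.1 hM).2 j (by simpa [hMlen] using hj) hj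
    simp only [List.get_eq_getElem, List.getElem_map, List.getElem_range] at h1
    exact clause_unique (hle₃₈.store _ _ h1) (hseq (List.getElem?_eq_getElem hj'))
  -- Without any clause, `isFalse` would refer to the name `cl 0` (as `0 - 1 = 0`), which is unused.
  have hpos : x.L + x.R ≠ 0 := by
    intro h0
    have hL : x.qbf.matrix = [] := List.length_eq_zero_iff.1 (by rw [Stmt.L] at h0; omega)
    have hR : x.R = 0 := by omega
    rw [hL] at hlab
    rw [hR, List.range_zero, List.map_nil, List.map_eq_nil_iff] at hld
    subst hld
    rw [hR] at hrs
    obtain rfl := hrd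
    obtain rfl := hrs
    obtain ⟨m, _, rfl, hm, hlab⟩ := List.map_eq_cons_iff.1 hlab
    obtain rfl := List.map_eq_nil_iff.1 hlab
    obtain ⟨_, _, hrm, -, rfl⟩ := hrab
    rw [hm] at hrm
    have h1 := invoke_isFalse hrz₀
    simp only [invoke_ord_setup hrm] at h1
    exact h1 rfl
  refine ⟨f, ⟨⟨fun i s hs => ?_, ?_⟩, by simp, fun C hC => ?_, fun s hs => ?_, fun s hs => ?_⟩, ?_⟩
  · obtain ⟨hi, rfl⟩ : i < x.R ∧ f i = s := by
      simpa [List.getElem?_eq_some_iff] using hs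
    obtain ⟨-, -, hs⟩ := hf i hi
    obtain ⟨A, B, hA, hB, hex, hres⟩ := hs.resolvent
    rw [hMseq] at hA hB
    exact ⟨hs.left, hs.right, A, B, hA, hB, hex, hres, hs.red⟩
  · rw [List.getLast?_eq_getElem?, hlen]
    obtain ⟨C, hC⟩ : ∃ C, (clauseSeq x.qbf ((List.range x.R).map f))[x.L + x.R - 1]? = some C :=
      ⟨_, List.getElem?_eq_getElem (by omega)⟩
    rw [hC, clause_unique (hseq hC) hempty]
  · obtain ⟨j, hj⟩ := List.mem_iff_getElem?.1 hC
    exact (hcommon hj).1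
  · obtain ⟨i, hi, rfl⟩ := List.mem_map.1 hs
    obtain ⟨-, -, hs⟩ := hf i (List.mem_range.1 hi)
    exact ⟨hs.width, (Finset.card_le_card (hs.red ▸ QBF.forallRed_subset _)).trans hs.width⟩
  · obtain ⟨i, hi, rfl⟩ := List.mem_map.1 hs
    exact (hf i (List.mem_range.1 hi)).2.2.degree
  · have hld' : ld.map Prod.snd = (List.range x.R).flatMap fun i =>
        [Cmd.clause (.input (.cl (x.L + i)) x.w)] := by
      rw [hld, List.map_eq_flatMap]
    obtain ⟨segd, rfl, hsegd⟩ := exists_segments hld'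
    refine ⟨(lab ++ [mc]).map Prod.fst, [me].map Prod.fst, [mz₀, mz₁, mz₂].map Prod.fst,
      fun i => (seg i).map Prod.fst, ?_, fun i hi => (hf i hi).1, ?_⟩
    · have h1 : ∀ i ∈ List.range x.R, (segd i).map Prod.fst =
          [⟨.clause (.input (.cl (x.L + i)) x.w), .clause (f i).red⟩] := by
        intro i hi
        obtain ⟨m, _, hm, hm', hnil⟩ := List.map_eq_cons_iff.1 (hsegd i (List.mem_range.1 hi))
        obtain rfl := List.map_eq_nil_iff.1 hnil
        have h2 := hf₃ _ hle₃₈ m (List.mem_flatMap.2 ⟨i, hi, by simp [hm]⟩)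
        rw [hm'] at h2
        obtain ⟨h3, C, h4, -, h5⟩ := h2
        obtain rfl := clause_unique h5 (hf i (List.mem_range.1 hi)).2.1
        rw [hm, List.map_singleton, ← h3, ← h4]
      simp only [List.map_append, List.map_flatMap]
      rw [List.flatMap_def (f := fun i => (segd i).map Prod.fst), List.map_congr_left h1,
        ← List.flatMap_def, ← List.map_eq_flatMap]
    · have hsub : ∀ m ∈ lab ++ [mc] ++ [me] ++ [mz₀, mz₁, mz₂], ¬ m.1.cmd.Carries := by
        intro m hm
        have hm' : m ∈ lab ++ [mc] ++ (List.range x.R).flatMap segd ++ [me] ++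
            (List.range x.R).flatMap seg ++ [mz₀, mz₁, mz₂] := by
          simp only [List.mem_append] at hm ⊢
          tauto
        refine (hagree m hm').not_carries ?_
        have h1 : m.2 ∈ (lab ++ [mc] ++ [me] ++ [mz₀, mz₁, mz₂]).map Prod.snd :=
          List.mem_map_of_mem hm
        simp only [List.map_append, hlab, List.map_cons, List.map_nil, hmc, hme, hmz₀, hmz₁, hmz₂,
          List.mem_append, List.mem_cons, List.mem_map, List.not_mem_nil, or_false] at h1
        rcases h1 with (((h1 | ⟨c, -, h1⟩) | h1) | h1) | h1 | h1 | h1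
        · rw [h1]; exact id
        · rw [← h1]; exact id
        all_goals rw [h1]; exact id
      intro p hp
      rw [← List.map_append, ← List.map_append] at hp
      obtain ⟨m, hm, rfl⟩ := List.mem_map.1 hp
      exact hsub m hm

end

section

/-! ### The extractor -/

open Data

/-- One pass of the extractor over an encoded message `m`. The state holds the parts of the current
step that have been seen, the queue of the reduced clauses that are not yet used, and the finished
steps. The reduced clauses are committed before all steps; a step is finished by the message that
fetches its second premise. -/
def extractStep (m s : Data) : Data :=
  if m.hd.hd = ofNat 1 then cons (cons m.tl.tl.hd nil) s.tl
  else if m.hd.hd = ofNat 4 then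
    if m.hd.tl.hd.hd = ofNat 0 then cons s.hd (cons (app s.tl.hd (cons m.tl.tl.hd nil)) s.tl.tl)
    else if m.hd.tl.hd.hd = ofNat 2 then cons (cons m.tl.tl.hd s.hd) s.tl
    else s
  else if m.hd.hd = ofNat 10 then
    if m.hd.tl.tl.hd.hd = ofNat 3 then cons (cons m.tl.tl.hd s.hd) s.tl
    else cons nil (cons s.tl.hd.tl (app s.tl.tl (cons (cons s.hd.hd (cons m.tl.tl.hd
      (cons s.hd.tl.tl.hd (cons s.hd.tl.hd (cons s.tl.hd.hd nil))))) nil)))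
  else s

/-- The list of steps that is read off from the encoded messages `l`. -/
def extractData (l : Data) : Data := (fold extractStep l (cons nil (cons nil nil))).tl.tl

theorem size_hd_add_tl (x : Data) : x.hd.size + x.tl.size ≤ x.size + 1 := by
  cases x <;> simp [hd, tl, size]; omega

theorem size_extractStep (m s : Data) : (extractStep m s).size ≤ s.size + (m.size + 20) := by
  have hm : m.tl.tl.hd.size ≤ m.size :=
    (size_hd_le _).trans ((size_tl_le _).trans (size_tl_le _))
  have h1 := size_hd_add_tl s
  have h2 := size_hd_add_tl s.tl
  have h3 := size_hd_add_tl s.hd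
  have h4 := size_hd_add_tl s.hd.tl
  have h5 := size_hd_le s.hd.tl.tl
  have h6 := size_hd_add_tl s.tl.hd
  have h7 := size_app_le s.tl.hd (cons m.tl.tl.hd nil)
  have h8 := size_app_le s.tl.tl (cons (cons s.hd.hd (cons m.tl.tl.hd
      (cons s.hd.tl.tl.hd (cons s.hd.tl.hd (cons s.tl.hd.hd nil))))) nil)
  unfold extractStep
  simp only [size] at h7 h8
  split_ifs <;> first | omega | (simp only [size]; omega)

theorem PolyF.extractData {f : Data → Data} (hf : PolyF f) : PolyF fun x => extractData (f x) := by
  refine PolyF.comp (g := QRes.extractData) ?_ hf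
  refine PolyF.tl (PolyF.tl (PolyF.fold (b := fun m s _ => extractStep m s) ?_ .id (.const _)
    (.X + 20) fun m s x => ?_))
  · unfold extractStep
    repeat' first
      | with_reducible exact PolyF.const _
      | with_reducible exact PolyF.id
      | with_reducible apply PolyF.hd
      | with_reducible apply PolyF.tl
      | with_reducible apply PolyF.app
      | with_reducible apply PolyF.cons
      | with_reducible apply PolyF.ite_eq
  · have := size_extractStep m s
    simp only [Polynomial.eval_add, Polynomial.eval_X, Polynomial.eval_ofNat]
    omega

variable {F : Type} {x : Stmt}

/-- Messages that carry no part of the witness do not change the state of the extractor. -/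
theorem extractStep_of_not_carries {p : PMsg F} (h : ¬ p.cmd.Carries) (s : Data) :
    extractStep p.enc s = s := by
  have hne : ∀ {a b : ℕ}, a ≠ b → ofNat a ≠ ofNat b := fun h h' => h (ofNat_injective h')
  have h1 : p.enc.hd = p.cmd.enc := rfl
  obtain ⟨c, a⟩ := p
  simp only at h h1
  simp only [extractStep, h1]
  rcases c with c | c | c | c | c | c <;> cases c
  case clause.input n w =>
    cases n <;> first
      | exact (h trivial).elim
      | simp [Cmd.enc, Name.enc, tag, ofNat_injective.eq_iff]
  all_goals first
    | exact (h trivial).elim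
    | simp [Cmd.enc, tag, ofNat_injective.eq_iff]

theorem foldl_extractStep_of_not_carries {l : List (PMsg F)} (h : ∀ p ∈ l, ¬ p.cmd.Carries)
    (s : Data) : (l.map PMsg.enc).foldl (fun s m => extractStep m s) s = s := by
  induction l with
  | nil => rfl
  | cons p l ih =>
    rw [List.map_cons, List.foldl_cons, extractStep_of_not_carries (h p List.mem_cons_self)]
    exact ih fun q hq => h q (List.mem_cons_of_mem _ hq)

/-- The messages of one step make the extractor append this step, with the first clause of its queue
as the reduced clause. -/
theorem foldl_extractStep_segment {i : ℕ} {s : Step} {l : List (PMsg F)} (h : SegmentOf x i s l)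
    (c : Data) (r acc : List Data) :
    (l.map PMsg.enc).foldl (fun s m => extractStep m s)
        (cons c (cons (ofList (encClause s.red :: r)) (ofList acc))) =
      cons nil (cons (ofList r) (ofList (acc ++ [s.enc]))) := by
  obtain ⟨t, t', C, C', rest, rfl, hrest⟩ := h
  have hone : ∀ d : Data, cons d nil = ofList [d] := fun _ => rfl
  simp only [List.map_cons, List.foldl_cons]
  have e : (List.map PMsg.enc rest).foldl (fun s m => extractStep m s)
      (cons nil (cons (ofList r) (ofList (acc ++ [s.enc])))) =
      cons nil (cons (ofList r) (ofList (acc ++ [s.enc]))) :=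
    foldl_extractStep_of_not_carries hrest _
  rw [← e]
  congr 1
  simp only [extractStep, PMsg.enc, Cmd.enc, Priv.enc, Name.enc, tag, hd_cons, tl_cons, ofList_cons,
    ofNat_injective.eq_iff]
  simp only [reduceIte, Nat.reduceEqDiff, hd_cons, tl_cons]
  rw [hone (cons _ _), app_ofList]
  rfl

theorem extractData_messages {f : ℕ → Step} {l : List (PMsg F)} (h : MessagesOf x f l) :
    extractData (ofList (l.map PMsg.enc)) = encProof ((List.range x.R).map f) := by
  obtain ⟨l₁, l₂, l₃, seg, rfl, hseg, hl⟩ := h.split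
  rw [extractData, fold_ofList]
  simp only [List.map_append, List.foldl_append]
  rw [foldl_extractStep_of_not_carries (l := l₁) fun p hp => hl p (by simp [hp])]
  have h1 : ∀ k, (((List.range k).map (fun i => (⟨.clause (.input (.cl (x.L + i)) x.w),
      .clause (f i).red⟩ : PMsg F))).map PMsg.enc).foldl (fun s m => extractStep m s)
        (cons nil (cons nil nil)) =
      cons nil (cons (ofList ((List.range k).map fun i => encClause (f i).red)) nil) := by
    intro k
    induction k with
    | zero => rfl
    | succ k ih =>
      rw [List.range_succ, List.map_append, List.map_append, List.foldl_append, ih, List.map_append,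
        ← app_ofList]
      simp [extractStep, PMsg.enc, Cmd.enc, Priv.enc, Name.enc, tag, ofNat_injective.eq_iff]
  rw [h1, foldl_extractStep_of_not_carries (l := l₂) fun p hp => hl p (by simp [hp])]
  have h2 : ∀ k ≤ x.R, (((List.range k).flatMap seg).map PMsg.enc).foldl
        (fun s m => extractStep m s)
        (cons nil (cons (ofList ((List.range x.R).map fun i => encClause (f i).red)) nil)) =
      cons nil (cons (ofList (((List.range x.R).map fun i => encClause (f i).red).drop k))
        (ofList (((List.range k).map f).map Step.enc))) := by
    intro k hk
    induction k with
    | zero => rfl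
    | succ k ih =>
      rw [List.range_succ, List.flatMap_append, List.map_append, List.foldl_append,
        ih (by omega), List.flatMap_singleton, List.drop_eq_getElem_cons (by simpa using hk),
        List.getElem_map, List.getElem_range, foldl_extractStep_segment (hseg k hk)]
      simp
  rw [h2 _ le_rfl, foldl_extractStep_of_not_carries (l := l₃) fun p hp => hl p (by simp [hp])]
  rfl

/-! ### Knowledge soundness and soundness -/

variable [Field F]

/-- Every outcome of the execution with the honest verifier that has full length and no bad answer
comes from a run of the functionalities. -/
theorem run_of_mem_support {P : Prover F} {tr : List (Round F)} {n : ℕ} {st : State F}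
    {tr₀ : List (Round F)} (htr : tr ∈ (execFrom P (honestVerifier x) n st tr₀).support)
    (hlen : tr.length = tr₀.length + n)
    (ha : ∀ r ∈ tr, r.toV ≠ Resp.abort ∧ r.toV ≠ Resp.cheating) :
    ∃ u, tr = tr₀ ++ u ∧
      u.map Round.v =
        (List.range' tr₀.length n).map (fun k => (verifierScript F x).getD k default) ∧
      ∃ st', State.Run st (u.map fun r => (r.p, r.v)) st' := by
  induction n generalizing st tr₀ with
  | zero =>
    rw [execFrom] at htr
    rw [PMF.mem_support_pure_iff] at htr
    exact ⟨[], by simpa using htr, rfl, st, rfl⟩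
  | succ n ih =>
    rw [execFrom] at htr
    obtain ⟨p, -, htr⟩ := (PMF.mem_support_bind_iff _ _ _).1 htr
    obtain ⟨v, hv, htr⟩ := (PMF.mem_support_bind_iff _ _ _).1 htr
    rw [honestVerifier, PMF.mem_support_pure_iff, List.length_map] at hv
    simp only at htr
    split_ifs at htr with hab
    · rw [PMF.mem_support_pure_iff] at htr
      refine ((ha ⟨p, v, (st.round p v).2.1, (st.round p v).2.2⟩ ?_).1 hab).elim
      rw [htr]
      exact List.mem_append_right _ (List.mem_singleton.2 rfl)
    · obtain ⟨u, hu, huv, st', hrun⟩ := ih htr (by simp [hlen]; omega)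
      rw [List.append_assoc] at hu
      refine ⟨_, hu, ?_, st', ?_⟩
      · rw [List.map_append, huv, List.range'_succ, hv]
        simp
      · have hr := (ha _ (by rw [hu]; simp : (⟨p, v, (st.round p v).2.1, (st.round p v).2.2⟩ :
          Round F) ∈ tr)).2
        rcases hinv : st.invoke p v with _ | ⟨s, r⟩
        · simp [State.round, hinv] at hab
        · simp only [State.round, hinv] at hr hrun
          exact ⟨s, r, hinv, hr, hrun⟩

theorem run_of_accepts {P : Prover F} {tr : List (Round F)}
    (htr : tr ∈ (exec x P (honestVerifier x)).support) (ha : Accepts x tr) :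
    (tr.map fun r => (r.p, r.v)).map Prod.snd = verifierScript F x ∧
      ∃ st', State.Run .start (tr.map fun r => (r.p, r.v)) st' := by
  obtain ⟨u, rfl, hv, hr⟩ := run_of_mem_support htr (by simpa using ha.1) ha.2
  refine ⟨?_, hr⟩
  rw [List.map_map]
  refine hv.trans (List.ext_getElem (by simp [rounds]) fun k h1 h2 => ?_)
  simp [List.getD_eq_getElem?_getD, List.getElem?_eq_getElem h2]

theorem Pr_eq_zero {α : Type} {μ : PMF α} {E : Set α} (h : ∀ a ∈ μ.support, a ∉ E) :
    Pr μ E = 0 := by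
  rw [Pr, PMF.toOuterMeasure_apply_eq_zero_iff]
  exact Set.disjoint_left.2 h

theorem knowledgeSound (F : Type) [Field F] : KnowledgeSound F := by
  obtain ⟨E, hE, hrun⟩ := PolyF.id.tl.extractData
  refine ⟨E, hE, fun x hx P => Pr_eq_zero ?_⟩
  rintro tr htr ⟨ha, hno⟩
  obtain ⟨hv, st', hr⟩ := run_of_accepts htr ha
  obtain ⟨f, hrel, hmsg⟩ := witness_of_run hx hv hr
  refine hno ⟨_, hrel, ?_⟩
  simp only [hrun, ← extractData_messages hmsg, extractorInput, tl_cons]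
  simp [List.map_map, Function.comp_def]

theorem sound (F : Type) [Field F] : Sound F := by
  refine fun x hx ht P => Pr_eq_zero fun tr htr ha => ?_
  obtain ⟨hv, st', hr⟩ := run_of_accepts htr ha
  obtain ⟨f, hrel, -⟩ := witness_of_run hx hv hr
  exact hrel.refutes.not_isTrue hx ht

end

section

/-! ### The extended witness of the honest prover -/

theorem innermost_eq_none {φ : QBF} {C : Clause} (h : innermost φ C = none) :
    ∀ l ∈ C, ¬ φ.IsEx l.var := by
  intro l hl he
  rw [innermost, List.argmax_eq_none] at h
  have : l ∈ (C.filter (fun l => φ.IsEx l.var)).sort (· ≤ ·) := by simp [hl, he]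
  rw [h] at this
  simp at this

theorem innermost_eq_some {φ : QBF} {C : Clause} {m : Lit} (h : innermost φ C = some m) :
    m ∈ C ∧ φ.IsEx m.var ∧ ∀ l ∈ C, φ.IsEx l.var → φ.pos l.var ≤ φ.pos m.var := by
  have h1 := List.argmax_mem h
  simp only [Finset.mem_sort, Finset.mem_filter] at h1
  exact ⟨h1.1, h1.2, fun l hl he => List.le_of_mem_argmax (f := fun l : Lit => φ.pos l.var)
    (by simp [hl, he]) h⟩

theorem litSet_slots {C : Clause} {m : ℕ} {pad : Sym} (hp : ∀ l, pad ≠ .lit l) :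
    litSet (slots C m pad) = C := by
  ext l
  rw [mem_litSet]
  simp only [slots, List.mem_append, List.mem_map, Finset.mem_sort, List.mem_replicate,
    Sym.lit.injEq]
  exact ⟨fun h => h.elim (fun ⟨a, ha, h⟩ => h ▸ ha) fun h => (hp l h.2.symm).elim,
    fun h => Or.inl ⟨l, h, rfl⟩⟩

theorem length_slots {C : Clause} {m : ℕ} {pad : Sym} (h : C.card ≤ m) :
    (slots C m pad).length = m := by
  simp [slots]; omega

theorem mem_slots {C : Clause} {m : ℕ} {pad s : Sym} (h : s ∈ slots C m pad) :
    (∃ l ∈ C, s = .lit l) ∨ s = pad := by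
  simp only [slots, List.mem_append, List.mem_map, Finset.mem_sort, List.mem_replicate] at h
  exact h.imp (fun ⟨l, hl, h⟩ => ⟨l, hl, h.symm⟩) fun h => h.2

theorem eq_of_pos_eq {φ : QBF} {x y : ℕ} (hx : x ∈ φ.vars) (h : φ.pos x = φ.pos y) : x = y :=
  (List.idxOf_inj hx).1 h

/-- The symbol that the honest prover uses for the innermost existential literal. -/
def innermostSym (φ : QBF) (C : Clause) : Sym := (innermost φ C).elim Sym.noEx Sym.lit

theorem innermostSym_mem {φ : QBF} {C : Clause} : innermostSym φ C ∈ exSyms φ := by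
  unfold innermostSym
  rcases h : innermost φ C with _ | m
  · simp [exSyms]
  · exact lit_mem_exSyms.2 (innermost_eq_some h).2.1

theorem litSet_innermostSym {φ : QBF} {C : Clause} :
    litSet [innermostSym φ C] = (innermost φ C).toFinset := by
  ext l
  rw [mem_litSet, List.mem_singleton, innermostSym]
  rcases innermost φ C with _ | m
  · simp
  · simp

theorem toFinset_innermost_subset {φ : QBF} {C : Clause} :
    (innermost φ C).toFinset ⊆ φ.forallRed C := by
  intro l hl
  rw [Option.mem_toFinset, Option.mem_def] at hl
  obtain ⟨h1, h2, -⟩ := innermost_eq_some hl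
  simp [QBF.forallRed, h1, h2]

/-- The retained literals precede the innermost existential literal. -/
theorem symOrder_retained {φ : QBF} {C : Clause} (hN : NonTaut C) {m : ℕ} {s : Sym}
    (hs : s ∈ slots (φ.forallRed C \ (innermost φ C).toFinset) m .padLo) :
    symOrder φ.vars s < symOrder φ.vars (innermostSym φ C) := by
  rcases mem_slots hs with ⟨l, hl, rfl⟩ | rfl
  · simp only [QBF.forallRed, Finset.mem_sdiff, Finset.mem_filter, Option.mem_toFinset,
      Option.mem_def] at hl
    obtain ⟨⟨hlC, hr⟩, hne⟩ := hl
    unfold innermostSym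
    rcases h : innermost φ C with _ | m
    · have h1 := innermost_eq_none h
      rcases hr with hr | ⟨m, hm, he, -⟩
      · exact (h1 l hlC hr).elim
      · exact (h1 m hm he).elim
    · obtain ⟨hm, hme, hmax⟩ := innermost_eq_some h
      rw [Option.elim_some, symOrder_lit, symOrder_lit]
      rcases hr with hr | ⟨k, hk, hke, hlt⟩
      · have h1 := hmax l hlC hr
        rcases h1.lt_or_eq with h1 | h1
        · omega
        · have hv := eq_of_pos_eq hr.mem_vars h1
          by_cases hsg : l.sign = m.sign
          · exact (hne (h.trans (congrArg some (Lit.ext hv hsg).symm))).elim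
          · refine (hN l hlC ?_).elim
            rwa [show l.neg = m from Lit.ext hv (by
              cases hl : l.sign <;> cases hm' : m.sign <;> simp_all [Lit.neg])]
      · have := hmax k hk hke
        omega
  · unfold innermostSym
    cases innermost φ C <;> simp [symOrder]

/-- The removed literals follow the innermost existential literal. -/
theorem symOrder_removed {φ : QBF} {C : Clause} (hc : ∀ l ∈ C, l.var ∈ φ.vars) {m : ℕ} {s : Sym}
    (hs : s ∈ slots (C \ φ.forallRed C) m .padHi) :
    symOrder φ.vars s > symOrder φ.vars (innermostSym φ C) := by
  have hlt : ∀ {y}, y ∈ φ.vars → φ.pos y < φ.vars.length := List.idxOf_lt_length_of_mem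
  rcases mem_slots hs with ⟨l, hl, rfl⟩ | rfl
  · simp only [QBF.forallRed, Finset.mem_sdiff, Finset.mem_filter, not_and, not_or, not_exists] at hl
    obtain ⟨hlC, hr⟩ := hl
    obtain ⟨hr₁, hr₂⟩ := hr hlC
    unfold innermostSym
    rcases h : innermost φ C with _ | m
    · rw [symOrder_lit]; simp [symOrder]
    · obtain ⟨hm, hme, -⟩ := innermost_eq_some h
      rw [Option.elim_some, symOrder_lit, symOrder_lit]
      have h1 := hr₂ m hm hme
      have h2 : φ.pos l.var ≠ φ.pos m.var := fun h2 => hr₁ (eq_of_pos_eq (hc l hlC) h2 ▸ hme)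
      omega
  · unfold innermostSym
    rcases h : innermost φ C with _ | m
    · simp [symOrder]
    · have := hlt (innermost_eq_some h).2.1.mem_vars
      rw [Option.elim_some, symOrder_lit]
      simp only [symOrder]
      omega

theorem removed_mem_allSyms {φ : QBF} {C : Clause} (hc : ∀ l ∈ C, l.var ∈ φ.vars) {m : ℕ}
    {s : Sym} (hs : s ∈ slots (C \ φ.forallRed C) m .padHi) : s ∈ allSyms φ := by
  rcases mem_slots hs with ⟨l, hl, rfl⟩ | rfl
  · rw [Finset.mem_sdiff] at hl
    refine lit_mem_allSyms.2 ((QBF.isEx_or_all _ (hc l hl.1)).resolve_left fun he => hl.2 ?_)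
    simp [QBF.forallRed, hl.1, he]
  · simp [allSyms]

/-! ### The execution of the honest prover -/

variable {F : Type} {x : Stmt} {π : List Step}

/-- The values that the honest prover commits. -/
def honestVal (F : Type) (x : Stmt) (π : List Step) : Name → Val F
  | .cl j => .clause ((clauseSeq x.qbf π).getD j ∅)
  | .piv i => .lit (.lit (π.getD i default).pivot)
  | .bar i => .clause (π.getD i default).bar
  | .fetL i => .clause ((clauseSeq x.qbf π).getD (π.getD i default).left ∅)
  | .fetR i => .clause ((clauseSeq x.qbf π).getD (π.getD i default).right ∅)
  | .wRes i => .clause ((π.getD i default).red \ (innermost x.qbf (π.getD i default).bar).toFinset)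
  | .wRem i => .clause ((π.getD i default).bar \ (π.getD i default).red)
  | .wCl i => .clause (innermost x.qbf (π.getD i default).bar).toFinset
  | .wLit i => .lit (innermostSym x.qbf (π.getD i default).bar)
  | .wOrd i => .nat (symOrder x.qbf.vars (innermostSym x.qbf (π.getD i default).bar))
  | .resLit i j => .lit ((slots ((π.getD i default).red \
      (innermost x.qbf (π.getD i default).bar).toFinset) x.w .padLo).getD j .padLo)
  | .resOrd i j => .nat (symOrder x.qbf.vars ((slots ((π.getD i default).red \
      (innermost x.qbf (π.getD i default).bar).toFinset) x.w .padLo).getD j .padLo))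
  | .remLit i j => .lit ((slots ((π.getD i default).bar \ (π.getD i default).red)
      x.d .padHi).getD j .padHi)
  | .remOrd i j => .nat (symOrder x.qbf.vars ((slots ((π.getD i default).bar \
      (π.getD i default).red) x.d .padHi).getD j .padHi))

/-- The state of an honest execution in which the names in `N` are assigned. -/
def honestState (F : Type) (x : Stmt) (π : List Step) (N : Set Name)
    (a : Option (List Clause)) (q : Option (List Sym × List Sym)) : State F where
  store n := if n ∈ N then some (honestVal F x π n) else none
  vars := some x.qbf.vars
  arr := a
  arrFlag := false
  quants := q
  quantFlag := false
  setFlag := false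

/-- The names to which a command assigns values. -/
def Cmd.dsts : Cmd F → List Name
  | .ord (.input n) => [n]
  | .ord (.order _ n) => [n]
  | .clause (.common n _ _) => [n]
  | .clause (.input n _) => [n]
  | .clause (.retrieval _ ns) => ns
  | .array (.read _ n) => [n]
  | _ => []

/-- The names whose values a command uses. -/
def Cmd.srcs : Cmd F → List Name
  | .ord (.order s _) => [s]
  | .clause (.retrieval s _) => [s]
  | .clause (.equal c cs) => c :: cs
  | .clause (.res a b p c) => [a, b, p, c]
  | .clause (.isFalse c) => [c]
  | .quant (.check n _) => [n]
  | .zk (.compare _ i j) => [i, j]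
  | _ => []

/-- Starting with the assigned names `N`, every command of the list uses assigned names and assigns
fresh ones; at the end the names in `N'` are assigned. -/
def WellScoped : Set Name → List (Cmd F) → Set Name → Prop
  | N, [], N' => N = N'
  | N, c :: l, N' => (∀ n ∈ c.srcs, n ∈ N) ∧ (∀ n ∈ c.dsts, n ∉ N) ∧ c.dsts.Nodup ∧
      WellScoped (N ∪ {n | n ∈ c.dsts}) l N'

/-- A message of the honest prover makes a claim that is true of the committed values. -/
def HonestMsg (x : Stmt) (π : List Step) (m : PMsg F) : Prop :=
  match m.cmd, m.priv with
  | .ord (.input n), .lit l => l.var ∈ x.qbf.vars ∧ honestVal F x π n = .lit (.lit l)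
  | .ord (.order s n), .nat k => ∃ a, honestVal F x π s = .lit a ∧ symOrder x.qbf.vars a = k ∧
      honestVal F x π n = .nat k
  | .clause (.common n C w), _ => C.card ≤ w ∧ (∀ l ∈ C, l.var ∈ x.qbf.vars) ∧
      honestVal F x π n = .clause C
  | .clause (.input n w), .clause C => C.card ≤ w ∧ (∀ l ∈ C, l.var ∈ x.qbf.vars) ∧
      honestVal F x π n = .clause C
  | .clause (.retrieval s ns), .slots S => honestVal F x π s = .clause (litSet S) ∧
      ns.map (honestVal F x π) = S.map .lit
  | .clause (.equal c cs), _ => ∃ Cs : List Clause, cs.map (honestVal F x π) = Cs.map .clause ∧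
      Cs.Pairwise Disjoint ∧ honestVal F x π c = .clause (Cs.foldr (· ∪ ·) ∅)
  | .clause (.res a b p c), _ => ∃ A B l C, honestVal F x π a = .clause A ∧
      honestVal F x π b = .clause B ∧ honestVal F x π p = .lit (.lit l) ∧
      honestVal F x π c = .clause C ∧ IsResolvent A B l C
  | .clause (.isFalse c), _ => honestVal F x π c = .clause ∅
  | .array (.read t n), .read i C => i < t ∧ (clauseSeq x.qbf π)[i]? = some C ∧
      honestVal F x π n = .clause C
  | .array .check, .proceed => True
  | .quant (.check n q), _ => ∃ a, honestVal F x π n = .lit a ∧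
      a ∈ State.quantSyms q (exSyms x.qbf, allSyms x.qbf)
  | .quant .final, .proceed => True
  | .zk (.compare op i j), _ => ∃ a b, honestVal F x π i = .nat a ∧ honestVal F x π j = .nat b ∧
      op.Holds a b
  | _, _ => False

/-- The answer to a command of the verifier in an execution without deviations. -/
def Cmd.goodResp : Cmd F → Resp
  | .array .check => .honest
  | .quant .final => .honest
  | _ => .ok

variable {N : Set Name} {a : Option (List Clause)} {q : Option (List Sym × List Sym)}

theorem honestState_store {n : Name} {v : Val F} (hn : n ∈ N) (hv : honestVal F x π n = v) :
    (honestState F x π N a q).store n = some v := by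
  simp [honestState, hn, hv]

theorem honestState_put {n : Name} {v : Val F} (hn : n ∉ N) (hv : honestVal F x π n = v) :
    (honestState F x π N a q).put n v = some (honestState F x π (N ∪ {m | m ∈ [n]}) a q) := by
  rw [State.put, if_pos (by simp [honestState, hn])]
  simp only [honestState, Option.some.injEq, State.mk.injEq, and_true]
  funext m
  by_cases hm : m = n
  · subst hm; simp [hv]
  · simp [hm]

theorem honestState_putAll {ns : List Name} {vs : List (Val F)} (hn : ∀ n ∈ ns, n ∉ N)
    (hnd : ns.Nodup) (hv : ns.map (honestVal F x π) = vs) :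
    (honestState F x π N a q).putAll ns vs =
      some (honestState F x π (N ∪ {m | m ∈ ns}) a q) := by
  induction ns generalizing N vs with
  | nil => subst hv; simp [State.putAll]
  | cons n ns ih =>
    subst hv
    rw [List.nodup_cons] at hnd
    rw [List.map_cons, State.putAll, honestState_put (hn n List.mem_cons_self) rfl,
      Option.bind_some, ih (fun m hm hm' => ?_) hnd.2 rfl]
    · congr 2
      ext m
      simp [or_assoc, or_left_comm]
    · rcases hm' with hm' | hm'
      · exact hn m (List.mem_cons_of_mem _ hm) hm'
      · obtain rfl := List.mem_singleton.1 hm'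
        exact hnd.1 hm

variable [Field F]

theorem invoke_self (st : State F) (m : PMsg F)
    (h1 : ∀ t n, m.cmd ≠ .array (.read t n)) (h2 : ∀ n q, m.cmd ≠ .quant (.check n q)) :
    st.invoke m m.cmd = st.execCmd m.cmd m.priv := by
  obtain ⟨c, p⟩ := m
  unfold State.invoke
  simp only at h1 h2 ⊢
  split
  · exact (h1 _ _ rfl).elim
  · exact (h2 _ _ rfl).elim
  · rw [if_pos rfl]; rfl

/-- A true claim about committed values is accepted, and commits the values `honestVal`. -/
theorem honest_invoke {m : PMsg F} (hm : HonestMsg x π m) (ha : a = some (clauseSeq x.qbf π) ∨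
      ∀ t n, m.cmd ≠ .array (.read t n)) (hq : q = some (exSyms x.qbf, allSyms x.qbf) ∨
      ∀ n q, m.cmd ≠ .quant (.check n q)) (hs : ∀ n ∈ m.cmd.srcs, n ∈ N)
    (hd : ∀ n ∈ m.cmd.dsts, n ∉ N) (hnd : m.cmd.dsts.Nodup) :
    (honestState F x π N a q).invoke m m.cmd =
      some (honestState F x π (N ∪ {n | n ∈ m.cmd.dsts}) a q, m.cmd.goodResp) := by
  have sym : ∀ {n : Name} {b : Sym}, n ∈ N → honestVal F x π n = .lit b →
      (honestState F x π N a q).getSym n = some b :=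
    fun hn hv => State.getSym_eq_some.2 (honestState_store hn hv)
  have nat : ∀ {n : Name} {b : ℕ}, n ∈ N → honestVal F x π n = .nat b →
      (honestState F x π N a q).getNat n = some b :=
    fun hn hv => State.getNat_eq_some.2 (honestState_store hn hv)
  have cla : ∀ {n : Name} {b : Clause}, n ∈ N → honestVal F x π n = .clause b →
      (honestState F x π N a q).getClause n = some b :=
    fun hn hv => State.getClause_eq_some.2 (honestState_store hn hv)
  have hrange : ∀ {l : Lit}, (honestState F x π N a q).InRange l ↔ l.var ∈ x.qbf.vars := by
    intro l
    simp [State.InRange, honestState]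
  have hnil : ∀ {s : Set Name}, s ∪ {n | n ∈ ([] : List Name)} = s := by simp
  have hvars : (honestState F x π N a q).vars = some x.qbf.vars := rfl
  obtain ⟨c, p⟩ := m
  unfold HonestMsg at hm
  simp only at ha hq hs hd hnd
  simp only at hm
  split at hm
  · rw [invoke_self _ _ (by simp) (by simp)]
    simp only [State.execCmd, State.execOrd, Cmd.dsts] at hd ⊢
    rw [if_pos (hrange.2 hm.1), honestState_put (hd _ List.mem_cons_self) hm.2]
    rfl
  · obtain ⟨b, hb, rfl, hn⟩ := hm
    rw [invoke_self _ _ (by simp) (by simp)]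
    simp only [State.execCmd, State.execOrd, Cmd.dsts, Cmd.srcs] at hd hs ⊢
    simp only [sym (hs _ List.mem_cons_self) hb, hvars, Option.bind_eq_bind, Option.bind_some,
      if_true, honestState_put (hd _ List.mem_cons_self) hn]
    rfl
  · rw [invoke_self _ _ (by simp) (by simp)]
    simp only [State.execCmd, State.execClause, Cmd.dsts] at hd ⊢
    rw [if_pos ⟨hm.1, fun l hl => hrange.2 (hm.2.1 l hl)⟩,
      honestState_put (hd _ List.mem_cons_self) hm.2.2]
    rfl
  · rw [invoke_self _ _ (by simp) (by simp)]
    simp only [State.execCmd, State.execClause, Cmd.dsts] at hd ⊢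
    rw [if_pos ⟨hm.1, fun l hl => hrange.2 (hm.2.1 l hl)⟩,
      honestState_put (hd _ List.mem_cons_self) hm.2.2]
    rfl
  · rw [invoke_self _ _ (by simp) (by simp)]
    simp only [State.execCmd, State.execClause, Cmd.dsts, Cmd.srcs] at hd hs hnd ⊢
    simp only [cla (hs _ List.mem_cons_self) hm.1, Option.bind_eq_bind, Option.bind_some, if_true,
      honestState_putAll hd hnd hm.2]
    rfl
  · obtain ⟨Cs, hCs, hdis, hc⟩ := hm
    rw [invoke_self _ _ (by simp) (by simp)]
    simp only [State.execCmd, State.execClause, Cmd.dsts, Cmd.srcs] at hs ⊢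
    rename_i cs
    have hmap : cs.mapM (honestState F x π N a q).getClause = some Cs := by
      rw [mapM_eq_some_iff]
      have h1 : List.Forall₂ (fun n C => honestVal F x π n = .clause C) cs Cs := by
        rw [← List.forall₂_map_right_iff (f := Val.clause), ← hCs, List.forall₂_map_right_iff]
        exact List.forall₂_same.2 fun _ _ => rfl
      exact List.forall₂_iff_zip.2 ⟨h1.length_eq, fun {n C} hz =>
        cla (hs n (List.mem_cons_of_mem _ (List.of_mem_zip hz).1)) ((List.forall₂_iff_zip.1 h1).2 hz)⟩
    simp only [cla (hs _ List.mem_cons_self) hc, hmap, Option.bind_eq_bind, Option.bind_some, hnil]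
    rw [if_pos ⟨hdis, trivial⟩]
    rfl
  · obtain ⟨A, B, l, C, h1, h2, h3, h4, hres⟩ := hm
    rw [invoke_self _ _ (by simp) (by simp)]
    simp only [State.execCmd, State.execClause, Cmd.dsts, Cmd.srcs] at hs ⊢
    simp only [cla (hs _ (by simp)) h1, cla (hs _ (by simp)) h2, sym (hs _ (by simp)) h3,
      cla (hs _ (by simp)) h4, Option.bind_eq_bind, Option.bind_some]
    rw [if_pos ⟨l, rfl, hres⟩, hnil]
    rfl
  · rw [invoke_self _ _ (by simp) (by simp)]
    simp only [State.execCmd, State.execClause, Cmd.dsts, Cmd.srcs] at hs ⊢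
    simp only [cla (hs _ List.mem_cons_self) hm, Option.bind_eq_bind, Option.bind_some, if_true,
      hnil]
    rfl
  · obtain rfl := ha.resolve_right (by simp)
    simp only [State.invoke, if_true, State.execArray, Cmd.dsts] at hd ⊢
    have harr : (honestState F x π N (some (clauseSeq x.qbf π)) q).arr =
        some (clauseSeq x.qbf π) := rfl
    simp only [harr, Option.bind_eq_bind, Option.bind_some,
      honestState_put (hd _ List.mem_cons_self) hm.2.2]
    rw [if_pos ⟨hm.2.1, trivial, hm.1⟩]
    rfl
  · rw [invoke_self _ _ (by simp) (by simp)]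
    simp only [Cmd.dsts, hnil]
    rfl
  · obtain ⟨b, hb, hmem⟩ := hm
    obtain rfl := hq.resolve_right (by simp)
    simp only [State.invoke, if_true, State.execQuant, Cmd.dsts, Cmd.srcs, hnil] at hs ⊢
    have hqs : (honestState F x π N a (some (exSyms x.qbf, allSyms x.qbf))).quants =
        some (exSyms x.qbf, allSyms x.qbf) := rfl
    simp only [sym (hs _ List.mem_cons_self) hb, hqs, Option.bind_eq_bind, Option.bind_some]
    rename_i n q'
    cases q' <;> rw [if_pos ⟨trivial, hmem⟩] <;> rfl
  · rw [invoke_self _ _ (by simp) (by simp)]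
    simp only [Cmd.dsts, hnil]
    rfl
  · obtain ⟨b, c, hb, hc, hop⟩ := hm
    rw [invoke_self _ _ (by simp) (by simp)]
    simp only [State.execCmd, State.execZK, Cmd.dsts, Cmd.srcs] at hs ⊢
    simp only [nat (hs _ (by simp)) hb, nat (hs _ (by simp)) hc, Option.bind_eq_bind,
      Option.bind_some, if_pos hop, hnil]
    rfl
  · exact hm.elim

end

section

variable {F : Type} {x : Stmt} {π : List Step}

theorem wellScoped_append {l m : List (Cmd F)} {N M N' : Set Name} (h : WellScoped N l M)
    (k : WellScoped M m N') : WellScoped N (l ++ m) N' := by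
  induction l generalizing N with
  | nil => cases h; exact k
  | cons c l ih => exact ⟨h.1, h.2.1, h.2.2.1, ih h.2.2.2⟩

theorem wellScoped_range {g : ℕ → List (Cmd F)} {S : ℕ → Set Name} {k : ℕ}
    (h : ∀ i < k, WellScoped (S i) (g i) (S (i + 1))) :
    WellScoped (S 0) ((List.range k).flatMap g) (S k) := by
  induction k with
  | zero => rfl
  | succ k ih =>
    rw [List.range_succ, List.flatMap_append, List.flatMap_singleton]
    exact wellScoped_append (ih fun i hi => h i (by omega)) (h k (by omega))

theorem wellScoped_zipIdx {α : Type} {g : α × ℕ → Cmd F} {S : ℕ → Set Name}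
    (h : ∀ c, WellScoped (S c.2) [g c] (S (c.2 + 1))) (l : List α) (k : ℕ) :
    WellScoped (S k) ((l.zipIdx k).map g) (S (k + l.length)) := by
  induction l generalizing k with
  | nil => rfl
  | cons a l ih =>
    rw [List.zipIdx_cons, List.map_cons, List.length_cons, Nat.add_comm l.length, ← Nat.add_assoc,
      ← List.singleton_append]
    exact wellScoped_append (h (a, k)) (ih (k + 1))

/-- The names assigned in the course of the `i`-th step, after the setup, the first `i` steps, and
the computation of the orders of `u` retained and `v` removed literals. -/
def inStep (x : Stmt) (i u v : ℕ) : Set Name := {n | match n with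
  | .cl j => j < x.L + x.R
  | .resLit k j => k < i + 1 ∧ j < x.w
  | .resOrd k j => k < i ∧ j < x.w ∨ k = i ∧ j < u
  | .remLit k j => k < i + 1 ∧ j < x.d
  | .remOrd k j => k < i ∧ j < x.d ∨ k = i ∧ j < v
  | .piv k | .bar k | .fetL k | .fetR k | .wRes k | .wRem k | .wCl k | .wLit k | .wOrd k =>
    k < i + 1}

/-- The names assigned before the `i`-th step. -/
def beforeStep (x : Stmt) (i : ℕ) : Set Name := {n | match n with
  | .cl j => j < x.L + x.R
  | .resLit k j | .resOrd k j => k < i ∧ j < x.w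
  | .remLit k j | .remOrd k j => k < i ∧ j < x.d
  | .piv k | .bar k | .fetL k | .fetR k | .wRes k | .wRem k | .wCl k | .wLit k | .wOrd k => k < i}

/-- In each step every name is assigned once, and used only afterwards. -/
theorem wellScoped_verifierStep {i : ℕ} (hi : i < x.R) :
    WellScoped (beforeStep x i) (verifierStep F x i) (beforeStep x (i + 1)) := by
  have hend : beforeStep x (i + 1) = inStep x i x.w x.d := by
    ext n
    cases n <;> simp [beforeStep, inStep] <;> omega
  rw [hend, verifierStep]
  refine wellScoped_append (M := inStep x i x.w x.d) (wellScoped_append (M := inStep x i x.w x.d)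
    (wellScoped_append (M := inStep x i x.w x.d) (wellScoped_append (M := inStep x i x.w 0)
    (wellScoped_append (M := inStep x i 0 0) ?_ ?_) ?_) ?_) ?_) ?_
  · have hres : ((List.range x.w).map (Name.resLit i)).Nodup :=
      List.nodup_range.map fun a b h => by cases h; rfl
    have hrem : ((List.range x.d).map (Name.remLit i)).Nodup :=
      List.nodup_range.map fun a b h => by cases h; rfl
    simp only [WellScoped, Cmd.srcs, Cmd.dsts, hres, hrem]
    simp [beforeStep]
    ext n
    cases n <;> simp [inStep] <;> omega
  · refine wellScoped_range (S := fun j => inStep x i j 0) fun j hj => ?_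
    simp [WellScoped, Cmd.srcs, Cmd.dsts, inStep, hj]
    ext n
    cases n <;> simp <;> omega
  · refine wellScoped_range (S := fun j => inStep x i x.w j) fun j hj => ?_
    simp [WellScoped, Cmd.srcs, Cmd.dsts, inStep, hj]
    ext n
    cases n <;> simp <;> omega
  · simp [WellScoped, Cmd.srcs, Cmd.dsts, inStep]
  · rw [List.map_eq_flatMap]
    refine wellScoped_range (S := fun _ => inStep x i x.w x.d) fun j hj => ?_
    simp [WellScoped, Cmd.srcs, Cmd.dsts, inStep, hj]
  · simp [WellScoped, Cmd.srcs, Cmd.dsts, inStep, hi]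

theorem map_cmd_proverStep (i : ℕ) (s : Step) :
    (proverStep F x π i s).map PMsg.cmd = verifierStep F x i := by
  simp only [proverStep, verifierStep, List.map_append, List.map_flatMap, List.map_map]
  rfl

theorem map_cmd_proverScript : (proverScript F x π).map PMsg.cmd = verifierScript F x := by
  simp only [proverScript, verifierScript, List.map_append, List.map_flatMap, List.map_map,
    map_cmd_proverStep]
  rfl

theorem map_getD_range {S : List Sym} {m : ℕ} (h : S.length = m) (d : Sym) :
    (List.range m).map (fun j => S.getD j d) = S := by
  refine List.ext_getElem (by simp [h]) fun j h1 h2 => ?_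
  simp [List.getD_eq_getElem?_getD, List.getElem?_eq_getElem h2]

theorem getD_mem {S : List Sym} {m j : ℕ} (h : S.length = m) (hj : j < m) (d : Sym) :
    S.getD j d ∈ S := by
  rw [List.getD_eq_getElem _ _ (h ▸ hj)]
  exact List.getElem_mem _

theorem clauseSeq_getD_add {i : ℕ} {s : Step} (h : π[i]? = some s) :
    (clauseSeq x.qbf π).getD (x.L + i) ∅ = s.red := by
  rw [List.getD_eq_getElem?_getD, clauseSeq, Stmt.L, List.getElem?_append_right (by omega),
    Nat.add_sub_cancel_left, List.getElem?_map, h]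
  rfl

/-- The claims of the honest prover in a step are true of the values it commits. -/
theorem honestMsg_step (h : x.qbf.Admissible) (hr : Rel x π) {i : ℕ} (hi : i < x.R) :
    ∀ m ∈ proverStep F x π i (π.getD i default), HonestMsg x π m := by
  have hget : π[i]? = some (π.getD i default) := by
    rw [List.getD_eq_getElem _ _ (hr.length ▸ hi)]
    exact List.getElem?_eq_getElem _
  have hmem : π.getD i default ∈ π := List.mem_of_getElem? hget
  have hred : (clauseSeq x.qbf π).getD (x.L + i) ∅ = (π.getD i default).red :=
    clauseSeq_getD_add hget
  obtain ⟨hL, hR, A, B, hA, hB, hex, hres, hbred⟩ := hr.refutes.1 i _ hget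
  have hclosed := closed_bar h hr.refutes.1 hmem
  have hwidth := (hr.widthStep _ hmem).1
  have hdeg := hr.degree _ hmem
  have hA' : (clauseSeq x.qbf π).getD (π.getD i default).left ∅ = A := by
    rw [List.getD_eq_getElem?_getD, hA]; rfl
  have hB' : (clauseSeq x.qbf π).getD (π.getD i default).right ∅ = B := by
    rw [List.getD_eq_getElem?_getD, hB]; rfl
  -- the clauses of the extended witness are subclauses of the resolvent
  have hredsub : (π.getD i default).red ⊆ (π.getD i default).bar := by
    rw [hbred]; exact QBF.forallRed_subset _
  have hinsub : (innermost x.qbf (π.getD i default).bar).toFinset ⊆ (π.getD i default).red := by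
    rw [hbred]; exact toFinset_innermost_subset
  have hsub : ∀ {C : Clause}, C ⊆ (π.getD i default).bar →
      C.card ≤ x.w ∧ ∀ l ∈ C, l.var ∈ x.qbf.vars := fun hC =>
    ⟨(Finset.card_le_card hC).trans hwidth, fun l hl => hclosed l (hC hl)⟩
  have hres' := hsub (Finset.sdiff_subset.trans hredsub :
    (π.getD i default).red \ (innermost x.qbf (π.getD i default).bar).toFinset ⊆ _)
  have hrem' := hsub (Finset.sdiff_subset : (π.getD i default).bar \ (π.getD i default).red ⊆ _)
  have hin' := hsub (hinsub.trans hredsub)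
  have hreslen := length_slots (pad := .padLo) hres'.1
  have hremlen := length_slots (pad := .padHi) hdeg
  have hlt : ∀ j < x.w, symOrder x.qbf.vars ((slots ((π.getD i default).red \
      (innermost x.qbf (π.getD i default).bar).toFinset) x.w .padLo).getD j .padLo) <
        symOrder x.qbf.vars (innermostSym x.qbf (π.getD i default).bar) := fun j hj =>
    symOrder_retained hres.2.2.2 (m := x.w) (by rw [← hbred]; exact getD_mem hreslen hj _)
  have hgt : ∀ j < x.d, symOrder x.qbf.vars ((slots ((π.getD i default).bar \
      (π.getD i default).red) x.d .padHi).getD j .padHi) >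
        symOrder x.qbf.vars (innermostSym x.qbf (π.getD i default).bar) := fun j hj =>
    symOrder_removed hclosed (m := x.d) (by rw [← hbred]; exact getD_mem hremlen hj _)
  have hall : ∀ j < x.d, (slots ((π.getD i default).bar \
      (π.getD i default).red) x.d .padHi).getD j .padHi ∈ allSyms x.qbf := fun j hj =>
    removed_mem_allSyms hclosed (m := x.d) (by rw [← hbred]; exact getD_mem hremlen hj _)
  have hunion : (π.getD i default).red = ((π.getD i default).red \
      (innermost x.qbf (π.getD i default).bar).toFinset) ∪
        (innermost x.qbf (π.getD i default).bar).toFinset :=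
    (Finset.sdiff_union_of_subset hinsub).symm
  simp only [proverStep, List.forall_mem_append, List.forall_mem_cons, List.forall_mem_flatMap,
    List.forall_mem_map, List.mem_range, List.not_mem_nil, false_imp_iff, implies_true, and_true]
  refine ⟨⟨⟨⟨⟨⟨⟨hex.mem_vars, rfl⟩, ⟨hwidth, hclosed, rfl⟩, ⟨hL, ?_, rfl⟩, ⟨hR, ?_, rfl⟩,
    ⟨A, B, _, _, congrArg _ hA', congrArg _ hB', rfl, rfl, hres⟩,
    ⟨_, rfl, lit_mem_exSyms.2 hex⟩, ⟨hres'.1, hres'.2, rfl⟩, ⟨hrem'.1, hrem'.2, rfl⟩,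
    ⟨hin'.1, hin'.2, rfl⟩, ⟨?_, ?_⟩, ⟨?_, ?_⟩, ⟨?_, rfl⟩, ⟨_, rfl, rfl, rfl⟩⟩,
    fun j hj => ⟨⟨_, rfl, rfl, rfl⟩, ⟨_, _, rfl, rfl, hlt j hj⟩⟩⟩,
    fun j hj => ⟨⟨_, rfl, rfl, rfl⟩, ⟨_, _, rfl, rfl, hgt j hj⟩⟩⟩,
    ⟨_, rfl, innermostSym_mem⟩⟩, fun j hj => ⟨_, rfl, hall j hj⟩⟩,
    ⟨[_, _], rfl, ?_, ?_⟩, ⟨[_, _, _], rfl, ?_, ?_⟩⟩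
  · rw [hA', hA]
  · rw [hB', hB]
  · exact congrArg Val.clause (litSet_slots (by simp)).symm
  · rw [List.map_map]
    conv_rhs => rw [← map_getD_range hreslen .padLo, List.map_map]
    rfl
  · exact congrArg Val.clause (litSet_slots (by simp)).symm
  · rw [List.map_map]
    conv_rhs => rw [← map_getD_range hremlen .padHi, List.map_map]
    rfl
  · exact congrArg Val.clause litSet_innermostSym.symm
  · simpa using Finset.sdiff_disjoint
  · refine congrArg Val.clause (hred.trans ?_)
    simpa using hunion
  · simp only [List.pairwise_cons, List.mem_cons, List.not_mem_nil, or_false, forall_eq_or_imp,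
      forall_eq, false_imp_iff, implies_true, List.Pairwise.nil, and_true]
    exact ⟨⟨Finset.sdiff_disjoint, Finset.disjoint_sdiff.mono_left Finset.sdiff_subset⟩,
      Finset.disjoint_sdiff.mono_left hinsub⟩
  · refine congrArg Val.clause ?_
    simp only [List.foldr_cons, List.foldr_nil, Finset.union_empty]
    rw [← Finset.union_assoc, ← hunion, Finset.union_sdiff_of_subset hredsub]

variable [Field F]

/-- The messages are answered one after the other as in an execution without deviations, and no flag
is set. -/
def HonestRun : State F → List (PMsg F) → State F → Prop
  | st, [], st' => st = st'
  | st, m :: l, st' => ∃ s, st.invoke m m.cmd = some (s, m.cmd.goodResp) ∧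
      s.arrFlag = false ∧ s.quantFlag = false ∧ HonestRun s l st'

theorem honestRun_append {l m : List (PMsg F)} {st s st' : State F} (h : HonestRun st l s)
    (k : HonestRun s m st') : HonestRun st (l ++ m) st' := by
  induction l generalizing st with
  | nil => cases h; exact k
  | cons a l ih =>
    obtain ⟨u, h3, h4, h5, h6⟩ := h
    exact ⟨u, h3, h4, h5, ih h6⟩

theorem honestRun_of_wellScoped {a : Option (List Clause)} {q : Option (List Sym × List Sym)}
    {N N' : Set Name} {l : List (PMsg F)} (hm : ∀ m ∈ l, HonestMsg x π m)
    (ha : a = some (clauseSeq x.qbf π) ∨ ∀ m ∈ l, ∀ t n, m.cmd ≠ .array (.read t n))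
    (hq : q = some (exSyms x.qbf, allSyms x.qbf) ∨ ∀ m ∈ l, ∀ n q, m.cmd ≠ .quant (.check n q))
    (hs : WellScoped N (l.map PMsg.cmd) N') :
    HonestRun (honestState F x π N a q) l (honestState F x π N' a q) := by
  induction l generalizing N with
  | nil => cases hs; rfl
  | cons m l ih =>
    obtain ⟨h1, h2, h3, h4⟩ := hs
    refine ⟨_, honest_invoke (hm m List.mem_cons_self)
      (ha.imp_right fun h => h m List.mem_cons_self) (hq.imp_right fun h => h m List.mem_cons_self)
      h1 h2 h3, rfl, rfl, ih (fun k hk => hm k (List.mem_cons_of_mem _ hk))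
      (ha.imp_right fun h k hk => h k (List.mem_cons_of_mem _ hk))
      (hq.imp_right fun h k hk => h k (List.mem_cons_of_mem _ hk)) h4⟩

/-- The functionalities accept all messages of a prover that holds a witness. -/
theorem honestRun_proverScript (h : x.qbf.Admissible) (hr : Rel x π) :
    ∃ st' : State F, HonestRun .start (proverScript F x π) st' := by
  have hlen : (clauseSeq x.qbf π).length = x.L + x.R := by simp [clauseSeq, hr.length, Stmt.L]
  have hpos : x.L + x.R ≠ 0 := by
    intro h0
    have := hr.refutes.2
    rw [List.eq_nil_of_length_eq_zero (hlen.trans h0)] at this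
    cases this
  let S : ℕ → Set Name := fun k => {n | ∃ j < k, n = .cl j}
  have hS : ∀ k, S k ∪ {n | n ∈ [Name.cl k]} = S (k + 1) := by
    intro k
    ext n
    cases n <;> simp [S]
    omega
  have hS0 : S 0 = ∅ := by simp [S]
  refine ⟨honestState F x π (beforeStep x x.R) (some (clauseSeq x.qbf π))
    (some (exSyms x.qbf, allSyms x.qbf)), ?_⟩
  unfold proverScript
  refine honestRun_append (s := honestState F x π (beforeStep x x.R) (some (clauseSeq x.qbf π))
      (some (exSyms x.qbf, allSyms x.qbf)))
    (honestRun_append (s := honestState F x π (S (x.L + x.R)) (some (clauseSeq x.qbf π))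
      (some (exSyms x.qbf, allSyms x.qbf)))
    (honestRun_append (s := honestState F x π (S (x.L + x.R)) none
      (some (exSyms x.qbf, allSyms x.qbf)))
    (honestRun_append (s := honestState F x π (S x.L) none (some (exSyms x.qbf, allSyms x.qbf)))
    (honestRun_append (s := honestState F x π (S x.L) none none)
    (honestRun_append (s := honestState F x π (S 0) none none) ?_ ?_) ?_) ?_) ?_) ?_) ?_
  · refine ⟨honestState F x π (S 0) none none, ?_, rfl, rfl, rfl⟩
    rw [invoke_self _ _ (by simp) (by simp), hS0]
    simp [State.execCmd, State.execOrd, honestState, State.start, Cmd.goodResp]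
  · refine honestRun_of_wellScoped ?_ (Or.inr ?_) (Or.inr ?_) ?_
    · simp only [List.forall_mem_map]
      rintro ⟨C, j⟩ hj
      have hj' := List.mem_zipIdx_iff_getElem?.1 hj
      have hC := List.mem_of_getElem? hj'
      refine ⟨hr.widthInput C hC, h.closed C hC, congrArg Val.clause ?_⟩
      simp only [clauseSeq, List.getD_eq_getElem?_getD]
      rw [List.getElem?_append_left (List.getElem?_eq_some_iff.1 hj').1, hj']
      rfl
    · rintro m hm
      obtain ⟨c, -, rfl⟩ := List.mem_map.1 hm
      simp
    · rintro m hm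
      obtain ⟨c, -, rfl⟩ := List.mem_map.1 hm
      simp
    · rw [List.map_map]
      have := wellScoped_zipIdx (F := F) (S := S)
        (g := fun c : Clause × ℕ => .clause (.common (.cl c.2) c.1 x.w)) (fun c => by
          simp only [WellScoped, Cmd.srcs, Cmd.dsts]
          exact ⟨by simp, by simpa [S] using fun j hj => hj.ne', by simp, hS _⟩) x.qbf.matrix 0
      rwa [Nat.zero_add] at this
  · refine ⟨honestState F x π (S x.L) none (some (exSyms x.qbf, allSyms x.qbf)), ?_,
      rfl, rfl, rfl⟩
    rw [invoke_self _ _ (by simp) (by simp)]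
    rfl
  · refine honestRun_of_wellScoped ?_ (Or.inr ?_) (Or.inr ?_) ?_
    · simp only [List.forall_mem_map, List.mem_range]
      intro i hi
      have hget : π[i]? = some (π.getD i default) := by
        rw [List.getD_eq_getElem _ _ (hr.length ▸ hi)]
        exact List.getElem?_eq_getElem _
      have hmem : π.getD i default ∈ π := List.mem_of_getElem? hget
      obtain ⟨-, -, -, -, -, -, -, -, hred⟩ := hr.refutes.1 i _ hget
      refine ⟨(hr.widthStep _ hmem).2, fun l hl => closed_bar h hr.refutes.1 hmem l ?_,
        congrArg Val.clause (clauseSeq_getD_add hget)⟩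
      rw [hred] at hl
      exact QBF.forallRed_subset _ hl
    · simp
    · simp
    · rw [List.map_map, List.map_eq_flatMap]
      refine wellScoped_range (S := fun k => S (x.L + k)) fun i hi => ?_
      simp only [WellScoped, Cmd.srcs, Cmd.dsts, Function.comp_apply]
      exact ⟨by simp, by simpa [S] using fun j hj => hj.ne', by simp, hS _⟩
  · have hmap : ((List.range (x.L + x.R)).map Name.cl).mapM
        (honestState F x π (S (x.L + x.R)) none
          (some (exSyms x.qbf, allSyms x.qbf))).getClause = some (clauseSeq x.qbf π) := by
      rw [mapM_eq_some_iff, List.forall₂_iff_get]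
      refine ⟨by simp [hlen], fun j h1 h2 => ?_⟩
      rw [State.getClause_eq_some]
      refine honestState_store ?_ ?_
      · simp only [List.length_map, List.length_range] at h1
        simpa [S] using h1
      · simp [honestVal, List.getElem?_eq_getElem h2]
    refine ⟨honestState F x π (S (x.L + x.R)) (some (clauseSeq x.qbf π))
      (some (exSyms x.qbf, allSyms x.qbf)), ?_, rfl, rfl, rfl⟩
    rw [invoke_self _ _ (by simp) (by simp)]
    simp only [State.execCmd, State.execArray, hmap, Option.bind_eq_bind, Option.bind_some]
    rfl
  · refine honestRun_of_wellScoped ?_ (Or.inl rfl) (Or.inl rfl) ?_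
    · simp only [List.forall_mem_flatMap, List.mem_range]
      exact fun i hi => honestMsg_step h hr hi
    · rw [List.map_flatMap]
      simp only [map_cmd_proverStep]
      have hb : S (x.L + x.R) = beforeStep x 0 := by
        ext n
        cases n <;> simp [S, beforeStep]
      rw [hb]
      exact wellScoped_range (S := beforeStep x) fun i hi => wellScoped_verifierStep hi
  · refine honestRun_of_wellScoped ?_ (Or.inl rfl) (Or.inl rfl) ?_
    · simp only [List.forall_mem_cons, List.not_mem_nil, false_imp_iff, implies_true, and_true]
      refine ⟨congrArg Val.clause ?_, trivial, trivial⟩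
      have := hr.refutes.2
      rw [List.getLast?_eq_getElem?, hlen] at this
      rw [List.getD_eq_getElem?_getD, this]
      rfl
    · simp [WellScoped, Cmd.srcs, Cmd.dsts, beforeStep]
      omega

end

section

variable {F : Type} {x : Stmt} {π : List Step}

/-! ### Completeness -/

theorem length_proverScript : (proverScript F x π).length = rounds F x := by
  rw [rounds, ← map_cmd_proverScript (F := F) (x := x) (π := π), List.length_map]

theorem Cmd.goodResp_ne (c : Cmd F) : c.goodResp ≠ .abort ∧ c.goodResp ≠ .cheating := by
  unfold Cmd.goodResp
  split <;> simp

/-- The execution with both honest parties is deterministic, and no answer is an abort or reports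
cheating. -/
theorem execFrom_honest [Field F] {l : List (PMsg F)} {st st' : State F} {tr : List (Round F)}
    (h : HonestRun st l st') (hl : (proverScript F x π).drop tr.length = l) :
    ∃ tr', execFrom (honestProver x π) (honestVerifier x) l.length st tr = PMF.pure tr' ∧
      tr'.length = tr.length + l.length ∧
      ∀ r ∈ tr', r ∈ tr ∨ r.toV ≠ .abort ∧ r.toV ≠ .cheating := by
  induction l generalizing st tr with
  | nil => exact ⟨tr, rfl, rfl, fun r => Or.inl⟩
  | cons m l ih =>
    obtain ⟨s, hs, -, -, h⟩ := h
    have hm : (proverScript F x π)[tr.length]? = some m := by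
      rw [← List.head?_drop, hl]; rfl
    have hc : (verifierScript F x)[tr.length]? = some m.cmd := by
      rw [← map_cmd_proverScript (F := F) (x := x) (π := π), List.getElem?_map, hm]; rfl
    have hl' : (proverScript F x π).drop (tr.length + 1) = l := by
      rw [← List.tail_drop, hl, List.tail_cons]
    obtain ⟨tr', h1, h2, h3⟩ := ih (tr := tr ++ [⟨m, m.cmd, .ok, m.cmd.goodResp⟩]) h
      (by simpa using hl')
    refine ⟨tr', ?_, by simpa [add_assoc, add_comm 1] using h2, fun r hr => ?_⟩
    · rw [← h1]
      simp [execFrom, honestProver, honestVerifier, PMF.pure_bind, hm, hc, State.round, hs,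
        (Cmd.goodResp_ne m.cmd).1]
    · rcases h3 r hr with h4 | h4
      · rcases List.mem_append.1 h4 with h5 | h5
        · exact Or.inl h5
        · rw [List.mem_singleton.1 h5]
          exact Or.inr (Cmd.goodResp_ne m.cmd)
      · exact Or.inr h4

theorem complete (F : Type) [Field F] : Complete F := by
  intro x π hx hr
  obtain ⟨st', h⟩ := honestRun_proverScript (F := F) hx hr
  obtain ⟨tr, h1, h2, h3⟩ := execFrom_honest (tr := []) h rfl
  have hacc : Accepts x tr :=
    ⟨by simpa [length_proverScript] using h2, fun r hr => (h3 r hr).resolve_left (by simp)⟩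
  rw [Pr, exec, ← length_proverScript (π := π), h1, PMF.toOuterMeasure_pure_apply, if_pos (Set.mem_ofPred.2 hacc)]

end

section

variable {F : Type} {x : Stmt} {π : List Step}

/-! ### Deviations of the verifier from the protocol -/

/-- The same state with other flags. -/
def State.withFlags (a b : Bool) (st : State F) : State F :=
  { st with arrFlag := a, quantFlag := b }

/-- The commands that the protocol uses. -/
def Cmd.Used : Cmd F → Prop
  | .ord _ => True
  | .clause _ => True
  | .array _ => True
  | .quant _ => True
  | .zk (.compare _ _ _) => True
  | _ => False

/-- The used commands that neither read nor change the flags. -/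
def Cmd.Silent : Cmd F → Prop
  | .ord _ => True
  | .clause _ => True
  | .quant (.setup _ _) => True
  | .zk (.compare _ _ _) => True
  | _ => False

namespace State

variable {a b : Bool} {st : State F}

theorem put_withFlags (n : Name) (v : Val F) :
    (st.withFlags a b).put n v = (st.put n v).map (withFlags a b) := by
  have h : (st.withFlags a b).store = st.store := rfl
  unfold put
  rw [h]
  split_ifs <;> rfl

theorem putAll_withFlags (ns : List Name) (vs : List (Val F)) :
    (st.withFlags a b).putAll ns vs = (st.putAll ns vs).map (withFlags a b) := by
  induction ns generalizing st vs with
  | nil => cases vs <;> rfl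
  | cons n ns ih =>
    cases vs with
    | nil => rfl
    | cons v vs =>
      simp only [putAll, put_withFlags]
      cases st.put n v with
      | none => rfl
      | some s => exact ih vs

variable [Field F]

/-- The flags have no influence on a silent command. -/
theorem execCmd_withFlags {c : Cmd F} (hc : c.Silent) (p : Priv F) :
    (st.withFlags a b).execCmd c p =
      (st.execCmd c p).map fun o => (o.1.withFlags a b, o.2) := by
  have hs : (st.withFlags a b).getSym = st.getSym := rfl
  have hn : (st.withFlags a b).getNat = st.getNat := rfl
  have hC : (st.withFlags a b).getClause = st.getClause := rfl
  have hf : (st.withFlags a b).getFld = st.getFld := rfl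
  have hr : (st.withFlags a b).InRange = st.InRange := rfl
  have hp : (st.withFlags a b).openPoly = st.openPoly := rfl
  have hv : (st.withFlags a b).vars = st.vars := rfl
  have hq : (st.withFlags a b).quants = st.quants := rfl
  have hmap : ∀ (o : Option (State F)) (r : Resp),
      (o.map (withFlags a b)).map (fun s => (s, r)) =
        (o.map (fun s => (s, r))).map fun o => (o.1.withFlags a b, o.2) := by
    intro o r; cases o <;> rfl
  have hite : ∀ (P : Prop) [Decidable P] (o : Option (State F × Resp)),
      (if P then o.map (fun o => (o.1.withFlags a b, o.2)) else none) =
        (if P then o else none).map (fun o => (o.1.withFlags a b, o.2)) := by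
    intro P _ o; split_ifs <;> rfl
  have hsome : ∀ r : Resp, some (st.withFlags a b, r) =
    (some (st, r)).map (fun o : State F × Resp => (o.1.withFlags a b, o.2)) := fun r => rfl
  have hbind : ∀ {α : Type} (o : Option α) (g : α → Option (State F × Resp)),
      (o.bind fun y => (g y).map (fun o => (o.1.withFlags a b, o.2))) =
        (o.bind g).map (fun o => (o.1.withFlags a b, o.2)) := by
    intro α o g; cases o <;> rfl
  rcases c with c | c | c | c | c | c
  · simp only [execCmd]
    unfold execOrd
    split
    · rw [hv]; split_ifs <;> rfl
    · rw [hr, put_withFlags, hmap, hite]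
    · simp only [Option.bind_eq_bind, hs, hv, put_withFlags, hmap, hite, hbind]
    · rfl
  · simp only [execCmd]
    unfold execClause
    split
    · simp only [hr, put_withFlags, hmap, hite]
    · simp only [hr, put_withFlags, hmap, hite]
    · simp only [Option.bind_eq_bind, hC, putAll_withFlags, hmap, hite, hbind]
    · simp only [Option.bind_eq_bind, hC, hsome, hite, hbind]
    · simp only [Option.bind_eq_bind, hC, hs, hsome, hite, hbind]
    · simp only [Option.bind_eq_bind, hC, hsome, hite, hbind]
    · rfl
  · exact hc.elim
  · cases c with
    | setup e u =>
      simp only [execCmd, execQuant, hq]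
      split_ifs <;> rfl
    | _ => exact hc.elim
  · cases c with
    | compare op i j =>
      simp only [execCmd, execZK, Option.bind_eq_bind, hn, hsome, hite, hbind]
    | _ => exact hc.elim
  · exact hc.elim

end State

/-- The answer of the functionalities when the honest prover sends `c` and the verifier sends `v`,
with the flags of the array and of the quantifiers. -/
def simAnswer (c v : Cmd F) (a b : Bool) : Resp :=
  if v = c then
    if c = .array .check then if a then .cheating else .honest
    else if c = .quant .final then if b then .cheating else .honest
    else .ok
  else if (∃ t t' n, c = .array (.read t n) ∧ v = .array (.read t' n)) ∨
    (∃ n q q', c = .quant (.check n q) ∧ v = .quant (.check n q')) then .ok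
  else .abort

/-- The flag of the array after a command `c`, in place of which the verifier sends `v`. -/
def arrDeviates (c v : Cmd F) (a : Bool) : Bool :=
  a || decide ((∃ t n, c = .array (.read t n)) ∧ v ≠ c)

/-- The flag of the quantifiers after a command `c`, in place of which the verifier sends `v`. -/
def quantDeviates (c v : Cmd F) (b : Bool) : Bool :=
  b || decide ((∃ n q, c = .quant (.check n q)) ∧ v ≠ c)

theorem Cmd.Silent.ne {c : Cmd F} (h : c.Silent) : (∀ t n, c ≠ .array (.read t n)) ∧
    (∀ n q, c ≠ .quant (.check n q)) ∧ c ≠ .array .check ∧ c ≠ .quant .final := by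
  refine ⟨?_, ?_, ?_, ?_⟩
  · rintro t n rfl; exact h
  · rintro n q rfl; exact h
  · rintro rfl; exact h
  · rintro rfl; exact h

/-- What the functionalities do with an honest prover when the verifier deviates: they answer as
`simAnswer` says, and the state differs from that of an honest execution only in the flags. The
flag of the array cannot be set before its setup, as a `read` aborts there. -/
theorem State.invoke_withFlags [Field F] {st s : State F} {m : PMsg F} {a b : Bool}
    (hm : m.cmd.Used) (h : st.invoke m m.cmd = some (s, m.cmd.goodResp))
    (h3 : s.arrFlag = false) (h4 : s.quantFlag = false)
    (ha : st.arr = none → a = false) (v : Cmd F) :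
    (st.withFlags a b).invoke m v =
        (if simAnswer m.cmd v a b = .abort then none
          else some (s.withFlags (arrDeviates m.cmd v a) (quantDeviates m.cmd v b),
            simAnswer m.cmd v a b)) ∧
      (simAnswer m.cmd v a b ≠ .abort → s.arr = none → arrDeviates m.cmd v a = false) := by
  obtain ⟨c, p⟩ := m
  simp only at h hm ⊢
  have h₀ := h
  by_cases hr : ∃ t n, c = .array (.read t n)
  · obtain ⟨t, n, rfl⟩ := hr
    simp only [invoke, if_true] at h
    unfold execArray at h
    split at h
    · cases ‹ArrayCmd.read _ _ = ArrayCmd.setup _›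
    · rename_i t₀ n₀ idx C heq
      cases heq
      simp only [Option.bind_eq_bind, Option.bind_eq_some_iff] at h
      obtain ⟨M, hM, u, hu, h⟩ := h
      split_ifs at h with hc
      · cases h
        have hsarr : s.arr ≠ none := by
          obtain ⟨-, rfl⟩ := put_eq_some hu
          simp [hM]
        refine ⟨?_, fun _ h => (hsarr h).elim⟩
        by_cases hv : ∃ t', v = .array (.read t' n)
        · obtain ⟨t', rfl⟩ := hv
          have hans : simAnswer (F := F) (.array (.read t n)) (.array (.read t' n)) a b = .ok := by
            unfold simAnswer
            split_ifs <;> simp_all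
          have hqd : quantDeviates (F := F) (.array (.read t n)) (.array (.read t' n)) b = b := by
            simp [quantDeviates]
          rw [hans, hqd]
          have hM' : (st.withFlags a b).arr = some M := hM
          simp only [invoke, if_true, execArray, hM', Option.bind_eq_bind, Option.bind_some,
            put_withFlags, hu, Option.map_some, hc.1, true_and, reduceCtorEq, if_false]
          by_cases ht : t = t'
          · subst ht
            simp [arrDeviates, hc.2.2]
          · simp only [ht, false_and, if_false, arrDeviates]
            simp [Ne.symm ht, withFlags]
        · have hans : simAnswer (.array (.read t n)) v a b = .abort := by
            unfold simAnswer
            rw [if_neg (fun h => hv ⟨t, h⟩), if_neg]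
            rintro (⟨t₁, t', n', hc, h⟩ | ⟨n, q, q', hc, -⟩)
            · cases hc; exact hv ⟨_, h⟩
            · cases hc
          rw [hans, if_pos rfl]
          rcases invoke_cases (rfl : (st.withFlags a b).invoke ⟨.array (.read t n), .read idx C⟩ v = _)
            with ⟨t, t', n, hc, h, -⟩ | ⟨n, q, q', hc, -⟩ | ⟨h, -, hc, -⟩ | hc
          · cases hc; exact (hv ⟨_, h⟩).elim
          · cases hc
          · exact (h _ _ hc.symm).elim
          · exact hc
      · cases h
        cases h3
    · cases ‹ArrayCmd.read _ _ = ArrayCmd.check›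
    · cases h
  by_cases hq : ∃ n q, c = .quant (.check n q)
  · obtain ⟨n, q, rfl⟩ := hq
    simp only [invoke, if_true, execQuant, Option.bind_eq_bind, Option.bind_eq_some_iff] at h
    obtain ⟨y, hy, Ls, hL, h⟩ := h
    split_ifs at h with hc
    · cases h
      refine ⟨?_, fun _ h => by rw [ha h]; simp [arrDeviates]⟩
      by_cases hv : ∃ q', v = .quant (.check n q')
      · obtain ⟨q', rfl⟩ := hv
        have hans : simAnswer (F := F) (.quant (.check n q)) (.quant (.check n q')) a b = .ok := by
          unfold simAnswer
          split_ifs <;> simp_all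
        have had : arrDeviates (F := F) (.quant (.check n q)) (.quant (.check n q')) a = a := by
          simp [arrDeviates]
        rw [hans, had]
        have hL' : (st.withFlags a b).quants = some Ls := hL
        have hy' : (st.withFlags a b).getSym n = some y := hy
        simp only [invoke, if_true, execQuant, hL', hy', Option.bind_eq_bind, Option.bind_some,
          reduceCtorEq, if_false]
        by_cases ht : q = q'
        · subst ht
          rw [if_pos ⟨rfl, hc.2⟩]
          simp [quantDeviates]
        · rw [if_neg (fun h => ht h.1)]
          simp [Ne.symm ht, withFlags, quantDeviates, hL]
      · have hans : simAnswer (.quant (.check n q)) v a b = .abort := by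
          unfold simAnswer
          rw [if_neg (fun h => hv ⟨q, h⟩), if_neg]
          rintro (⟨t₁, t', n', hc, h⟩ | ⟨n, q, q', hc, h⟩)
          · cases hc
          · cases hc; exact hv ⟨_, h⟩
        rw [hans, if_pos rfl]
        rcases invoke_cases (rfl : (st.withFlags a b).invoke ⟨.quant (.check n q), p⟩ v = _)
          with ⟨t, t', n, hc, -⟩ | ⟨n, q, q', hc, h, -⟩ | ⟨-, h, hc, -⟩ | hc
        · cases hc
        · cases hc; exact (hv ⟨_, h⟩).elim
        · exact (h _ _ hc.symm).elim
        · exact hc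
    · cases h
      cases h4
  have hab : arrDeviates c v a = a ∧ quantDeviates c v b = b := by
    simp [arrDeviates, quantDeviates, hr, hq]
  have hne : ∀ t n, c ≠ .array (.read t n) := fun t n hc => hr ⟨t, n, hc⟩
  have hnq : ∀ n q, c ≠ .quant (.check n q) := fun n q hc => hq ⟨n, q, hc⟩
  rw [hab.1, hab.2]
  rw [invoke_self _ _ hne hnq] at h
  simp only at h
  by_cases hv : v = c
  · subst hv
    rw [show State.invoke (st.withFlags a b) ⟨v, p⟩ v = (st.withFlags a b).execCmd v p from
      invoke_self _ ⟨v, p⟩ hne hnq]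
    by_cases hs : v.Silent
    · have hans : simAnswer v v a b = .ok := by
        rw [simAnswer, if_pos rfl, if_neg hs.ne.2.2.1, if_neg hs.ne.2.2.2]
      rw [execCmd_withFlags hs, h, hans]
      have hg : v.goodResp = .ok := by
        unfold Cmd.goodResp
        split
        · exact hs.elim
        · exact hs.elim
        · rfl
      refine ⟨by simp [hg], fun _ hn => ha ?_⟩
      rcases v with v | v | v | v | v | v
      · exact (invoke_plain (v := .ord v) trivial h₀).2.1 ▸ hn
      · exact (invoke_plain (v := .clause v) trivial h₀).2.1 ▸ hn
      · exact hs.elim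
      · cases v with
        | setup e u =>
          simp only [execCmd, execQuant] at h
          split_ifs at h <;> cases h <;> exact hn
        | _ => exact hs.elim
      · cases v with
        | compare op i j => exact (invoke_plain (v := .zk (.compare op i j)) trivial h₀).2.1 ▸ hn
        | _ => exact hs.elim
      · exact hs.elim
    · rcases v with v | v | v | v | v | v
      · exact (hs trivial).elim
      · exact (hs trivial).elim
      · cases v with
        | setup cs =>
          -- The setup clears the flag of the array, which `ha` says is not set before it.
          simp only [execCmd, execArray, Option.bind_eq_bind, Option.bind_eq_some_iff] at h ⊢
          obtain ⟨Cs, hCs, h⟩ := h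
          have hCs' : cs.mapM (st.withFlags a b).getClause = some Cs := hCs
          have harr' : (st.withFlags a b).arr = st.arr := rfl
          rw [hCs', Option.bind_some, harr']
          have hans : simAnswer (F := F) (.array (.setup cs)) (.array (.setup cs)) a b = .ok := by
            simp [simAnswer]
          rw [hans]
          by_cases hn : st.arr = none
          · rw [if_pos hn] at h ⊢
            cases h
            rw [ha hn, if_neg (by simp)]
            exact ⟨rfl, fun _ _ => rfl⟩
          · rw [if_neg hn] at h ⊢
            cases h
            rw [if_neg (by simp)]
            exact ⟨rfl, fun _ h => (hn h).elim⟩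
        | read t n => exact (hne _ _ rfl).elim
        | check =>
          simp only [execCmd, execArray, Option.map_eq_some_iff, Prod.mk.injEq] at h ⊢
          obtain ⟨r, hr, rfl, rfl⟩ := h
          -- The honest prover does not ask to be caught, since its check is answered `honest`.
          have hp : p = .proceed := by
            cases p <;> simp_all [answer, Cmd.goodResp]
          subst hp
          refine ⟨?_, fun _ => ha⟩
          cases a <;> simp [answer, simAnswer, withFlags]
      · cases v with
        | setup e u => exact (hs trivial).elim
        | check n q => exact (hnq _ _ rfl).elim
        | final =>
          simp only [execCmd, execQuant, Option.map_eq_some_iff, Prod.mk.injEq] at h ⊢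
          obtain ⟨r, hr, rfl, rfl⟩ := h
          have hp : p = .proceed := by
            cases p <;> simp_all [answer, Cmd.goodResp]
          subst hp
          refine ⟨?_, fun _ => ha⟩
          cases b <;> simp [answer, simAnswer, withFlags]
      · cases v with
        | compare op i j => exact (hs trivial).elim
        | _ => exact hm.elim
      · exact hm.elim
  · have : simAnswer c v a b = .abort := by
      rw [simAnswer, if_neg hv, if_neg]
      rintro (⟨t, t', n, hc, -⟩ | ⟨n, q, q', hc, -⟩)
      · exact hne _ _ hc
      · exact hnq _ _ hc
    simp only [this, if_true, ne_eq, not_true, false_imp_iff, and_true]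
    rcases invoke_cases (rfl : (st.withFlags a b).invoke ⟨c, p⟩ v = _) with
      ⟨t, t', n, hc, -⟩ | ⟨n, q, q', hc, -⟩ | ⟨-, -, hc, -⟩ | hc
    · exact (hne _ _ hc).elim
    · exact (hnq _ _ hc).elim
    · exact (hv hc.symm).elim
    · exact hc

end

section

variable {F : Type} {x : Stmt} {π : List Step}

/-! ### Encodings of commands are injective -/

open Data

theorem tag_inj {k k' : ℕ} {l l' : List Data} : tag k l = tag k' l' ↔ k = k' ∧ l = l' := by
  rw [tag, tag, Data.cons.injEq, ofNat_injective.eq_iff, ofList_injective.eq_iff]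

theorem Lit.enc_injective : Function.Injective Lit.enc := by
  rintro ⟨v, s⟩ ⟨v', s'⟩ h
  simp only [Lit.enc, Data.cons.injEq] at h
  rw [ofBits_injective h.1, ofBool_injective h.2]

theorem encClause_injective : Function.Injective encClause := by
  intro C D h
  have := (List.map_injective_iff.2 Lit.enc_injective) (ofList_injective h)
  rw [← Finset.sort_toFinset (· ≤ ·) (s := C), this, Finset.sort_toFinset]

theorem Sym.enc_injective : Function.Injective Sym.enc := by
  intro s t h
  cases s <;> cases t <;> simp [Sym.enc, tag_inj, Lit.enc_injective.eq_iff] at h ⊢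
  exact h

theorem Name.enc_injective : Function.Injective Name.enc := by
  intro s t h
  cases s <;> cases t <;>
    simp only [Name.enc, tag_inj, List.cons.injEq, ofNat_injective.eq_iff, Nat.reduceEqDiff,
      false_and, and_true, true_and] at h <;> simp only [h]

theorem CmpOp.enc_injective : Function.Injective CmpOp.enc := by
  intro s t h
  cases s <;> cases t <;> first | rfl | cases h

theorem encNames_injective : Function.Injective encNames := fun _ _ h =>
  (List.map_injective_iff.2 Name.enc_injective) (ofList_injective h)

/-- Commands that the protocol uses can be compared by comparing their encodings. This fails for the
other commands, all of which have the same encoding. -/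
theorem Cmd.enc_inj {c v : Cmd F} (hc : c.Used) : c.enc = v.enc ↔ v = c := by
  refine ⟨fun h => ?_, fun h => h ▸ rfl⟩
  rcases c with c | c | c | c | c | c <;> cases c <;> first | exact hc.elim | skip
  all_goals
    rcases v with v | v | v | v | v | v <;> cases v <;>
    simp only [Cmd.enc, tag_inj, List.cons.injEq, ofNat_injective.eq_iff, Nat.reduceEqDiff,
      false_and, and_true, true_and, Name.enc_injective.eq_iff, encClause_injective.eq_iff,
      encNames_injective.eq_iff, Quant.enc_injective.eq_iff, CmpOp.enc_injective.eq_iff,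
      ofList_injective.eq_iff, (List.map_injective_iff.2 Sym.enc_injective).eq_iff,
      (List.map_injective_iff.2 ofBits_injective).eq_iff] at h <;> simp only [h]

theorem Cmd.enc_hd_eq_ten {c : Cmd F} :
    c.enc.hd = ofNat 10 ↔ ∃ t n, c = .array (.read t n) := by
  rcases c with c | c | c | c | c | c <;> cases c <;>
    simp [Cmd.enc, tag, ofNat_injective.eq_iff]

theorem Cmd.enc_hd_eq_eleven {c : Cmd F} : c.enc.hd = ofNat 11 ↔ c = .array .check := by
  rcases c with c | c | c | c | c | c <;> cases c <;>
    simp [Cmd.enc, tag, ofNat_injective.eq_iff]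

theorem Cmd.enc_hd_eq_thirteen {c : Cmd F} :
    c.enc.hd = ofNat 13 ↔ ∃ n q, c = .quant (.check n q) := by
  rcases c with c | c | c | c | c | c <;> cases c <;>
    simp [Cmd.enc, tag, ofNat_injective.eq_iff]

theorem Cmd.enc_hd_eq_fourteen {c : Cmd F} : c.enc.hd = ofNat 14 ↔ c = .quant .final := by
  rcases c with c | c | c | c | c | c <;> cases c <;>
    simp [Cmd.enc, tag, ofNat_injective.eq_iff]

theorem Resp.dec_enc (r : Resp) : Resp.dec r.enc = r := by
  cases r <;> simp [Resp.dec, Resp.enc, ofNat_injective.eq_iff]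

/-! ### The simulator -/

/-- One pass of the simulator over an entry `e` of the view. The state holds the encoded commands
of the protocol that are still to come, and the two flags. -/
def simStep (e s : Data) : Data :=
  cons s.hd.tl (cons
    (if s.hd.hd.hd = ofNat 10 then if s.hd.hd = e.hd then s.tl.hd else ofBool true else s.tl.hd)
    (if s.hd.hd.hd = ofNat 13 then if s.hd.hd = e.hd then s.tl.tl else ofBool true else s.tl.tl))

/-- The encoded answer to the encoded command `v` in the state `s` of the simulator. -/
def simReply (s v : Data) : Data :=
  if s.hd.hd = v then
    if v.hd = ofNat 11 then if s.tl.hd = nil then Resp.honest.enc else Resp.cheating.enc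
    else if v.hd = ofNat 14 then if s.tl.tl = nil then Resp.honest.enc else Resp.cheating.enc
    else Resp.ok.enc
  else if s.hd.hd.hd = v.hd then
    if v.hd = ofNat 10 then if s.hd.hd.tl.tl = v.tl.tl then Resp.ok.enc else Resp.abort.enc
    else if v.hd = ofNat 13 then if s.hd.hd.tl.hd = v.tl.hd then Resp.ok.enc else Resp.abort.enc
    else Resp.abort.enc
  else Resp.abort.enc

/-- The answer of the simulator, from its encoded input. -/
def simData (y : Data) : Data :=
  simReply (fold simStep y.tl.hd (cons (scriptData y.hd) (cons nil nil))) y.tl.tl.hd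

theorem size_simStep (e s : Data) : (simStep e s).size ≤ s.size + 10 := by
  have h1 := size_hd_add_tl s
  have h2 := size_hd_add_tl s.tl
  have h3 := size_tl_le s.hd
  unfold simStep
  have h4 : (ofBool true).size = 3 := rfl
  simp only [size]
  split_ifs <;> omega

theorem polyF_simData : PolyF simData := by
  have h : PolyF fun y => fold simStep y.tl.hd (cons (scriptData y.hd) (cons nil nil)) := by
    refine PolyF.fold (b := fun m s _ => simStep m s) ?_ PolyF.id.tl.hd
      (.cons PolyF.id.hd.scriptData (.cons (.const _) (.const _))) 10 fun m s x => ?_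
    · unfold simStep
      repeat' first
        | with_reducible exact PolyF.const _
        | with_reducible exact PolyF.id
        | with_reducible apply PolyF.hd
        | with_reducible apply PolyF.tl
        | with_reducible apply PolyF.cons
        | with_reducible apply PolyF.ite_eq
    · simpa using size_simStep m s
  refine PolyF.comp (g := fun y => simReply y.hd y.tl) ?_ (h.cons PolyF.id.tl.tl.hd)
  unfold simReply
  repeat' first
    | with_reducible exact PolyF.const _
    | with_reducible exact PolyF.id
    | with_reducible apply PolyF.hd
    | with_reducible apply PolyF.tl
    | with_reducible apply PolyF.cons
    | with_reducible apply PolyF.ite_eq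

/-- The simulator keeps track of the flags of the functionalities. -/
theorem simStep_enc {c : Cmd F} (hc : c.Used) (v : Cmd F) (r : Data) (l : List Data) (a b : Bool) :
    simStep (cons v.enc r) (cons (ofList (c.enc :: l)) (cons (ofBool a) (ofBool b))) =
      cons (ofList l) (cons (ofBool (arrDeviates c v a)) (ofBool (quantDeviates c v b))) := by
  simp only [simStep, ofList_cons, hd_cons, tl_cons, Cmd.enc_inj hc, Cmd.enc_hd_eq_ten,
    Cmd.enc_hd_eq_thirteen, arrDeviates, quantDeviates]
  congr 2 <;> split_ifs <;> simp_all

/-- The simulator answers as the functionalities do with the same flags. -/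
theorem simReply_enc {c : Cmd F} (hc : c.Used) (v : Cmd F) (l : List Data) (a b : Bool) :
    simReply (cons (ofList (c.enc :: l)) (cons (ofBool a) (ofBool b))) v.enc =
      (simAnswer c v a b).enc := by
  simp only [simReply, ofList_cons, hd_cons, tl_cons, Cmd.enc_inj hc, ofBool_eq_nil]
  unfold simAnswer
  by_cases hv : v = c
  · subst hv
    simp only [if_true, Cmd.enc_hd_eq_eleven, Cmd.enc_hd_eq_fourteen]
    cases a <;> cases b <;> simp only [Bool.false_eq_true, if_true, if_false, reduceCtorEq] <;>
      split_ifs <;> rfl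
  · simp only [hv, if_false]
    by_cases h10 : ∃ t n, v = .array (.read t n)
    · obtain ⟨t, n, rfl⟩ := h10
      by_cases hc10 : ∃ t n, c = .array (.read t n)
      · obtain ⟨t', n', rfl⟩ := hc10
        simp [Cmd.enc, tag, Name.enc_injective.eq_iff, apply_ite Resp.enc, eq_comm]
      · rw [if_neg (c := _ ∨ _)]
        · exact if_neg fun h => hc10 (Cmd.enc_hd_eq_ten.1 h)
        · rintro (⟨t, t', n, h, -⟩ | ⟨n, q, q', -, h⟩)
          · exact hc10 ⟨_, _, h⟩
          · cases h
    by_cases h13 : ∃ n q, v = .quant (.check n q)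
    · obtain ⟨n, q, rfl⟩ := h13
      by_cases hc13 : ∃ n q, c = .quant (.check n q)
      · obtain ⟨n', q', rfl⟩ := hc13
        simp [Cmd.enc, tag, Name.enc_injective.eq_iff, ofNat_injective.eq_iff,
          apply_ite Resp.enc, eq_comm]
      · rw [if_neg (c := _ ∨ _)]
        · exact if_neg fun h => hc13 (Cmd.enc_hd_eq_thirteen.1 h)
        · rintro (⟨t, t', n, -, h⟩ | ⟨n, q, q', h, -⟩)
          · cases h
          · exact hc13 ⟨_, _, h⟩
    rw [if_neg (c := _ ∨ _), if_neg (fun h => h10 (Cmd.enc_hd_eq_ten.1 h)),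
      if_neg (fun h => h13 (Cmd.enc_hd_eq_thirteen.1 h))]
    · exact ite_self _
    rintro (⟨t, t', n, -, hv⟩ | ⟨n, q, q', -, hv⟩)
    · exact h10 ⟨_, _, hv⟩
    · exact h13 ⟨_, _, hv⟩

variable {F : Type} {x : Stmt} {π : List Step}

/-! ### Perfect zero knowledge -/

theorem used_of_mem_script {c : Cmd F} (h : c ∈ verifierScript F x) : c.Used := by
  have : ∀ c ∈ verifierScript F x, c.Used := by
    simp only [verifierScript, verifierStep, List.forall_mem_append, List.forall_mem_cons,
      List.forall_mem_map, List.forall_mem_flatMap, Cmd.Used]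
    simp
  exact this c h

/-- The flags after a part `h` of the view in which the protocol has the commands `l`. -/
def flagsAfter : List (Cmd F) → List (Cmd F × Resp) → Bool → Bool → Bool × Bool
  | c :: l, e :: h, a, b => flagsAfter l h (arrDeviates c e.1 a) (quantDeviates c e.1 b)
  | _, _, a, b => (a, b)

theorem fold_simStep {l k : List (Cmd F)} {h : List (Cmd F × Resp)} (hl : ∀ c ∈ l, c.Used)
    (hlen : l.length = h.length) (a b : Bool) :
    fold simStep (ofList (h.map fun r => cons r.1.enc r.2.enc))
        (cons (ofList ((l ++ k).map Cmd.enc)) (cons (ofBool a) (ofBool b))) =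
      cons (ofList (k.map Cmd.enc))
        (cons (ofBool (flagsAfter l h a b).1) (ofBool (flagsAfter l h a b).2)) := by
  induction l generalizing h a b with
  | nil =>
    obtain rfl := List.eq_nil_of_length_eq_zero hlen.symm
    rfl
  | cons c l ih =>
    cases h with
    | nil => cases hlen
    | cons e h =>
      rw [List.map_cons, ofList_cons, fold, List.cons_append, List.map_cons,
        simStep_enc (hl c List.mem_cons_self)]
      exact ih (fun c hc => hl c (List.mem_cons_of_mem _ hc)) (by simpa using hlen) _ _

theorem flagsAfter_append {l : List (Cmd F)} {h : List (Cmd F × Resp)}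
    (hlen : l.length = h.length) (c : Cmd F) (e : Cmd F × Resp) (a b : Bool) :
    flagsAfter (l ++ [c]) (h ++ [e]) a b =
      (arrDeviates c e.1 (flagsAfter l h a b).1, quantDeviates c e.1 (flagsAfter l h a b).2) := by
  induction l generalizing h a b with
  | nil =>
    obtain rfl := List.eq_nil_of_length_eq_zero hlen.symm
    rfl
  | cons d l ih =>
    cases h with
    | nil => cases hlen
    | cons f h => exact ih (by simpa using hlen) _ _

theorem simData_input {l k : List (Cmd F)} {c : Cmd F} {h : List (Cmd F × Resp)}
    (hs : verifierScript F x = l ++ c :: k) (hlen : l.length = h.length) (v : Cmd F) :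
    simData (simulatorInput x h v) =
      (simAnswer c v (flagsAfter l h false false).1 (flagsAfter l h false false).2).enc := by
  have hu : ∀ e ∈ l ++ c :: k, e.Used := fun e he => used_of_mem_script (x := x) (hs ▸ he)
  have := fold_simStep (k := c :: k) (fun c hc => hu c (List.mem_append_left _ hc)) hlen false false
  rw [simData]
  simp only [simulatorInput, ofList_cons, hd_cons, tl_cons, scriptData_enc (F := F), hs]
  rw [show fold simStep _ (cons _ (cons Data.nil Data.nil)) = _ from this]
  exact simReply_enc (hu c (by simp)) v _ _ _

/-- The functionalities with the honest prover and the simulator answer alike from any point of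
the execution on. -/
theorem execFrom_eq_simFrom [Field F] {S : List (Cmd F × Resp) → Cmd F → Resp}
    (hS : ∀ h v, S h v = Resp.dec (simData (simulatorInput x h v))) (V : Verifier F)
    {l₀ l : List (PMsg F)} {st st' : State F} {tr : List (Round F)} {a b : Bool}
    (h : HonestRun st l st') (hl : proverScript F x π = l₀ ++ l) (hlen : l₀.length = tr.length)
    (hf : flagsAfter (l₀.map PMsg.cmd) (view tr) false false = (a, b))
    (ha : st.arr = none → a = false) :
    (execFrom (honestProver x π) V l.length (st.withFlags a b) tr).map view =
      simFrom S V l.length (view tr) := by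
  induction l generalizing st tr l₀ a b with
  | nil => exact PMF.pure_map _ _
  | cons m l ih =>
    obtain ⟨s, hs, h3, h4, h⟩ := h
    have hm : (proverScript F x π).getD tr.length default = m := by
      rw [hl, ← hlen]; simp
    have hscript : verifierScript F x = l₀.map PMsg.cmd ++ m.cmd :: l.map PMsg.cmd := by
      rw [← map_cmd_proverScript (F := F) (x := x) (π := π), hl, List.map_append, List.map_cons]
    have hlen' : (l₀.map PMsg.cmd).length = (view tr).length := by simpa [view] using hlen
    have hview : tr.map (fun r => (r.v, r.toV)) = view tr := rfl
    simp only [List.length_cons, execFrom, simFrom, honestProver, PMF.pure_bind, List.length_map,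
      hm, hview, PMF.map_bind]
    congr 1
    funext v
    obtain ⟨h5, h6⟩ := State.invoke_withFlags (used_of_mem_script (x := x) (by simp [hscript]))
      hs h3 h4 (b := b) ha v
    have hans : S (view tr) v = simAnswer m.cmd v a b := by
      rw [hS, simData_input hscript hlen', Resp.dec_enc, hf]
    have hv : ∀ r : Round F, view (tr ++ [r]) = view tr ++ [(r.v, r.toV)] := fun r => by
      simp [view]
    rw [State.round, h5, hans]
    by_cases hab : simAnswer m.cmd v a b = .abort
    · simp only [hab, if_true, PMF.pure_map, hv]
    · simp only [hab, if_false]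
      have := ih (l₀ := l₀ ++ [m]) (tr := tr ++ [⟨m, v, .ok, simAnswer m.cmd v a b⟩]) h
        (by simp [hl]) (by simp [hlen])
        (by rw [hv, List.map_append, List.map_cons, List.map_nil, flagsAfter_append hlen', hf])
        (h6 hab)
      rw [hv] at this
      exact this

theorem zeroKnowledge (F : Type) [Field F] : ZeroKnowledge F := by
  obtain ⟨S, hS, h⟩ := polyF_simData
  refine ⟨S, hS, fun x π hx hr V => ?_⟩
  obtain ⟨st', hrun⟩ := honestRun_proverScript (F := F) hx hr
  have := execFrom_eq_simFrom (S := fun h v => Resp.dec (S.run (simulatorInput x h v)))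
    (fun h' v => by rw [h]) V (l₀ := []) (tr := []) hrun rfl rfl rfl (fun _ => rfl)
  rw [length_proverScript] at this
  exact this

end

end QRes

end

theorem theorem4 (F : Type) [Field F] [Fintype F] :
    QRes.EfficientVerifier F ∧ QRes.Complete F ∧ QRes.Sound F ∧
      QRes.KnowledgeSound F ∧ QRes.ZeroKnowledge F :=
  ⟨QRes.efficientVerifier F, QRes.complete F, QRes.sound F, QRes.knowledgeSound F,
    QRes.zeroKnowledge F⟩
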